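/- Let $n\ge 0$, $p\in\mathbb{C}^n$ and $\hbar>0$. For multiindices write $\partial^R\bar\partial^S=\partial^{|R|+|S|}/\partial z^R\partial\bar z^S$. For $f\in C^\infty(\mathbb{C}^n)$, multiindices $R,S$, $m\in\mathbb{N}$ and $0\le\ell\le 2^m-1$ define $h_{m,\ell,R,S}(f)\in[0,\infty]$ recursively by $$h_{0,0,R,S}(f)=\sum_{N}\frac{(2\hbar)^{|R|+|S|+|N|}}{N!}\,\bigl|\partial^R\bar\partial^{N+S}f(p)\bigr|^2,$$ $$h_{m,\ell,R,S}(f)=\sum_N\frac1{N!}\Bigl(\sum_{I\le R}\sum_{J\le N+S}\binom RI\binom{N+S}J\,h_{m-1,\ell/2,I,J}(f)\Bigr)^2\quad(\ell\text{ even}),$$ $$h_{m,\ell,R,S}(f)=\sum_N\frac1{N!}\Bigl(\sum_{I\le R}\sum_{J\le N+S}\binom RI\binom{N+S}J\,h_{m-1,(\ell-1)/2,J,I}(f)\Bigr)^2\quad(\ell\text{ odd}),$$ and let $\|f\|_{m,\ell,R,S}=h_{m,\ell,R,S}(f)^{1/2^{m+1}}$. Let $\tilde{\mathcal A}_{p,\hbar}$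 be the space of all $f\in C^\infty(\mathbb{C}^n)$ for which all $\|f\|_{m,\ell,R,S}$ are finite. Let $\mathcal A_{p,\hbar}$ be the space of the real-analytic functions in $\tilde{\mathcal A}_{p,\hbar}$, with the locally convex topology of the seminorms $\|\cdot\|_{m,\ell,R,S}$. Every $f\in\tilde{\mathcal A}_{p,\hbar}$ has the same infinite jet at $p$ as exactly one element of $\mathcal A_{p,\hbar}$, so that $\mathcal A_{p,\hbar}$ is the quotient of $\tilde{\mathcal A}_{p,\hbar}$ by the functions with vanishing infinite jet at $p$. Every $f\in\mathcal A_{p,\hbar}$ has a unique extension $\hat f(z,\bar v)$ to $\mathbb{C}^n\times\mathbb{C}^n$ that is holomorphic in $z$, anti-holomorphic in $v$, and satisfies $\hat f(z,\bar z)=f(z)$. Put $(\tau_\alpha f)(z)=\hat f(z+\alpha,\bar z)$ and $(\bar\tau_{\bar\alpha}f)(z)=\hat f(z,\bar z+\bar\alpha)$ for $\alpha\in\mathbb{C}^n$. For $f,g\in\mathcal A_{p,\hbar}$ the series $$f\star g=\sum_N\frac{(2\hbar)^{|N|}}{N!}\,\frac{\partial^{|N|}f}{\partial z^N}\,\frac{\partial^{|N|}g}{\partial\bar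 z^N}$$ converges absolutely in the topology of $\mathcal A_{p,\hbar}$ (and pointwise to the same sum). With this product and with complex conjugation as the involution, $\mathcal A_{p,\hbar}$ is an associative $*$-algebra with unit $1$ in which the product and the involution are continuous. For $\alpha,\beta\in\mathbb{C}^n$ write $\bar\alpha\beta=\sum_i\bar\alpha_i\beta_i$ and let $\mathsf e_{\bar\alpha,\beta}(z)=e^{\hbar\bar\alpha\beta}\,e^{\bar\alpha z+\beta\bar z}$. These functions belong to $\mathcal A_{p,\hbar}$. For all $\alpha,\beta,\gamma,\delta\in\mathbb{C}^n$ and $f\in\mathcal A_{p,\hbar}$: 1. $\mathsf e_{\bar\alpha,\beta}\star\mathsf e_{\bar\gamma,\delta}=e^{\hbar(\bar\alpha\delta-\beta\bar\gamma)}\,\mathsf e_{\bar\alpha+\bar\gamma,\beta+\delta}$. 2. $\mathsf e_{\bar\alpha,\beta}\star f=\mathsf e_{\bar\alpha,\beta}\cdot\bar\tau_{2\hbar\bar\alpha}f$. 3. $f\star\mathsf e_{\bar\alpha,\beta}=\mathsf e_{\bar\alpha,\beta}\cdot\tau_{2\hbar\beta}f$. 4. $\tau_\alpha$ and $\bar\tau_{\bar\alpha}$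 are continuous linear bijections of $\mathcal A_{p,\hbar}$ onto itself, with continuous inverses. For $w\in\mathbb{C}^n$ let $u_w=\mathsf e_{\bar w/2\hbar,\,-w/2\hbar}$. Then $u_w$ is a unitary element of $\mathcal A_{p,\hbar}$, that is, $u_w\star\overline{u_w}=1=\overline{u_w}\star u_w$. The translation group $\mathbb{C}^n$ acts on $\mathcal A_{p,\hbar}$ by the pull-backs $(T_w^*f)(z)=f(z+w)$, with $T_0^*=\mathrm{id}$ and $T_{v+w}^*=T_v^*T_w^*$. Each $T_w^*$ is a linear $*$-automorphism of the unital $*$-algebra $\mathcal A_{p,\hbar}$, continuous together with its inverse, and it is inner: $T_w^*f=u_w\star f\star\overline{u_w}=u_w\star f\star u_w^{-1}$. -/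

import Mathlib

open scoped ContDiff ENNReal

noncomputable section

namespace WickStar

/-- Multiindices `R = (r_1, …, r_n)`. -/
abbrev MultiIndex (n : ℕ) : Type := Fin n → ℕ

/-- `|R| = r_1 + ⋯ + r_n`. -/
def deg {n : ℕ} (R : MultiIndex n) : ℕ := ∑ i, R i

/-- `R! = r_1! ⋯ r_n!`. -/
def fact {n : ℕ} (R : MultiIndex n) : ℕ := ∏ i, (R i).factorial

/-- The multiindex binomial coefficient `∏ i, (r_i choose s_i)`. -/
def binom {n : ℕ} (R S : MultiIndex n) : ℕ := ∏ i, (R i).choose (S i)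

/-- The Wirtinger derivative `∂/∂z^i = (∂/∂x^i - √-1 ∂/∂y^i) / 2`. -/
def dz {n : ℕ} (i : Fin n) (f : (Fin n → ℂ) → ℂ) : (Fin n → ℂ) → ℂ := fun z =>
  (1 / 2 : ℂ) * (fderiv ℝ f z (Pi.single i 1) - Complex.I * fderiv ℝ f z (Pi.single i Complex.I))

/-- The Wirtinger derivative `∂/∂z̄^i = (∂/∂x^i + √-1 ∂/∂y^i) / 2`. -/
def dzbar {n : ℕ} (i : Fin n) (f : (Fin n → ℂ) → ℂ) : (Fin n → ℂ) → ℂ := fun z =>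
  (1 / 2 : ℂ) * (fderiv ℝ f z (Pi.single i 1) + Complex.I * fderiv ℝ f z (Pi.single i Complex.I))

/-- `∂^{|R|}/∂z^R`: apply `∂/∂z^i` exactly `r_i` times, for `i = n, …, 1`. -/
def dzPow {n : ℕ} (R : MultiIndex n) (f : (Fin n → ℂ) → ℂ) : (Fin n → ℂ) → ℂ :=
  (List.finRange n).foldr (fun i g => (dz i)^[R i] g) f

/-- `∂^{|S|}/∂z̄^S`. -/
def dzbarPow {n : ℕ} (S : MultiIndex n) (f : (Fin n → ℂ) → ℂ) : (Fin n → ℂ) → ℂ :=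
  (List.finRange n).foldr (fun i g => (dzbar i)^[S i] g) f

/-- `∂^{|R|+|S|} f / ∂z^R ∂z̄^S`. -/
def dMixed {n : ℕ} (R S : MultiIndex n) (f : (Fin n → ℂ) → ℂ) : (Fin n → ℂ) → ℂ :=
  dzPow R (dzbarPow S f)

/-- The quantities `h_{m,ℓ,R,S}(f) ∈ [0,∞]` at the point `p`; they are used for `ℓ < 2 ^ m`. -/
def hQuant {n : ℕ} (p : Fin n → ℂ) (hbar : ℝ) (f : (Fin n → ℂ) → ℂ) :
    ℕ → ℕ → MultiIndex n → MultiIndex n → ℝ≥0∞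
  | 0, _, R, S =>
      ∑' N : MultiIndex n,
        ENNReal.ofReal ((2 * hbar) ^ (deg R + deg S + deg N) / (fact N : ℝ)) *
          ‖dMixed R (N + S) f p‖ₑ ^ 2
  | m + 1, l, R, S =>
      if Even l then
        ∑' N : MultiIndex n, (fact N : ℝ≥0∞)⁻¹ *
          (∑ I ∈ Finset.Iic R, ∑ J ∈ Finset.Iic (N + S),
            (binom R I : ℝ≥0∞) * (binom (N + S) J : ℝ≥0∞) *
              hQuant p hbar f m (l / 2) I J) ^ 2
      else
        ∑' N : MultiIndex n, (fact N : ℝ≥0∞)⁻¹ *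
          (∑ I ∈ Finset.Iic R, ∑ J ∈ Finset.Iic (N + S),
            (binom R I : ℝ≥0∞) * (binom (N + S) J : ℝ≥0∞) *
              hQuant p hbar f m ((l - 1) / 2) J I) ^ 2

/-- `‖f‖_{m,ℓ,R,S} = h_{m,ℓ,R,S}(f) ^ (1 / 2^(m+1)) ∈ [0,∞]`. -/
def eSeminorm {n : ℕ} (p : Fin n → ℂ) (hbar : ℝ) (m l : ℕ) (R S : MultiIndex n)
    (f : (Fin n → ℂ) → ℂ) : ℝ≥0∞ :=
  hQuant p hbar f m l R S ^ (((2 : ℝ) ^ (m + 1))⁻¹)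

/-! ### The `eSeminorm`s are seminorms on smooth functions -/

section SeminormFacts

variable {n : ℕ} (p : Fin n → ℂ) (hbar : ℝ)

theorem dz_add (i : Fin n) {f g : (Fin n → ℂ) → ℂ} (hf : ContDiff ℝ ∞ f) (hg : ContDiff ℝ ∞ g) :
    dz i (f + g) = dz i f + dz i g := by
  ext z
  have h1 := (hf.differentiable (by simp)) z
  have h2 := (hg.differentiable (by simp)) z
  simp only [dz, Pi.add_apply, fderiv_add h1 h2, add_apply]
  ring

theorem dzbar_add (i : Fin n) {f g : (Fin n → ℂ) → ℂ} (hf : ContDiff ℝ ∞ f)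
    (hg : ContDiff ℝ ∞ g) : dzbar i (f + g) = dzbar i f + dzbar i g := by
  ext z
  have h1 := (hf.differentiable (by simp)) z
  have h2 := (hg.differentiable (by simp)) z
  simp only [dzbar, Pi.add_apply, fderiv_add h1 h2, add_apply]
  ring

theorem dz_smul (i : Fin n) (c : ℂ) {f : (Fin n → ℂ) → ℂ} (hf : ContDiff ℝ ∞ f) :
    dz i (c • f) = c • dz i f := by
  ext z
  have h1 := (hf.differentiable (by simp)) z
  simp only [dz, Pi.smul_apply, fderiv_const_smul h1 c, smul_apply, smul_eq_mul]
  ring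

theorem dzbar_smul (i : Fin n) (c : ℂ) {f : (Fin n → ℂ) → ℂ} (hf : ContDiff ℝ ∞ f) :
    dzbar i (c • f) = c • dzbar i f := by
  ext z
  have h1 := (hf.differentiable (by simp)) z
  simp only [dzbar, Pi.smul_apply, fderiv_const_smul h1 c, smul_apply,
    smul_eq_mul]
  ring

theorem contDiff_dz (i : Fin n) {f : (Fin n → ℂ) → ℂ} (hf : ContDiff ℝ ∞ f) :
    ContDiff ℝ ∞ (dz i f) := by
  have h : ContDiff ℝ ∞ (fderiv ℝ f) := hf.fderiv_right (by simp)
  unfold dz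
  exact contDiff_const.mul ((h.clm_apply contDiff_const).sub
    (contDiff_const.mul (h.clm_apply contDiff_const)))

theorem contDiff_dzbar (i : Fin n) {f : (Fin n → ℂ) → ℂ} (hf : ContDiff ℝ ∞ f) :
    ContDiff ℝ ∞ (dzbar i f) := by
  have h : ContDiff ℝ ∞ (fderiv ℝ f) := hf.fderiv_right (by simp)
  unfold dzbar
  exact contDiff_const.mul ((h.clm_apply contDiff_const).add
    (contDiff_const.mul (h.clm_apply contDiff_const)))

/-- Iterates of operators that are linear on smooth functions are linear on smooth functions. -/
theorem foldr_linear (D : Fin n → ((Fin n → ℂ) → ℂ) → ((Fin n → ℂ) → ℂ))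
    (hD : ∀ i f, ContDiff ℝ ∞ f → ContDiff ℝ ∞ (D i f))
    (hadd : ∀ i f g, ContDiff ℝ ∞ f → ContDiff ℝ ∞ g → D i (f + g) = D i f + D i g)
    (hsmul : ∀ i (c : ℂ) f, ContDiff ℝ ∞ f → D i (c • f) = c • D i f)
    (R : MultiIndex n) (L : List (Fin n)) {f g : (Fin n → ℂ) → ℂ} (c : ℂ)
    (hf : ContDiff ℝ ∞ f) (hg : ContDiff ℝ ∞ g) :
    ContDiff ℝ ∞ (L.foldr (fun i g => (D i)^[R i] g) f) ∧
    L.foldr (fun i g => (D i)^[R i] g) (f + g) =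
      L.foldr (fun i g => (D i)^[R i] g) f + L.foldr (fun i g => (D i)^[R i] g) g ∧
    L.foldr (fun i g => (D i)^[R i] g) (c • f) =
      c • L.foldr (fun i g => (D i)^[R i] g) f := by
  have iter : ∀ (i : Fin n) (k : ℕ) (f g : (Fin n → ℂ) → ℂ), ContDiff ℝ ∞ f → ContDiff ℝ ∞ g →
      ContDiff ℝ ∞ ((D i)^[k] f) ∧ (D i)^[k] (f + g) = (D i)^[k] f + (D i)^[k] g ∧
      (D i)^[k] (c • f) = c • (D i)^[k] f := by
    intro i k
    induction k with
    | zero => intro f g hf _; exact ⟨hf, rfl, rfl⟩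
    | succ k ih =>
      intro f g hf hg
      have := ih (D i f) (D i g) (hD i f hf) (hD i g hg)
      simp only [Function.iterate_succ, Function.comp_apply, hadd i f g hf hg, hsmul i c f hf]
      exact this
  have smooth : ∀ (L : List (Fin n)) (f : (Fin n → ℂ) → ℂ), ContDiff ℝ ∞ f →
      ContDiff ℝ ∞ (L.foldr (fun i g => (D i)^[R i] g) f) := by
    intro L f hf
    induction L with
    | nil => exact hf
    | cons i L ih => exact (iter i (R i) _ _ ih ih).1
  refine ⟨smooth L f hf, ?_, ?_⟩
  · induction L with
    | nil => rfl
    | cons i L ih =>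
      simp only [List.foldr_cons, ih]
      exact (iter i (R i) _ _ (smooth L f hf) (smooth L g hg)).2.1
  · induction L with
    | nil => rfl
    | cons i L ih =>
      simp only [List.foldr_cons, ih]
      exact (iter i (R i) _ _ (smooth L f hf) (smooth L f hf)).2.2

theorem contDiff_dzbarPow (S : MultiIndex n) {f : (Fin n → ℂ) → ℂ} (hf : ContDiff ℝ ∞ f) :
    ContDiff ℝ ∞ (dzbarPow S f) :=
  (foldr_linear dzbar (fun i _ => contDiff_dzbar i) (fun i _ _ => dzbar_add i)
    (fun i c _ => dzbar_smul i c) S _ 0 hf hf).1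

theorem dMixed_add (R S : MultiIndex n) {f g : (Fin n → ℂ) → ℂ} (hf : ContDiff ℝ ∞ f)
    (hg : ContDiff ℝ ∞ g) : dMixed R S (f + g) = dMixed R S f + dMixed R S g := by
  have h1 := (foldr_linear dzbar (fun i _ => contDiff_dzbar i) (fun i _ _ => dzbar_add i)
    (fun i c _ => dzbar_smul i c) S (List.finRange n) 0 hf hg).2.1
  have h2 := (foldr_linear dz (fun i _ => contDiff_dz i) (fun i _ _ => dz_add i)
    (fun i c _ => dz_smul i c) R (List.finRange n) 0 (contDiff_dzbarPow S hf)
      (contDiff_dzbarPow S hg)).2.1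
  unfold dMixed dzPow
  rw [← h2]
  unfold dzbarPow
  rw [h1]

theorem dMixed_smul (R S : MultiIndex n) (c : ℂ) {f : (Fin n → ℂ) → ℂ} (hf : ContDiff ℝ ∞ f) :
    dMixed R S (c • f) = c • dMixed R S f := by
  have h1 := (foldr_linear dzbar (fun i _ => contDiff_dzbar i) (fun i _ _ => dzbar_add i)
    (fun i c _ => dzbar_smul i c) S (List.finRange n) c hf hf).2.2
  have h2 := (foldr_linear dz (fun i _ => contDiff_dz i) (fun i _ _ => dz_add i)
    (fun i c _ => dz_smul i c) R (List.finRange n) c (contDiff_dzbarPow S hf)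
      (contDiff_dzbarPow S hf)).2.2
  unfold dMixed dzPow
  rw [← h2]
  unfold dzbarPow
  rw [h1]

/-- Minkowski's inequality for weighted sums. -/
theorem minkowski {ι : Type*} (w x y : ι → ℝ≥0∞) {q : ℝ} (hq : 1 ≤ q) :
    (∑' i, w i * (x i + y i) ^ q) ^ q⁻¹ ≤
      (∑' i, w i * x i ^ q) ^ q⁻¹ + (∑' i, w i * y i ^ q) ^ q⁻¹ := by
  have hq0 : 0 < q := by linarith
  let _ : MeasurableSpace ι := ⊤
  have key := ENNReal.lintegral_Lp_add_le (μ := MeasureTheory.Measure.count)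
    (f := fun i => w i ^ q⁻¹ * x i) (g := fun i => w i ^ q⁻¹ * y i)
    (measurable_from_top).aemeasurable (measurable_from_top).aemeasurable hq
  simp only [MeasureTheory.lintegral_count, Pi.add_apply, ← mul_add,
    ENNReal.mul_rpow_of_nonneg _ _ hq0.le, ENNReal.rpow_inv_rpow hq0.ne', one_div] at key
  exact key

theorem minkowski_finset {ι : Type*} (s : Finset ι) (w x y : ι → ℝ≥0∞) {q : ℝ} (hq : 1 ≤ q) :
    (∑ i ∈ s, w i * (x i + y i) ^ q) ^ q⁻¹ ≤
      (∑ i ∈ s, w i * x i ^ q) ^ q⁻¹ + (∑ i ∈ s, w i * y i ^ q) ^ q⁻¹ := by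
  have key := minkowski (fun i : s => w i) (fun i => x i) (fun i => y i) hq
  simpa only [tsum_fintype, Finset.sum_coe_sort s (fun i => w i * (x i + y i) ^ q),
    Finset.sum_coe_sort s (fun i => w i * x i ^ q),
    Finset.sum_coe_sort s (fun i => w i * y i ^ q)] using key

/-- The recursion step: mixed norms of subadditive quantities are subadditive. -/
theorem step_add {ι κ : Type*} (s : κ → Finset ι) (w : κ → ℝ≥0∞) (c a b d : κ → ι → ℝ≥0∞) {q : ℝ}
    (hq : 1 ≤ q) (hd : ∀ N i, d N i ^ q⁻¹ ≤ a N i ^ q⁻¹ + b N i ^ q⁻¹) :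
    (∑' N, w N * (∑ i ∈ s N, c N i * d N i) ^ 2) ^ (q * 2)⁻¹ ≤
      (∑' N, w N * (∑ i ∈ s N, c N i * a N i) ^ 2) ^ (q * 2)⁻¹ +
        (∑' N, w N * (∑ i ∈ s N, c N i * b N i) ^ 2) ^ (q * 2)⁻¹ := by
  have hq0 : 0 < q := by linarith
  have sq : ∀ t : ℝ≥0∞, t ^ 2 = (t ^ q⁻¹) ^ (q * 2) := fun t => by
    rw [← ENNReal.rpow_mul, inv_mul_cancel_left₀ hq0.ne', ENNReal.rpow_two]
  have inner : ∀ N, (∑ i ∈ s N, c N i * d N i) ^ q⁻¹ ≤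
      (∑ i ∈ s N, c N i * a N i) ^ q⁻¹ + (∑ i ∈ s N, c N i * b N i) ^ q⁻¹ := fun N => by
    have key := minkowski_finset (s N) (c N) (fun i => a N i ^ q⁻¹) (fun i => b N i ^ q⁻¹) hq
    simp only [ENNReal.rpow_inv_rpow hq0.ne'] at key
    refine le_trans ?_ key
    refine ENNReal.rpow_le_rpow (Finset.sum_le_sum fun i _ => ?_) (by positivity)
    gcongr
    calc d N i = (d N i ^ q⁻¹) ^ q := (ENNReal.rpow_inv_rpow hq0.ne' _).symm
      _ ≤ _ := ENNReal.rpow_le_rpow (hd N i) hq0.le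
  simp only [sq]
  refine le_trans ?_ (minkowski w _ _ (by linarith : (1 : ℝ) ≤ q * 2))
  refine ENNReal.rpow_le_rpow (ENNReal.tsum_le_tsum fun N => ?_) (by positivity)
  gcongr
  exact inner N

theorem eSeminorm_add_le {f g : (Fin n → ℂ) → ℂ} (hf : ContDiff ℝ ∞ f) (hg : ContDiff ℝ ∞ g)
    (m l : ℕ) (R S : MultiIndex n) :
    eSeminorm p hbar m l R S (f + g) ≤
      eSeminorm p hbar m l R S f + eSeminorm p hbar m l R S g := by
  induction m generalizing l R S with
  | zero =>
    simp only [eSeminorm, hQuant, zero_add, pow_one, dMixed_add _ _ hf hg, Pi.add_apply]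
    have key := minkowski
      (fun N : MultiIndex n =>
        ENNReal.ofReal ((2 * hbar) ^ (deg R + deg S + deg N) / (fact N : ℝ)))
      (fun N => ‖dMixed R (N + S) f p‖ₑ) (fun N => ‖dMixed R (N + S) g p‖ₑ)
      (q := 2) (by norm_num)
    simp only [ENNReal.rpow_two] at key
    refine le_trans ?_ key
    refine ENNReal.rpow_le_rpow (ENNReal.tsum_le_tsum fun N => ?_) (by positivity)
    gcongr
    exact enorm_add_le _ _
  | succ m ih =>
    have hq : (1 : ℝ) ≤ 2 ^ (m + 1) := one_le_pow₀ (by norm_num)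
    simp only [eSeminorm] at ih
    simp only [eSeminorm, hQuant]
    rw [pow_succ (2 : ℝ) (m + 1)]
    split_ifs
    · simp only [← Finset.sum_product']
      exact step_add (fun N => Finset.Iic R ×ˢ Finset.Iic (N + S)) (fun N => (fact N : ℝ≥0∞)⁻¹)
        (fun N x => (binom R x.1 : ℝ≥0∞) * (binom (N + S) x.2 : ℝ≥0∞)) _ _ _ hq
        (fun N x => ih _ _ _)
    · simp only [← Finset.sum_product']
      exact step_add (fun N => Finset.Iic R ×ˢ Finset.Iic (N + S)) (fun N => (fact N : ℝ≥0∞)⁻¹)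
        (fun N x => (binom R x.1 : ℝ≥0∞) * (binom (N + S) x.2 : ℝ≥0∞)) _ _ _ hq
        (fun N x => ih _ _ _)

theorem hQuant_smul (c : ℂ) {f : (Fin n → ℂ) → ℂ} (hf : ContDiff ℝ ∞ f)
    (m l : ℕ) (R S : MultiIndex n) :
    hQuant p hbar (c • f) m l R S = ‖c‖ₑ ^ (2 ^ (m + 1)) * hQuant p hbar f m l R S := by
  induction m generalizing l R S with
  | zero =>
    simp only [hQuant, dMixed_smul _ _ c hf, Pi.smul_apply, enorm_smul, mul_pow, zero_add, pow_one]
    rw [← ENNReal.tsum_mul_left]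
    exact tsum_congr fun N => by ring
  | succ m ih =>
    simp only [hQuant, ih]
    split_ifs <;>
    · rw [← ENNReal.tsum_mul_left]
      refine tsum_congr fun N => ?_
      rw [pow_succ 2 (m + 1), pow_mul, mul_left_comm, ← mul_pow, Finset.mul_sum]
      congr 2
      refine Finset.sum_congr rfl fun I _ => ?_
      rw [Finset.mul_sum]
      exact Finset.sum_congr rfl fun J _ => by ring

theorem eSeminorm_smul (c : ℂ) {f : (Fin n → ℂ) → ℂ} (hf : ContDiff ℝ ∞ f)
    (m l : ℕ) (R S : MultiIndex n) :
    eSeminorm p hbar m l R S (c • f) = ‖c‖ₑ * eSeminorm p hbar m l R S f := by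
  have h : ((2 : ℝ) ^ (m + 1)) = ((2 ^ (m + 1) : ℕ) : ℝ) := by push_cast; rfl
  rw [eSeminorm, hQuant_smul p hbar c hf, ENNReal.mul_rpow_of_nonneg _ _ (by positivity), eSeminorm,
    h, ENNReal.pow_rpow_inv_natCast (by positivity)]

end SeminormFacts

/-- The space of all smooth functions on `ℂⁿ` all of whose seminorms at `p` are finite. -/
def preAlgebra (n : ℕ) (p : Fin n → ℂ) (hbar : ℝ) : Submodule ℂ ((Fin n → ℂ) → ℂ) where
  carrier := {f | ContDiff ℝ ∞ f ∧
    ∀ (m l : ℕ) (R S : MultiIndex n), l < 2 ^ m → eSeminorm p hbar m l R S f < ⊤}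
  add_mem' {f g} hf hg := ⟨hf.1.add hg.1, fun m l R S hl =>
    (eSeminorm_add_le p hbar hf.1 hg.1 m l R S).trans_lt
      (ENNReal.add_lt_top.2 ⟨hf.2 m l R S hl, hg.2 m l R S hl⟩)⟩
  zero_mem' := ⟨contDiff_const, fun m l R S _ => by
    have h := eSeminorm_smul p hbar 0 (f := (0 : (Fin n → ℂ) → ℂ)) contDiff_const m l R S
    rw [zero_smul, enorm_zero, zero_mul] at h
    rw [h]
    exact ENNReal.zero_lt_top⟩
  smul_mem' c f hf := ⟨contDiff_const.smul hf.1, fun m l R S hl => by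
    rw [eSeminorm_smul p hbar c hf.1]
    exact ENNReal.mul_lt_top enorm_lt_top (hf.2 m l R S hl)⟩

/-- The real-analytic functions on `ℂⁿ ≅ ℝ²ⁿ`. -/
def realAnalytic (n : ℕ) : Submodule ℂ ((Fin n → ℂ) → ℂ) where
  carrier := {f | AnalyticOnNhd ℝ f Set.univ}
  add_mem' hf hg := hf.add hg
  zero_mem' := analyticOnNhd_const
  smul_mem' c _ hf := (analyticOnNhd_const (v := c)).smul hf

/-- The space `A_{p,ħ}`, as a space of real-analytic functions on `ℂⁿ`.  It is a type of its own
because its topology is not the one of pointwise convergence. -/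
def Alg (n : ℕ) (p : Fin n → ℂ) (hbar : ℝ) : Type :=
  ↥(preAlgebra n p hbar ⊓ realAnalytic n)

section AlgStructure

variable (n : ℕ) (p : Fin n → ℂ) (hbar : ℝ)

instance : AddCommGroup (Alg n p hbar) :=
  inferInstanceAs (AddCommGroup ↥(preAlgebra n p hbar ⊓ realAnalytic n))

instance : Module ℂ (Alg n p hbar) :=
  inferInstanceAs (Module ℂ ↥(preAlgebra n p hbar ⊓ realAnalytic n))

instance : FunLike (Alg n p hbar) (Fin n → ℂ) ℂ where
  coe f := f.1
  coe_injective _ _ h := Subtype.ext h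

/-- The indices `(m, ℓ, R, S)` with `0 ≤ ℓ ≤ 2 ^ m - 1`. -/
abbrev SemIndex : Type := (m : ℕ) × Fin (2 ^ m) × MultiIndex n × MultiIndex n

instance : Nonempty (SemIndex n) := ⟨⟨0, 0, 0, 0⟩⟩

/-- The seminorms `‖·‖_{m,ℓ,R,S}` on `A_{p,ħ}`. -/
def algSeminorm : SeminormFamily ℂ (Alg n p hbar) (SemIndex n) := fun k =>
  Seminorm.of (fun f => (eSeminorm p hbar k.1 k.2.1 k.2.2.1 k.2.2.2 f.1).toReal)
    (fun f g => by
      have hf := (f.2.1.2 k.1 k.2.1 k.2.2.1 k.2.2.2 k.2.1.2).ne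
      have hg := (g.2.1.2 k.1 k.2.1 k.2.2.1 k.2.2.2 k.2.1.2).ne
      rw [← ENNReal.toReal_add hf hg]
      exact ENNReal.toReal_mono (ENNReal.add_ne_top.2 ⟨hf, hg⟩)
        (eSeminorm_add_le p hbar f.2.1.1 g.2.1.1 _ _ _ _))
    (fun c f => by
      have h := congrArg ENNReal.toReal
        (eSeminorm_smul p hbar c f.2.1.1 k.1 k.2.1 k.2.2.1 k.2.2.2)
      rw [ENNReal.toReal_mul, toReal_enorm] at h
      exact h)

/-- The locally convex topology defined by all the seminorms `‖·‖_{m,ℓ,R,S}`. -/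
instance : TopologicalSpace (Alg n p hbar) := (algSeminorm n p hbar).moduleFilterBasis.topology

end AlgStructure

/-- The summand of index `N` of the Wick star product of `f` and `g` with `λ = ħ`. -/
def wickTerm {n : ℕ} (hbar : ℝ) (f g : (Fin n → ℂ) → ℂ) (N : MultiIndex n) (z : Fin n → ℂ) : ℂ :=
  (2 * (hbar : ℂ)) ^ deg N / (fact N : ℂ) * dzPow N f z * dzbarPow N g z

/-- `F` is holomorphic in the first, anti-holomorphic in the second argument, and restricts to `f`
on the diagonal. -/
def IsHatExtension {n : ℕ} (f : (Fin n → ℂ) → ℂ) (F : (Fin n → ℂ) → (Fin n → ℂ) → ℂ) : Prop :=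
  Differentiable ℂ (fun q : (Fin n → ℂ) × (Fin n → ℂ) => F q.1 (star q.2)) ∧ ∀ z, F z z = f z

/-- The function `f̂` (meaningful when an extension exists; extensions are unique). -/
def hat {n : ℕ} (f : (Fin n → ℂ) → ℂ) : (Fin n → ℂ) → (Fin n → ℂ) → ℂ :=
  Classical.epsilon (IsHatExtension f)

/-- The holomorphic translation `(τ_α f)(z, z̄) = f̂(z + α, z̄)`. -/
def tau {n : ℕ} (α : Fin n → ℂ) (f : (Fin n → ℂ) → ℂ) : (Fin n → ℂ) → ℂ :=
  fun z => hat f (z + α) z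

/-- The anti-holomorphic translation `(τ̄_ᾱ f)(z, z̄) = f̂(z, z̄ + ᾱ)`, as a function of `α`. -/
def tauBar {n : ℕ} (α : Fin n → ℂ) (f : (Fin n → ℂ) → ℂ) : (Fin n → ℂ) → ℂ :=
  fun z => hat f z (z + α)

/-- `a̅ · b = ∑ i, conj (a_i) b_i`. -/
def cdot {n : ℕ} (a b : Fin n → ℂ) : ℂ := ∑ i, star (a i) * b i

/-- The function `e_{ᾱ,β}(z, z̄) = exp(ħ ᾱ·β) exp(ᾱ·z + β·z̄)`. -/
def expFun {n : ℕ} (hbar : ℝ) (α β : Fin n → ℂ) (z : Fin n → ℂ) : ℂ :=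
  Complex.exp ((hbar : ℂ) * cdot α β) * Complex.exp (cdot α z + cdot z β)

/-- `u_w = e_{w̄/2ħ, -w/2ħ}`. -/
def uFun {n : ℕ} (hbar : ℝ) (w : Fin n → ℂ) : (Fin n → ℂ) → ℂ :=
  expFun hbar ((1 / (2 * (hbar : ℂ))) • w) (-((1 / (2 * (hbar : ℂ))) • w))

end WickStar

end

open scoped NNReal

noncomputable section

namespace WickStar

variable {n : ℕ}

/-! ### Multiindices and weights -/

section Weights

/-! Everything is reduced to the growth of the jet `a R S` of `f` at `p`. Call an array tame if for
every `d > 0` it satisfies `|a R S| ≤ B (R! S!)^d` for some `B`. The seminorms of the statement are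
equivalent, as a family, to the best constants `B` for the various `d`.

In one direction (`exists_step_le`, `exists_eSeminorm_le`), a bound with small `d` survives the
recursion. The binomial sums contribute powers of `2`, which any positive power of the factorial
absorbs, and the sum over `N` converges because `1 / N!` beats `(N!)^d` for `d < 1`. Each of these
operations multiplies `d` by a constant, so `d` only has to be small at the start. In the other
direction (`le_hQuant_one`, `exists_bd_jet`), all summands are nonnegative, so a single one may be
kept. With `ℓ = 1` it contains a high power of `|a R S|` but only `1 / (R! (S!)^2)`, and taking the
root leaves an arbitrarily small power of the factorials.

A tame array is the array of derivatives of a power series `pser a u v` that is entire on `ℂⁿ × ℂⁿ`.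
Restricting it to `v = ū` gives the real-analytic representative, and the series itself is the
extension `f̂`. Uniqueness of the representative is the identity theorem on real lines; uniqueness
of the extension is the identity theorem along complex lines that meet the totally real diagonal in
a real line. Re-expansion about another point (`pser_translate`) preserves tameness, so the space
does not depend on `p`, and translations in either variable act on it.

Products, derivatives, conjugation and the star product become operations on arrays with estimates
that are uniform in the arrays; these give convergence (`hasSum_of_bd`) and continuity
(`continuous_of_bd`, `continuous_bilin_of_bd`). Algebraic identities are checked pointwise. The
product `(f ⋆ g) ⋆ k` at `z` is an absolutely convergent triple series in the jets at `z`;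
conjugation reverses products and permutes the terms of that series, whence associativity. Since
`∂^N` multiplies an exponential by `ᾱ^N`, its star product with `f` is a Taylor series of `f̂` in
one variable. Left multiplication by `u_w` therefore shifts `z̄` by `w̄`, right multiplication by
its conjugate shifts `z` by `w`, and the exponential factors cancel: translations are inner. -/

theorem deg_add (R S : MultiIndex n) : deg (R + S) = deg R + deg S := by
  simp [deg, Finset.sum_add_distrib]

@[simp] theorem deg_zero : deg (0 : MultiIndex n) = 0 := by simp [deg]

@[simp] theorem fact_zero : fact (0 : MultiIndex n) = 1 := by simp [fact]

theorem fact_pos (R : MultiIndex n) : 0 < fact R :=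
  Finset.prod_pos fun _ _ => Nat.factorial_pos _

theorem one_le_fact (R : MultiIndex n) : (1 : ℝ≥0) ≤ fact R := by
  exact_mod_cast fact_pos R

theorem fact_ne_zero' {K : Type*} [AddMonoidWithOne K] [CharZero K] (R : MultiIndex n) :
    (fact R : K) ≠ 0 := by
  exact_mod_cast (fact_pos R).ne'

theorem fact_mul_le (R S : MultiIndex n) : fact R * fact S ≤ fact (R + S) := by
  simp only [fact, ← Finset.prod_mul_distrib]
  exact Finset.prod_le_prod' fun i _ =>
    Nat.le_of_dvd (Nat.factorial_pos _) (Nat.factorial_mul_factorial_dvd_factorial_add _ _)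

theorem fact_add_le (R S : MultiIndex n) :
    fact (R + S) ≤ 2 ^ deg R * 2 ^ deg S * (fact R * fact S) := by
  simp only [fact, deg, ← Finset.prod_pow_eq_pow_sum, ← Finset.prod_mul_distrib]
  refine Finset.prod_le_prod' fun i _ => ?_
  rw [← pow_add, Pi.add_apply, ← Nat.add_choose_mul_factorial_mul_factorial (R i) (S i), mul_assoc]
  exact Nat.mul_le_mul_right _ (Nat.choose_le_two_pow _ _)

theorem fact_mono {R S : MultiIndex n} (h : R ≤ S) : fact R ≤ fact S :=
  Finset.prod_le_prod' fun i _ => Nat.factorial_le (h i)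

theorem two_pow_pred_le_factorial (k : ℕ) : 2 ^ (k - 1) ≤ k.factorial := by
  induction k with
  | zero => simp
  | succ k ih =>
    rcases Nat.eq_zero_or_pos k with rfl | h
    · simp
    · rw [Nat.factorial_succ, Nat.add_sub_cancel]
      calc 2 ^ k = 2 * 2 ^ (k - 1) := by rw [← pow_succ']; congr 1; omega
        _ ≤ _ := Nat.mul_le_mul (by omega) ih

theorem two_pow_deg_le (R : MultiIndex n) : 2 ^ deg R ≤ 2 ^ n * fact R := by
  have : (2 : ℕ) ^ n = ∏ _i : Fin n, 2 := by simp
  rw [this]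
  simp only [fact, deg, ← Finset.prod_pow_eq_pow_sum, ← Finset.prod_mul_distrib]
  refine Finset.prod_le_prod' fun i _ => ?_
  rcases Nat.eq_zero_or_pos (R i) with h | h
  · simp [h]
  · calc 2 ^ R i = 2 * 2 ^ (R i - 1) := by rw [← pow_succ']; congr 1; omega
      _ ≤ _ := Nat.mul_le_mul_left _ (two_pow_pred_le_factorial _)

theorem binom_mul_fact {R I : MultiIndex n} (h : I ≤ R) :
    binom R I * (fact I * fact (R - I)) = fact R := by
  simp only [binom, fact, ← Finset.prod_mul_distrib]
  refine Finset.prod_congr rfl fun i _ => ?_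
  rw [← mul_assoc]
  exact Nat.choose_mul_factorial_mul_factorial (h i)

theorem sum_binom (R : MultiIndex n) : ∑ I ∈ Finset.Iic R, binom R I = 2 ^ deg R := by
  have h : Finset.Iic R = Fintype.piFinset fun i => Finset.Iic (R i) := by
    ext I; simp [Pi.le_def]
  rw [h, deg, ← Finset.prod_pow_eq_pow_sum]
  unfold binom
  rw [← Finset.prod_univ_sum (fun i => Finset.Iic (R i)) (fun i j => (R i).choose j)]
  refine Finset.prod_congr rfl fun i _ => ?_
  rw [← Nat.sum_range_choose]
  refine Finset.sum_congr ?_ fun _ _ => rfl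
  ext j; simp

/-- The weight `(R!) ^ d`. -/
def wt (d : ℝ) (R : MultiIndex n) : ℝ≥0 := (fact R : ℝ≥0) ^ d

@[simp] theorem wt_zero (d : ℝ) : wt d (0 : MultiIndex n) = 1 := by simp [wt]

theorem wt_add_exp (d e : ℝ) (R : MultiIndex n) : wt (d + e) R = wt d R * wt e R :=
  NNReal.rpow_add (fact_ne_zero' R) _ _

theorem wt_mono_exp {d e : ℝ} (h : d ≤ e) (R : MultiIndex n) : wt d R ≤ wt e R :=
  NNReal.rpow_le_rpow_of_exponent_le (one_le_fact R) h

theorem wt_neg_one (R : MultiIndex n) : wt (-1) R = (fact R : ℝ≥0)⁻¹ := by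
  simp [wt, NNReal.rpow_neg]

theorem wt_pow (d : ℝ) (R : MultiIndex n) (k : ℕ) : wt d R ^ k = wt (d * k) R := by
  simp [wt, NNReal.rpow_mul]

theorem wt_mono {d : ℝ} (hd : 0 ≤ d) {R S : MultiIndex n} (h : R ≤ S) : wt d R ≤ wt d S :=
  NNReal.rpow_le_rpow (by exact_mod_cast fact_mono h) hd

theorem wt_mul_le {d : ℝ} (hd : 0 ≤ d) {R S : MultiIndex n} (h : S ≤ R) :
    wt d S * wt d (R - S) ≤ wt d R := by
  rw [wt, wt, ← NNReal.mul_rpow]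
  refine NNReal.rpow_le_rpow ?_ hd
  have := fact_mul_le S (R - S)
  rw [add_tsub_cancel_of_le h] at this
  exact_mod_cast this

/-- Exponential growth is dominated by any positive power of the factorial. -/
theorem exists_pow_deg_le (r : ℝ≥0) {d : ℝ} (hd : 0 < d) :
    ∃ C : ℝ≥0, ∀ R : MultiIndex n, r ^ deg R ≤ C * wt d R := by
  obtain ⟨K, hK⟩ : ∃ K : ℝ≥0, ∀ k : ℕ, r ^ k ≤ K * (k.factorial : ℝ≥0) ^ d := by
    -- Since `(r^(1/d))^k / k!` tends to zero it is bounded; the estimate wanted is the `d`-th power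
    -- of this one.
    have h := FloorSemiring.tendsto_pow_div_factorial_atTop ((r : ℝ) ^ d⁻¹)
    obtain ⟨B, hB⟩ := h.bddAbove_range
    refine ⟨B.toNNReal ^ d, fun k => ?_⟩
    have h1 : ((r : ℝ) ^ d⁻¹) ^ k / k.factorial ≤ B := hB ⟨k, rfl⟩
    have h2 : (r ^ d⁻¹) ^ k ≤ B.toNNReal * (k.factorial : ℝ≥0) := by
      rw [← NNReal.coe_le_coe]
      push_cast
      have hk : (0 : ℝ) < k.factorial := by exact_mod_cast Nat.factorial_pos k
      rw [div_le_iff₀ hk] at h1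
      exact h1.trans (by gcongr; exact Real.le_coe_toNNReal B)
    calc r ^ k = ((r ^ d⁻¹) ^ k) ^ d := by
          rw [← NNReal.rpow_natCast (r ^ d⁻¹), ← NNReal.rpow_mul, ← NNReal.rpow_mul,
            ← NNReal.rpow_natCast]
          congr 1; field_simp
      _ ≤ _ := by rw [← NNReal.mul_rpow]; exact NNReal.rpow_le_rpow h2 hd.le
  refine ⟨∏ _i : Fin n, K, fun R => ?_⟩
  rw [deg, ← Finset.prod_pow_eq_pow_sum, wt, fact]
  push_cast
  rw [← NNReal.finsetProd_rpow, ← Finset.prod_mul_distrib]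
  exact Finset.prod_le_prod' fun i _ => hK _

/-- `(R + S)!` exceeds `R! S!` by at most `2^|R+S|`, and `2^|R| ≤ 2^n R!`. Separating the two
indices thus costs a doubling of the exponent, which is harmless where arbitrarily small exponents
are available. -/
theorem exists_wt_add_le {d : ℝ} (hd : 0 ≤ d) :
    ∃ C : ℝ≥0, ∀ R S : MultiIndex n, wt d (R + S) ≤ C * (wt (2 * d) R * wt (2 * d) S) := by
  refine ⟨(2 ^ n * 2 ^ n : ℝ≥0) ^ d, fun R S => ?_⟩
  rw [two_mul, wt_add_exp, wt_add_exp]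
  simp only [wt, ← NNReal.mul_rpow]
  refine NNReal.rpow_le_rpow ?_ hd
  have h1 := fact_add_le R S
  have h2 := Nat.mul_le_mul (two_pow_deg_le R) (two_pow_deg_le S)
  have h3 := h1.trans (Nat.mul_le_mul_right (fact R * fact S) h2)
  have h4 : ((fact (R + S) : ℕ) : ℝ≥0) ≤ ((2 ^ n * fact R * (2 ^ n * fact S) *
    (fact R * fact S) : ℕ) : ℝ≥0) := by exact_mod_cast h3
  refine h4.trans (le_of_eq ?_)
  push_cast
  ring

/-- Induction on the number of variables, splitting off the first. Absolute summability is carried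
along because multiplying two series requires it. -/
theorem hasSum_prod_univ {g : Fin n → ℕ → ℂ} {s : Fin n → ℂ} (hs : ∀ i, HasSum (g i) (s i))
    (hg : ∀ i, Summable fun k => ‖g i k‖) :
    HasSum (fun N : MultiIndex n => ∏ i, g i (N i)) (∏ i, s i) ∧
      Summable fun N : MultiIndex n => ‖∏ i, g i (N i)‖ := by
  induction n with
  | zero =>
    refine ⟨?_, ?_⟩
    · simp only [Finset.univ_eq_empty, Finset.prod_empty]
      exact hasSum_unique (f := fun _ : MultiIndex 0 => (1 : ℂ))
    · exact (hasSum_unique (f := fun N : MultiIndex 0 => ‖∏ i, g i (N i)‖)).summable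
  | succ n ih =>
    obtain ⟨h1, h2⟩ := ih (g := fun i => g i.succ) (s := fun i => s i.succ)
      (fun i => hs i.succ) (fun i => hg i.succ)
    have h3 := (hg 0).mul_norm h2
    have h4 := (hs 0).mul h1 h3.of_norm
    rw [Fin.prod_univ_succ]
    have key : (fun N : MultiIndex (n + 1) => ∏ i, g i (N i)) ∘
        (Fin.consEquiv (fun _ : Fin (n + 1) => ℕ)) =
        fun x : ℕ × MultiIndex n => g 0 x.1 * ∏ i, g i.succ (x.2 i) := by
      ext x
      simp [Fin.consEquiv, Fin.prod_univ_succ]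
    refine ⟨?_, ?_⟩
    · rw [← (Fin.consEquiv (fun _ : Fin (n + 1) => ℕ)).hasSum_iff, key]
      exact h4
    · rw [← (Fin.consEquiv (fun _ : Fin (n + 1) => ℕ)).summable_iff]
      have : (fun N : MultiIndex (n + 1) => ‖∏ i, g i (N i)‖) ∘
        (Fin.consEquiv (fun _ : Fin (n + 1) => ℕ)) = fun x => ‖((fun N : MultiIndex (n + 1) =>
          ∏ i, g i (N i)) ∘ (Fin.consEquiv (fun _ : Fin (n + 1) => ℕ))) x‖ := rfl
      rw [this, key]
      exact h3

theorem summable_half_pow_deg : Summable fun N : MultiIndex n => (2⁻¹ : ℝ≥0) ^ deg N := by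
  have h := (hasSum_prod_univ (n := n) (g := fun _ k => (2⁻¹ : ℂ) ^ k) (s := fun _ => (1 - 2⁻¹)⁻¹)
    (fun i => hasSum_geometric_of_norm_lt_one (by norm_num))
    (fun i => by
      simpa using summable_geometric_of_lt_one (r := (2 : ℝ)⁻¹) (by norm_num) (by norm_num))).2
  rw [← NNReal.summable_coe]
  refine h.congr fun N => ?_
  simp [deg, Finset.prod_pow_eq_pow_sum]

/-- Negative powers of the factorial are summable. -/
theorem summable_wt {d : ℝ} (hd : d < 0) : Summable fun N : MultiIndex n => wt d N := by
  obtain ⟨C, hC⟩ := exists_pow_deg_le (n := n) 2 (neg_pos.2 hd)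
  refine NNReal.summable_of_le (fun N => ?_) (summable_half_pow_deg.mul_left C)
  have h := hC N
  calc wt d N = (2⁻¹ : ℝ≥0) ^ deg N * 2 ^ deg N * wt d N := by
        rw [← mul_pow, inv_mul_cancel₀ two_ne_zero, one_pow, one_mul]
    _ ≤ (2⁻¹ : ℝ≥0) ^ deg N * (C * wt (-d) N) * wt d N := by gcongr
    _ = C * 2⁻¹ ^ deg N * wt (-d + d) N := by rw [wt_add_exp]; ring
    _ = _ := by simp [wt]

/-- The source of convergence of the sums over `N`: the factor `1 / N!` leaves room for any power of
`N!` with exponent below `1`. -/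
theorem summable_fact_wt {d : ℝ} (hd : d < 1) :
    Summable fun N : MultiIndex n => (fact N : ℝ≥0)⁻¹ * wt d N := by
  refine (summable_wt (n := n) (d := d - 1) (by linarith)).congr fun N => ?_
  rw [← wt_neg_one, ← wt_add_exp]
  congr 1; ring

end Weights

/-! ### Comparison of the seminorms with factorial growth bounds on jets -/

section Growth

/-- The array `a` is bounded by `B (R!)^d (S!)^d`. -/
def Bd (d : ℝ) (B : ℝ≥0) (a : MultiIndex n → MultiIndex n → ℂ) : Prop :=
  ∀ R S, ‖a R S‖₊ ≤ B * (wt d R * wt d S)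

/-- The array `a` grows more slowly than any positive power of the factorials. -/
def Tame (a : MultiIndex n → MultiIndex n → ℂ) : Prop := ∀ d : ℝ, 0 < d → ∃ B, Bd d B a

/-- The infinite jet of `f` at `p`. -/
def jet (f : (Fin n → ℂ) → ℂ) (p : Fin n → ℂ) (R S : MultiIndex n) : ℂ := dMixed R S f p

theorem Bd.mono_exp {d e : ℝ} {B : ℝ≥0} {a : MultiIndex n → MultiIndex n → ℂ} (h : Bd d B a)
    (hde : d ≤ e) : Bd e B a := fun R S => (h R S).trans <| by
  gcongr <;> exact wt_mono_exp hde _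

/-- One step of the recursion preserves factorial bounds. -/
theorem exists_step_le {e : ℝ} (he : 0 < e) :
    ∃ d : ℝ, 0 < d ∧ ∃ C : ℝ≥0, ∀ (D : ℝ≥0) (X : MultiIndex n → MultiIndex n → ℝ≥0∞),
      (∀ R S, X R S ≤ ((D * (wt d R * wt d S) : ℝ≥0) : ℝ≥0∞)) →
      ∀ R S, (∑' N : MultiIndex n, (fact N : ℝ≥0∞)⁻¹ *
        (∑ I ∈ Finset.Iic R, ∑ J ∈ Finset.Iic (N + S),
          (binom R I : ℝ≥0∞) * (binom (N + S) J : ℝ≥0∞) * X I J) ^ 2) ≤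
        ((C * D ^ 2 * (wt e R * wt e S) : ℝ≥0) : ℝ≥0∞) := by
  -- Exponent count: the binomial sums raise `d` to `2 * d`, separating `N` from `S` gives `4 * d`,
  -- and the square gives `8 * d`. This must be at most `e` for the result and below `1` for the sum
  -- over `N`.
  obtain ⟨d, hd, hd1, hd2⟩ : ∃ d : ℝ, 0 < d ∧ 8 * d ≤ e ∧ 8 * d < 1 :=
    ⟨min e 1 / 9, by positivity, by linarith [min_le_left e 1, lt_min he one_pos],
      by linarith [min_le_right e 1]⟩
  obtain ⟨C1, hC1⟩ := exists_pow_deg_le (n := n) 2 hd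
  obtain ⟨C2, hC2⟩ := exists_wt_add_le (n := n) (d := 2 * d) (by linarith)
  have hs := summable_fact_wt (n := n) hd2
  refine ⟨d, hd, (C1 ^ 2 * C2) ^ 2 * ∑' N : MultiIndex n, (fact N : ℝ≥0)⁻¹ * wt (8 * d) N,
    fun D X hX R S => ?_⟩
  have inner : ∀ N : MultiIndex n, (∑ I ∈ Finset.Iic R, ∑ J ∈ Finset.Iic (N + S),
      (binom R I : ℝ≥0∞) * (binom (N + S) J : ℝ≥0∞) * X I J) ≤
      ((C1 ^ 2 * C2 * D * (wt (2 * d) R * wt (4 * d) N * wt (4 * d) S) : ℝ≥0) : ℝ≥0∞) := fun N => by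
    calc _ ≤ ∑ I ∈ Finset.Iic R, ∑ J ∈ Finset.Iic (N + S),
        (binom R I : ℝ≥0∞) * (binom (N + S) J : ℝ≥0∞) *
          ((D * (wt d R * wt d (N + S)) : ℝ≥0) : ℝ≥0∞) := by
          refine Finset.sum_le_sum fun I hI => Finset.sum_le_sum fun J hJ => ?_
          rw [Finset.mem_Iic] at hI hJ
          refine mul_le_mul_right ((hX I J).trans (ENNReal.coe_le_coe.2 ?_)) _
          gcongr
          · exact wt_mono hd.le hI
          · exact wt_mono hd.le hJ
      _ = (((2 ^ deg R * 2 ^ deg (N + S)) * (D * (wt d R * wt d (N + S))) : ℝ≥0) : ℝ≥0∞) := by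
          rw [ENNReal.coe_mul (2 ^ deg R * 2 ^ deg (N + S))]
          have h1 : ((2 ^ deg R * 2 ^ deg (N + S) : ℝ≥0) : ℝ≥0∞) =
              ((2 ^ deg R : ℕ) : ℝ≥0∞) * ((2 ^ deg (N + S) : ℕ) : ℝ≥0∞) := by push_cast; rfl
          rw [h1, ← sum_binom, ← sum_binom, Nat.cast_sum, Nat.cast_sum, Finset.sum_mul_sum,
            Finset.sum_mul]
          exact Finset.sum_congr rfl fun I _ => by rw [Finset.sum_mul]
      _ ≤ _ := ENNReal.coe_le_coe.2 <| by
          calc _ ≤ (C1 * wt d R * (C1 * wt d (N + S))) * (D * (wt d R * wt d (N + S))) := by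
                gcongr <;> exact hC1 _
            _ = C1 ^ 2 * D * (wt (2 * d) R * wt (2 * d) (N + S)) := by
                rw [two_mul, wt_add_exp, wt_add_exp]; ring
            _ ≤ C1 ^ 2 * D * (wt (2 * d) R * (C2 * (wt (2 * (2 * d)) N * wt (2 * (2 * d)) S))) := by
                gcongr; exact hC2 _ _
            _ = _ := by rw [show 2 * (2 * d) = 4 * d by ring]; ring
  calc _ ≤ ∑' N : MultiIndex n, (((fact N : ℝ≥0)⁻¹ *
        (C1 ^ 2 * C2 * D * (wt (2 * d) R * wt (4 * d) N * wt (4 * d) S)) ^ 2 : ℝ≥0) : ℝ≥0∞) := by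
        refine ENNReal.tsum_le_tsum fun N => ?_
        rw [ENNReal.coe_mul, ENNReal.coe_inv (fact_ne_zero' N), ENNReal.coe_pow]
        push_cast
        gcongr
        simpa using inner N
    _ = ∑' N : MultiIndex n, (((C1 ^ 2 * C2) ^ 2 * D ^ 2 * (wt (4 * d) R * wt (8 * d) S) *
          ((fact N : ℝ≥0)⁻¹ * wt (8 * d) N) : ℝ≥0) : ℝ≥0∞) := by
        refine tsum_congr fun N => congrArg _ ?_
        -- Squaring a weight doubles its exponent.
        have h : ∀ (x : ℝ) (R : MultiIndex n), wt (2 * x) R = wt x R ^ 2 := fun x R => by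
          rw [two_mul, wt_add_exp, sq]
        rw [show 8 * d = 2 * (4 * d) by ring, h (4 * d), h (4 * d),
          show wt (4 * d) R = wt (2 * d) R ^ 2 by rw [← h]; congr 1; ring]
        ring
    _ = (((C1 ^ 2 * C2) ^ 2 * D ^ 2 * (wt (4 * d) R * wt (8 * d) S) *
          ∑' N : MultiIndex n, ((fact N : ℝ≥0)⁻¹ * wt (8 * d) N) : ℝ≥0) : ℝ≥0∞) := by
        rw [← NNReal.tsum_mul_left, ENNReal.coe_tsum (hs.mul_left _)]
    _ ≤ _ := ENNReal.coe_le_coe.2 <| by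
        calc _ = (C1 ^ 2 * C2) ^ 2 * (∑' N : MultiIndex n, ((fact N : ℝ≥0)⁻¹ * wt (8 * d) N)) *
              D ^ 2 * (wt (4 * d) R * wt (8 * d) S) := by ring
          _ ≤ _ := by gcongr <;> exact wt_mono_exp (by linarith) _

variable (p : Fin n → ℂ) (hbar : ℝ)

theorem exists_hQuant_zero_le {e : ℝ} (he : 0 < e) :
    ∃ d : ℝ, 0 < d ∧ ∃ C : ℝ≥0, ∀ (f : (Fin n → ℂ) → ℂ) (B : ℝ≥0), Bd d B (jet f p) →
      ∀ l R S, hQuant p hbar f 0 l R S ≤ ((C * B ^ 2 * (wt e R * wt e S) : ℝ≥0) : ℝ≥0∞) := by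
  -- In `N`, the power of `2ħ` costs `d`; the squared jet costs `2 * d`, doubled to `4 * d` when `N
  -- + S` is separated.
  obtain ⟨d, hd, hd1, hd2⟩ : ∃ d : ℝ, 0 < d ∧ 5 * d ≤ e ∧ 5 * d < 1 :=
    ⟨min e 1 / 6, by positivity, by linarith [min_le_left e 1, lt_min he one_pos],
      by linarith [min_le_right e 1]⟩
  obtain ⟨C1, hC1⟩ := exists_pow_deg_le (n := n) (2 * |hbar|).toNNReal hd
  obtain ⟨C2, hC2⟩ := exists_wt_add_le (n := n) (d := 2 * d) (by linarith)
  have hs := summable_fact_wt (n := n) hd2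
  refine ⟨d, hd, C1 ^ 3 * C2 * ∑' N : MultiIndex n, (fact N : ℝ≥0)⁻¹ * wt (5 * d) N,
    fun f B hf l R S => ?_⟩
  simp only [hQuant]
  calc _ ≤ ∑' N : MultiIndex n, (((C1 ^ 3 * C2 * B ^ 2 * (wt (3 * d) R * wt (5 * d) S) *
          ((fact N : ℝ≥0)⁻¹ * wt (5 * d) N) : ℝ≥0)) : ℝ≥0∞) := by
        refine ENNReal.tsum_le_tsum fun N => ?_
        have h1 : ENNReal.ofReal ((2 * hbar) ^ (deg R + deg S + deg N) / (fact N : ℝ)) ≤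
            (((2 * |hbar|).toNNReal ^ (deg R + deg S + deg N) * (fact N : ℝ≥0)⁻¹ : ℝ≥0) :
              ℝ≥0∞) := by
          refine ENNReal.ofReal_le_of_le_toReal ?_
          rw [ENNReal.coe_toReal]
          push_cast
          rw [Real.coe_toNNReal _ (by positivity), div_eq_mul_inv]
          refine mul_le_mul_of_nonneg_right ((le_abs_self _).trans (le_of_eq ?_)) (by positivity)
          simp [abs_pow, abs_mul]
        have h2 : ‖dMixed R (N + S) f p‖ₑ ^ 2 ≤
            (((B * (wt d R * wt d (N + S))) ^ 2 : ℝ≥0) : ℝ≥0∞) := by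
          rw [ENNReal.coe_pow]
          gcongr
          exact ENNReal.coe_le_coe.2 (hf R (N + S))
        refine (mul_le_mul' h1 h2).trans ?_
        rw [← ENNReal.coe_mul, ENNReal.coe_le_coe]
        calc _ = ((2 * |hbar|).toNNReal ^ deg R * (2 * |hbar|).toNNReal ^ deg S *
              (2 * |hbar|).toNNReal ^ deg N) * (fact N : ℝ≥0)⁻¹ *
                (B ^ 2 * (wt (2 * d) R * wt (2 * d) (N + S))) := by
              rw [two_mul d, wt_add_exp, wt_add_exp]; ring
          _ ≤ ((C1 * wt d R) * (C1 * wt d S) * (C1 * wt d N)) * (fact N : ℝ≥0)⁻¹ *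
                (B ^ 2 * (wt (2 * d) R * (C2 * (wt (2 * (2 * d)) N * wt (2 * (2 * d)) S)))) := by
              gcongr
              · exact hC1 _
              · exact hC1 _
              · exact hC1 _
              · exact hC2 _ _
          _ = _ := by
              rw [show 5 * d = d + 2 * (2 * d) by ring, show 3 * d = d + 2 * d by ring,
                wt_add_exp, wt_add_exp, wt_add_exp]
              ring
    _ = ((C1 ^ 3 * C2 * B ^ 2 * (wt (3 * d) R * wt (5 * d) S) *
          ∑' N : MultiIndex n, ((fact N : ℝ≥0)⁻¹ * wt (5 * d) N) : ℝ≥0) : ℝ≥0∞) := by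
        rw [← NNReal.tsum_mul_left, ENNReal.coe_tsum (hs.mul_left _)]
    _ ≤ _ := ENNReal.coe_le_coe.2 <| by
        calc _ = C1 ^ 3 * C2 * (∑' N : MultiIndex n, ((fact N : ℝ≥0)⁻¹ * wt (5 * d) N)) *
              B ^ 2 * (wt (3 * d) R * wt (5 * d) S) := by ring
          _ ≤ _ := by gcongr <;> exact wt_mono_exp (by linarith) _

/-- Iteration of `exists_step_le` from the case `m = 0`. The power `2^(m+1)` of `B` matches the
homogeneity of `hQuant`, so the final root will be linear in `B`. -/
theorem exists_hQuant_le (m : ℕ) {e : ℝ} (he : 0 < e) :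
    ∃ d : ℝ, 0 < d ∧ ∃ C : ℝ≥0, ∀ (f : (Fin n → ℂ) → ℂ) (B : ℝ≥0), Bd d B (jet f p) →
      ∀ l R S, hQuant p hbar f m l R S ≤
        ((C * B ^ (2 ^ (m + 1)) * (wt e R * wt e S) : ℝ≥0) : ℝ≥0∞) := by
  induction m generalizing e with
  | zero => simpa using exists_hQuant_zero_le p hbar he
  | succ m ih =>
    obtain ⟨d', hd', C', hC'⟩ := exists_step_le (n := n) he
    obtain ⟨d, hd, C, hC⟩ := ih hd'
    refine ⟨d, hd, C' * C ^ 2, fun f B hf l R S => ?_⟩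
    have h : C' * C ^ 2 * B ^ (2 ^ (m + 1 + 1)) = C' * (C * B ^ (2 ^ (m + 1))) ^ 2 := by
      rw [pow_succ 2 (m + 1), pow_mul]; ring
    rw [h]
    simp only [hQuant]
    split_ifs
    · exact hC' _ _ (fun R S => hC f B hf _ R S) R S
    -- The odd step exchanges the two indices, and the bound is symmetric in them.
    · exact hC' _ (fun I J => hQuant p hbar f m ((l - 1) / 2) J I)
        (fun R S => (hC f B hf _ S R).trans_eq (by rw [mul_comm (wt d' S)])) R S

/-- The upper half of the comparison. It is uniform in `f` and linear in `B`, as continuity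
statements need. -/
theorem exists_eSeminorm_le (m l : ℕ) (R S : MultiIndex n) :
    ∃ d : ℝ, 0 < d ∧ ∃ C : ℝ≥0, ∀ (f : (Fin n → ℂ) → ℂ) (B : ℝ≥0), Bd d B (jet f p) →
      eSeminorm p hbar m l R S f ≤ ((C * B : ℝ≥0) : ℝ≥0∞) := by
  obtain ⟨d, hd, C, hC⟩ := exists_hQuant_le p hbar m (one_pos)
  refine ⟨d, hd, (C * (wt 1 R * wt 1 S)) ^ (((2 : ℝ) ^ (m + 1))⁻¹), fun f B hf => ?_⟩
  have h : ((2 : ℝ) ^ (m + 1)) = ((2 ^ (m + 1) : ℕ) : ℝ) := by push_cast; rfl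
  have h0 : (0 : ℝ) ≤ ((2 : ℝ) ^ (m + 1))⁻¹ := by positivity
  refine (ENNReal.rpow_le_rpow (hC f B hf l R S) h0).trans_eq ?_
  rw [← ENNReal.coe_rpow_of_nonneg _ h0]
  congr 1
  rw [mul_right_comm, NNReal.mul_rpow]
  congr 1
  rw [h, NNReal.pow_rpow_inv_natCast _ (by positivity)]

/-- Of the outermost sum keep the index `N` with `I = R`, `J = N + S`, and of all inner sums the
index `0`. The jet is squared at every level while `1 / N!` enters only once, at the outermost one.
-/
theorem le_hQuant_zero (f : (Fin n → ℂ) → ℂ) (m : ℕ) (R S N : MultiIndex n) :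
    (fact N : ℝ≥0∞)⁻¹ * (ENNReal.ofReal ((2 * hbar) ^ (deg R + deg S + deg N)) *
      ‖jet f p R (N + S)‖ₑ ^ 2) ^ 2 ^ m ≤ hQuant p hbar f m 0 R S := by
  induction m generalizing S N with
  | zero =>
    simp only [hQuant, pow_zero, pow_one]
    refine le_trans (le_of_eq ?_) (ENNReal.le_tsum N)
    rw [ENNReal.ofReal_div_of_pos (by exact_mod_cast fact_pos N), ENNReal.ofReal_natCast,
      ENNReal.div_eq_inv_mul, mul_assoc]
    rfl
  | succ m ih =>
    simp only [hQuant, Even.zero, if_true, Nat.zero_div]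
    refine le_trans ?_ (ENNReal.le_tsum N)
    rw [pow_succ 2 m, pow_mul]
    gcongr
    have h1 := ih (N + S) 0
    simp only [fact_zero, Nat.cast_one, inv_one, one_mul, deg_zero, zero_add, add_zero] at h1
    rw [deg_add, add_comm (deg N), ← add_assoc] at h1
    refine h1.trans ?_
    refine le_trans ?_ (Finset.single_le_sum (f := fun I => ∑ J ∈ Finset.Iic (N + S),
      (binom R I : ℝ≥0∞) * (binom (N + S) J : ℝ≥0∞) * hQuant p hbar f m 0 I J)
      (fun _ _ => zero_le) (Finset.mem_Iic.2 le_rfl))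
    refine le_trans ?_ (Finset.single_le_sum (f := fun J =>
      (binom R R : ℝ≥0∞) * (binom (N + S) J : ℝ≥0∞) * hQuant p hbar f m 0 R J)
      (fun _ _ => zero_le) (Finset.mem_Iic.2 le_rfl))
    simp [binom]

/-- The even branch sums over the second index only, so it controls the jet for one fixed `R`. A
final odd step exchanges the indices and sums over the other one; hence a single seminorm sees the
derivatives of all orders in both variables. -/
theorem le_hQuant_one (f : (Fin n → ℂ) → ℂ) (m : ℕ) (R S : MultiIndex n) :
    (fact R : ℝ≥0∞)⁻¹ * ((fact S : ℝ≥0∞)⁻¹ * (ENNReal.ofReal ((2 * hbar) ^ (deg R + deg S)) *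
      ‖jet f p R S‖ₑ ^ 2) ^ 2 ^ m) ^ 2 ≤ hQuant p hbar f (m + 1) 1 0 0 := by
  simp only [hQuant, Nat.not_even_one, if_false, Nat.sub_self, Nat.zero_div]
  refine le_trans ?_ (ENNReal.le_tsum R)
  gcongr
  have h1 := le_hQuant_zero p hbar f m R 0 S
  rw [deg_zero, add_zero, add_zero] at h1
  refine h1.trans ?_
  refine le_trans ?_ (Finset.single_le_sum (f := fun I => ∑ J ∈ Finset.Iic (R + 0),
      (binom 0 I : ℝ≥0∞) * (binom (R + 0) J : ℝ≥0∞) * hQuant p hbar f m 0 J I)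
      (fun _ _ => zero_le) (Finset.mem_Iic.2 le_rfl))
  refine le_trans ?_ (Finset.single_le_sum (f := fun J =>
      (binom 0 0 : ℝ≥0∞) * (binom (R + 0) J : ℝ≥0∞) * hQuant p hbar f m 0 J 0)
      (fun _ _ => zero_le) (Finset.mem_Iic.2 le_rfl))
  simp [binom]

/-- The lower half of the comparison: after the root of order `2^(m+2)`, the factor `1 / (R!
(S!)^2)` becomes as small a power of the factorials as desired. Positivity of `ħ` is essential,
since one divides by powers of `2ħ`. -/
theorem exists_bd_jet (hpos : 0 < hbar) {e : ℝ} (he : 0 < e) :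
    ∃ (m : ℕ) (C : ℝ≥0), ∀ (f : (Fin n → ℂ) → ℂ) (E : ℝ≥0),
      eSeminorm p hbar (m + 1) 1 0 0 f = E → Bd e (C * E) (jet f p) := by
  obtain ⟨m, hm⟩ := exists_pow_lt_of_lt_one he (by norm_num : (2⁻¹ : ℝ) < 1)
  set d : ℝ := 2⁻¹ ^ m with hd
  have hd0 : 0 < d := by positivity
  set κ : ℝ≥0 := (2 * hbar).toNNReal with hκ
  have hκ0 : κ ≠ 0 := by simp [κ, hpos]
  obtain ⟨C, hC⟩ := exists_pow_deg_le (n := n) κ⁻¹ hd0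
  refine ⟨m, C, fun f E hE R S => ?_⟩
  have h2 : ((2 : ℝ) ^ (m + 2)) = ((2 ^ (m + 2) : ℕ) : ℝ) := by push_cast; rfl
  have hH : hQuant p hbar f (m + 1) 1 0 0 = ((E ^ 2 ^ (m + 2) : ℝ≥0) : ℝ≥0∞) := by
    rw [ENNReal.coe_pow, ← hE, eSeminorm, h2, ← ENNReal.rpow_natCast, ENNReal.rpow_inv_rpow]
    positivity
  have h3 := (le_hQuant_one p hbar f m R S).trans_eq hH
  have h4 : ENNReal.ofReal ((2 * hbar) ^ (deg R + deg S)) =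
      ((κ ^ (deg R + deg S) : ℝ≥0) : ℝ≥0∞) := by
    rw [ENNReal.ofReal_pow (by positivity), ENNReal.coe_pow]; rfl
  have h5 : (fact R : ℝ≥0)⁻¹ * ((fact S : ℝ≥0)⁻¹ * (κ ^ (deg R + deg S) *
      ‖jet f p R S‖₊ ^ 2) ^ 2 ^ m) ^ 2 ≤ E ^ 2 ^ (m + 2) := by
    rw [h4] at h3
    rw [← ENNReal.coe_le_coe]
    refine le_trans (le_of_eq ?_) h3
    rw [ENNReal.coe_mul, ENNReal.coe_pow, ENNReal.coe_mul, ENNReal.coe_pow, ENNReal.coe_mul,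
      ENNReal.coe_inv (fact_ne_zero' _), ENNReal.coe_inv (fact_ne_zero' _)]
    rfl
  set y : ℝ≥0 := κ ^ (deg R + deg S) * ‖jet f p R S‖₊ ^ 2 with hy
  have hR0 : (fact R : ℝ≥0) ≠ 0 := fact_ne_zero' R
  have hS0 : (fact S : ℝ≥0) ≠ 0 := fact_ne_zero' S
  -- The exponent `d = 2^(-m)` is chosen so that `(R! S!)^d`, raised to the power `2^(m+1)`, is
  -- exactly `(R! S!)^2`.
  have hdm : d * (2 ^ (m + 1) : ℕ) = 2 := by
    rw [hd]; push_cast; rw [pow_succ, ← mul_assoc, ← mul_pow]; norm_num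
  have h6 : y ^ 2 ^ (m + 1) ≤ (wt d R * wt d S * E ^ 2) ^ 2 ^ (m + 1) := by
    calc y ^ 2 ^ (m + 1) = fact R * fact S ^ 2 *
          ((fact R : ℝ≥0)⁻¹ * ((fact S : ℝ≥0)⁻¹ * y ^ 2 ^ m) ^ 2) := by
          rw [pow_succ 2 m, pow_mul]; field_simp
      _ ≤ fact R * fact S ^ 2 * E ^ 2 ^ (m + 2) := by gcongr
      -- `R!` is wastefully squared to make the bound symmetric in `R` and `S`.
      _ ≤ fact R ^ 2 * fact S ^ 2 * E ^ 2 ^ (m + 2) := by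
          gcongr; exact le_self_pow₀ (one_le_fact R) two_ne_zero
      _ = _ := by
          rw [mul_pow, mul_pow, wt_pow, wt_pow, hdm, ← pow_mul, pow_succ' 2 (m + 1)]
          simp [wt]
  have h7 : y ≤ wt d R * wt d S * E ^ 2 := le_of_pow_le_pow_left₀ (by positivity) zero_le h6
  have h8 : ‖jet f p R S‖₊ ^ 2 ≤ (C * E * (wt d R * wt d S)) ^ 2 := by
    calc ‖jet f p R S‖₊ ^ 2 = κ⁻¹ ^ deg R * κ⁻¹ ^ deg S * y := by
          rw [hy, pow_add, inv_pow, inv_pow]; field_simp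
      _ ≤ (C * wt d R) * (C * wt d S) * (wt d R * wt d S * E ^ 2) := by
          gcongr <;> exact hC _
      _ = _ := by ring
  refine (le_of_pow_le_pow_left₀ two_ne_zero zero_le h8).trans ?_
  gcongr <;> exact wt_mono_exp hm.le _

end Growth

/-! ### Commutation of Wirtinger derivatives and the identity theorem -/

section Wirtinger

/-- The multiindex with a single entry `1`. -/
def unitIdx (i : Fin n) : MultiIndex n := Pi.single i 1

/-- The operator `(∂/∂x^i + c ∂/∂y^i) / 2`. -/
def wirt (c : ℂ) (i : Fin n) (f : (Fin n → ℂ) → ℂ) : (Fin n → ℂ) → ℂ := fun z =>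
  (1 / 2 : ℂ) * (fderiv ℝ f z (Pi.single i 1) + c * fderiv ℝ f z (Pi.single i Complex.I))

theorem dz_eq_wirt : (dz : Fin n → _) = wirt (-Complex.I) := by
  ext i f z; simp [dz, wirt, sub_eq_add_neg]

theorem dzbar_eq_wirt : (dzbar : Fin n → _) = wirt Complex.I := by
  ext i f z; simp [dzbar, wirt]

theorem contDiff_fderiv {f : (Fin n → ℂ) → ℂ} (hf : ContDiff ℝ ∞ f) :
    ContDiff ℝ ∞ (fderiv ℝ f) := hf.fderiv_right (by simp)

theorem contDiff_wirt (c : ℂ) (i : Fin n) {f : (Fin n → ℂ) → ℂ} (hf : ContDiff ℝ ∞ f) :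
    ContDiff ℝ ∞ (wirt c i f) :=
  contDiff_const.mul (((contDiff_fderiv hf).clm_apply contDiff_const).add
    (contDiff_const.mul ((contDiff_fderiv hf).clm_apply contDiff_const)))

theorem fderiv_wirt (c : ℂ) (i : Fin n) {f : (Fin n → ℂ) → ℂ} (hf : ContDiff ℝ ∞ f)
    (z w : Fin n → ℂ) : fderiv ℝ (wirt c i f) z w =
      (1 / 2 : ℂ) * (fderiv ℝ (fderiv ℝ f) z w (Pi.single i 1) +
        c * fderiv ℝ (fderiv ℝ f) z w (Pi.single i Complex.I)) := by
  have h := ((contDiff_fderiv hf).differentiable (by simp) z).hasFDerivAt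
  have h1 : ∀ v : Fin n → ℂ, HasFDerivAt (fun z => fderiv ℝ f z v)
      ((ContinuousLinearMap.apply ℝ ℂ v).comp (fderiv ℝ (fderiv ℝ f) z)) z := fun v =>
    (ContinuousLinearMap.apply ℝ ℂ v).hasFDerivAt.comp z h
  have h2 := ((h1 (Pi.single i 1)).add ((h1 (Pi.single i Complex.I)).const_mul c)).const_mul
    (1 / 2 : ℂ)
  have h3 : fderiv ℝ (wirt c i f) z = _ := h2.fderiv
  rw [h3]
  simp [mul_add]

theorem wirt_comm (c d : ℂ) (i j : Fin n) {f : (Fin n → ℂ) → ℂ} (hf : ContDiff ℝ ∞ f) :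
    wirt c i (wirt d j f) = wirt d j (wirt c i f) := by
  ext z
  have hs : IsSymmSndFDerivAt ℝ f z :=
    (contDiff_infty.1 hf 2).contDiffAt.isSymmSndFDerivAt (by simp)
  rw [wirt, fderiv_wirt d j hf, fderiv_wirt d j hf, wirt, fderiv_wirt c i hf, fderiv_wirt c i hf,
    hs (Pi.single i 1) (Pi.single j 1), hs (Pi.single i 1) (Pi.single j Complex.I),
    hs (Pi.single i Complex.I) (Pi.single j 1), hs (Pi.single i Complex.I) (Pi.single j Complex.I)]
  ring

theorem contDiff_iterate (D : ((Fin n → ℂ) → ℂ) → ((Fin n → ℂ) → ℂ))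
    (hD : ∀ f, ContDiff ℝ ∞ f → ContDiff ℝ ∞ (D f)) (k : ℕ) {f : (Fin n → ℂ) → ℂ}
    (hf : ContDiff ℝ ∞ f) : ContDiff ℝ ∞ (D^[k] f) := by
  induction k generalizing f with
  | zero => exact hf
  | succ k ih => exact ih (hD f hf)

theorem contDiff_foldr_wirt (c : ℂ) (R : MultiIndex n) (L : List (Fin n)) {f : (Fin n → ℂ) → ℂ}
    (hf : ContDiff ℝ ∞ f) : ContDiff ℝ ∞ (L.foldr (fun i g => (wirt c i)^[R i] g) f) := by
  induction L with
  | nil => exact hf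
  | cons j L ih => exact contDiff_iterate _ (fun _ => contDiff_wirt c j) _ ih

/-- The two parameters are independent, so that `∂/∂z` can be moved past `∂/∂z̄` as well as past
other `∂/∂z`. -/
theorem foldr_wirt_comm (c d : ℂ) (i : Fin n) (R : MultiIndex n) (L : List (Fin n))
    {f : (Fin n → ℂ) → ℂ} (hf : ContDiff ℝ ∞ f) :
    L.foldr (fun i g => (wirt c i)^[R i] g) (wirt d i f) =
      wirt d i (L.foldr (fun i g => (wirt c i)^[R i] g) f) := by
  have iter : ∀ (j : Fin n) (k : ℕ) (f : (Fin n → ℂ) → ℂ), ContDiff ℝ ∞ f →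
      (wirt c j)^[k] (wirt d i f) = wirt d i ((wirt c j)^[k] f) := by
    intro j k
    induction k with
    | zero => intro f _; rfl
    | succ k ih =>
      intro f hf
      rw [Function.iterate_succ_apply, wirt_comm c d j i hf, ih _ (contDiff_wirt c j hf),
        Function.iterate_succ_apply]
  induction L with
  | nil => rfl
  | cons j L ih =>
    rw [List.foldr_cons, ih, iter j _ _ (contDiff_foldr_wirt c R L hf), List.foldr_cons]

/-- The list is arbitrary for the sake of the induction. Without repetitions, the extra derivative
occurs at most once and can be moved to the front. -/
theorem foldr_wirt_single (c : ℂ) (i : Fin n) (R : MultiIndex n) (L : List (Fin n))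
    (hL : L.Nodup) {f : (Fin n → ℂ) → ℂ} (hf : ContDiff ℝ ∞ f) :
    L.foldr (fun j g => (wirt c j)^[(R + unitIdx i) j] g) f =
      if i ∈ L then wirt c i (L.foldr (fun j g => (wirt c j)^[R j] g) f)
      else L.foldr (fun j g => (wirt c j)^[R j] g) f := by
  induction L with
  | nil => simp
  | cons j L ih =>
    rw [List.nodup_cons] at hL
    simp only [List.foldr_cons, ih hL.2]
    by_cases hij : i = j
    · subst hij
      simp only [hL.1, if_false, List.mem_cons, true_or, if_true, Pi.add_apply, unitIdx, Pi.single_eq_same,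
        Function.iterate_succ_apply']
    · have h1 : (R + unitIdx i) j = R j := by
        simp [unitIdx, Pi.single_eq_of_ne (Ne.symm hij)]
      rw [h1]
      simp only [List.mem_cons, hij, false_or]
      split_ifs
      · have := foldr_wirt_comm c c i R [j] (contDiff_foldr_wirt c R L hf)
        simpa using this
      · rfl

theorem dMixed_dz (R S : MultiIndex n) (i : Fin n) {f : (Fin n → ℂ) → ℂ} (hf : ContDiff ℝ ∞ f) :
    dMixed R S (dz i f) = dMixed (R + unitIdx i) S f := by
  have hS := contDiff_dzbarPow S hf
  unfold dMixed
  have h1 : dzbarPow S (dz i f) = dz i (dzbarPow S f) := by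
    unfold dzbarPow
    rw [dz_eq_wirt, dzbar_eq_wirt]
    exact foldr_wirt_comm _ _ _ _ _ hf
  rw [h1]
  unfold dzPow
  rw [dz_eq_wirt, foldr_wirt_single _ _ _ _ (List.nodup_finRange n) hS,
    if_pos (List.mem_finRange i)]
  exact foldr_wirt_comm _ _ _ _ _ hS

theorem dMixed_dzbar (R S : MultiIndex n) (i : Fin n) {f : (Fin n → ℂ) → ℂ}
    (hf : ContDiff ℝ ∞ f) : dMixed R S (dzbar i f) = dMixed R (S + unitIdx i) f := by
  unfold dMixed dzbarPow
  rw [dzbar_eq_wirt, foldr_wirt_single _ _ _ _ (List.nodup_finRange n) hf,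
    if_pos (List.mem_finRange i), foldr_wirt_comm _ _ _ _ _ hf]

theorem foldr_iterate_zero {α β : Type*} (D : β → α → α) (L : List β) (f : α) :
    L.foldr (fun i g => (D i)^[0] g) f = f := by
  induction L with
  | nil => rfl
  | cons j L ih => exact ih

@[simp] theorem dzPow_zero (f : (Fin n → ℂ) → ℂ) : dzPow 0 f = f := foldr_iterate_zero _ _ _

@[simp] theorem dzbarPow_zero (f : (Fin n → ℂ) → ℂ) : dzbarPow 0 f = f :=
  foldr_iterate_zero _ _ _

theorem dMixed_zero_left (S : MultiIndex n) (f : (Fin n → ℂ) → ℂ) :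
    dMixed 0 S f = dzbarPow S f := by simp [dMixed]

/-- A real directional derivative in terms of Wirtinger derivatives. -/
theorem fderiv_eq_sum (f : (Fin n → ℂ) → ℂ) (z v : Fin n → ℂ) :
    fderiv ℝ f z v = ∑ i, (v i * dz i f z + star (v i) * dzbar i f z) := by
  have hv : v = ∑ i, ((v i).re • (Pi.single i 1 : Fin n → ℂ) + (v i).im • (Pi.single i Complex.I : Fin n → ℂ)) := by
    ext j
    rw [Finset.sum_apply, Finset.sum_eq_single j]
    · simp [Complex.re_add_im]
    · intro i _ hij; simp [Pi.single_eq_of_ne (Ne.symm hij)]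
    · simp
  conv_lhs => rw [hv]
  rw [map_sum]
  refine Finset.sum_congr rfl fun i _ => ?_
  rw [map_add, map_smul, map_smul]
  have h1 : v i = (v i).re + (v i).im * Complex.I := (Complex.re_add_im _).symm
  have h2 : star (v i) = (v i).re - (v i).im * Complex.I := by
    conv_lhs => rw [h1]
    apply Complex.ext <;> simp
  simp only [dz, dzbar, Complex.real_smul]
  rw [h2]
  conv_rhs => enter [1, 1]; rw [h1]
  linear_combination (((v i).im : ℂ) * fderiv ℝ f z (Pi.single i Complex.I)) * Complex.I_sq

theorem jet_sum {ι : Type*} (s : Finset ι) (F : ι → (Fin n → ℂ) → ℂ)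
    (hF : ∀ i ∈ s, ContDiff ℝ ∞ (F i)) (R S : MultiIndex n) :
    dMixed R S (∑ i ∈ s, F i) = ∑ i ∈ s, dMixed R S (F i) ∧ ContDiff ℝ ∞ (∑ i ∈ s, F i) := by
  classical
  induction s using Finset.induction_on with
  | empty =>
    refine ⟨?_, contDiff_const⟩
    have := dMixed_smul R S 0 (f := (0 : (Fin n → ℂ) → ℂ)) contDiff_const
    simpa using this
  | insert i s hi ih =>
    obtain ⟨h1, h2⟩ := ih fun j hj => hF j (Finset.mem_insert_of_mem hj)
    have h3 := hF i (Finset.mem_insert_self _ _)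
    rw [Finset.sum_insert hi, Finset.sum_insert hi]
    exact ⟨by rw [dMixed_add R S h3 h2, h1], h3.add h2⟩

/-- A real-analytic function with vanishing infinite jet at a point is zero. -/
theorem eq_zero_of_jet_eq_zero {f : (Fin n → ℂ) → ℂ} (hf : AnalyticOnNhd ℝ f Set.univ)
    (p : Fin n → ℂ) (h0 : ∀ R S, dMixed R S f p = 0) : f = 0 := by
  -- The derivatives along a line through `p` are again restrictions of smooth functions with
  -- vanishing jet at `p`; this form, stronger than vanishing of the derivatives at `0`, is what the
  -- induction needs.
  have hline : ∀ (v : Fin n → ℂ) (k : ℕ), ∃ g : (Fin n → ℂ) → ℂ, ContDiff ℝ ∞ g ∧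
      (∀ R S, dMixed R S g p = 0) ∧
      iteratedDeriv k (fun t : ℝ => f (p + t • v)) = fun t : ℝ => g (p + t • v) := by
    intro v k
    induction k with
    | zero => exact ⟨f, hf.contDiff, h0, iteratedDeriv_zero⟩
    | succ k ih =>
      obtain ⟨g, hg, hg0, hgk⟩ := ih
      have h1 : ∀ i, ContDiff ℝ ∞ (v i • dz i g) := fun i => contDiff_const.smul (contDiff_dz i hg)
      have h2 : ∀ i, ContDiff ℝ ∞ (star (v i) • dzbar i g) := fun i =>
        contDiff_const.smul (contDiff_dzbar i hg)
      have h3 := jet_sum Finset.univ (fun i => v i • dz i g + star (v i) • dzbar i g)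
        (fun i _ => (h1 i).add (h2 i))
      refine ⟨∑ i, (v i • dz i g + star (v i) • dzbar i g), (h3 0 0).2, fun R S => ?_, ?_⟩
      · rw [(h3 R S).1, Finset.sum_apply]
        refine Finset.sum_eq_zero fun i _ => ?_
        rw [dMixed_add R S (h1 i) (h2 i), dMixed_smul R S _ (contDiff_dz i hg),
          dMixed_smul R S _ (contDiff_dzbar i hg), dMixed_dz R S i hg, dMixed_dzbar R S i hg]
        simp [hg0]
      · rw [iteratedDeriv_succ, hgk]
        ext t
        have h4 : HasDerivAt (fun t : ℝ => p + t • v) v t := by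
          simpa using ((hasDerivAt_id t).smul_const v).const_add p
        have h5 := ((hg.differentiable (by simp) (p + t • v)).hasFDerivAt.comp_hasDerivAt t h4).deriv
        refine h5.trans ?_
        rw [fderiv_eq_sum]
        simp
  ext z
  set v := z - p
  have ha : AnalyticOnNhd ℝ (fun t : ℝ => f (p + t • v)) Set.univ := fun t _ =>
    (hf _ (Set.mem_univ _)).comp (analyticAt_const.add (analyticAt_id.smul analyticAt_const))
  -- Infinite vanishing order at `0` makes the analytic function of one real variable vanish on the
  -- whole line, and the parameter `1` gives the point `z`.
  have h1 : analyticOrderAt (fun t : ℝ => f (p + t • v)) 0 = ⊤ :=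
    ENat.eq_top_iff_forall_ge.2 fun m =>
      (natCast_le_analyticOrderAt_iff_iteratedDeriv_eq_zero (ha 0 (Set.mem_univ _))).2 fun k _ => by
        obtain ⟨g, _, hg0, hgk⟩ := hline v k
        rw [hgk]
        simpa [dMixed_zero_left] using hg0 0 0
  have h2 := ha.eqOn_zero_of_preconnected_of_eventuallyEq_zero isPreconnected_univ
    (Set.mem_univ 0) (analyticOrderAt_eq_top.1 h1) (Set.mem_univ 1)
  simpa [v] using h2

end Wirtinger

/-! ### Power series with coefficients of slow factorial growth -/

section PowerSeries

/-- The monomial `u ^ R`. -/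
def mon (R : MultiIndex n) (u : Fin n → ℂ) : ℂ := ∏ i, u i ^ R i

theorem mon_add (R S : MultiIndex n) (u : Fin n → ℂ) : mon (R + S) u = mon R u * mon S u := by
  simp [mon, pow_add, Finset.prod_mul_distrib]

@[simp] theorem mon_zero (u : Fin n → ℂ) : mon 0 u = 1 := by simp [mon]

theorem mon_apply_zero (R : MultiIndex n) : mon R (0 : Fin n → ℂ) = if R = 0 then 1 else 0 := by
  split_ifs with h
  · simp [h]
  · obtain ⟨i, hi⟩ := Function.ne_iff.1 h
    exact Finset.prod_eq_zero (Finset.mem_univ i) (by simpa using hi)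

theorem nnnorm_mon_le {R : MultiIndex n} {u : Fin n → ℂ} {r : ℝ≥0} (hu : ‖u‖₊ ≤ r) :
    ‖mon R u‖₊ ≤ r ^ deg R := by
  rw [mon, nnnorm_prod, deg, ← Finset.prod_pow_eq_pow_sum]
  refine Finset.prod_le_prod' fun i _ => ?_
  rw [nnnorm_pow]
  gcongr
  exact (nnnorm_le_pi_nnnorm u i).trans hu

/-- The Taylor coefficient belonging to the array of derivatives `a`. -/
def coef (a : MultiIndex n → MultiIndex n → ℂ) (P : MultiIndex n × MultiIndex n) : ℂ :=
  a P.1 P.2 / (fact P.1 * fact P.2)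

/-- The summand of the Taylor series with derivatives `a`. -/
def pterm (a : MultiIndex n → MultiIndex n → ℂ) (u v : Fin n → ℂ)
    (P : MultiIndex n × MultiIndex n) : ℂ := coef a P * (mon P.1 u * mon P.2 v)

/-- The Taylor series with derivatives `a`. -/
def pser (a : MultiIndex n → MultiIndex n → ℂ) (u v : Fin n → ℂ) : ℂ := ∑' P, pterm a u v P

/-- The majorant of a power series in one group of variables. -/
def majorant (d : ℝ) (r : ℝ≥0) (R : MultiIndex n) : ℝ≥0 := (fact R : ℝ≥0)⁻¹ * (r ^ deg R * wt d R)

theorem summable_majorant {d : ℝ} (hd : d < 1) (r : ℝ≥0) :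
    Summable fun R : MultiIndex n => majorant d r R := by
  -- Half of the gap between `d` and `1` is spent on absorbing `r^|R|`; the total exponent `(1 + d)
  -- / 2` stays below `1`.
  obtain ⟨C, hC⟩ := exists_pow_deg_le (n := n) r (d := (1 - d) / 2) (by linarith)
  refine NNReal.summable_of_le (fun R => ?_)
    ((summable_fact_wt (n := n) (d := (1 - d) / 2 + d) (by linarith)).mul_left C)
  calc majorant d r R ≤ (fact R : ℝ≥0)⁻¹ * (C * wt ((1 - d) / 2) R * wt d R) := by
        rw [majorant]; gcongr; exact hC R
    _ = _ := by rw [wt_add_exp]; ring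

variable {a : MultiIndex n → MultiIndex n → ℂ} {d : ℝ} {B : ℝ≥0}

theorem nnnorm_coef_le (ha : Bd d B a) (r s : ℝ≥0) (P : MultiIndex n × MultiIndex n) :
    ‖coef a P‖₊ * (r ^ deg P.1 * s ^ deg P.2) ≤ B * (majorant d r P.1 * majorant d s P.2) := by
  have h : ‖coef a P‖₊ = ‖a P.1 P.2‖₊ * ((fact P.1 : ℝ≥0)⁻¹ * (fact P.2 : ℝ≥0)⁻¹) := by
    simp [coef, div_eq_mul_inv, mul_comm]
  rw [h]
  calc _ ≤ B * (wt d P.1 * wt d P.2) * ((fact P.1 : ℝ≥0)⁻¹ * (fact P.2 : ℝ≥0)⁻¹) *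
        (r ^ deg P.1 * s ^ deg P.2) := by gcongr; exact ha _ _
    _ = _ := by rw [majorant, majorant]; ring

theorem summable_majorant_mul (hd : d < 1) (r s : ℝ≥0) :
    Summable fun P : MultiIndex n × MultiIndex n => majorant d r P.1 * majorant d s P.2 := by
  have h := fun r : ℝ≥0 => summable_majorant (n := n) hd r
  rw [← NNReal.summable_coe]
  push_cast
  exact ((NNReal.summable_coe.2 (h r))).mul_of_nonneg (NNReal.summable_coe.2 (h s))
    (fun _ => NNReal.coe_nonneg _) (fun _ => NNReal.coe_nonneg _)

theorem summable_coef (ha : Bd d B a) (hd : d < 1) (r s : ℝ≥0) :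
    Summable fun P : MultiIndex n × MultiIndex n =>
      ‖coef a P‖₊ * (r ^ deg P.1 * s ^ deg P.2) :=
  NNReal.summable_of_le (nnnorm_coef_le ha r s) ((summable_majorant_mul hd r s).mul_left B)

theorem nnnorm_pterm_le (a : MultiIndex n → MultiIndex n → ℂ) {u v : Fin n → ℂ} {r s : ℝ≥0}
    (hu : ‖u‖₊ ≤ r) (hv : ‖v‖₊ ≤ s) (P : MultiIndex n × MultiIndex n) :
    ‖pterm a u v P‖₊ ≤ ‖coef a P‖₊ * (r ^ deg P.1 * s ^ deg P.2) := by
  rw [pterm, nnnorm_mul, nnnorm_mul]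
  gcongr
  · exact nnnorm_mon_le hu
  · exact nnnorm_mon_le hv

theorem summable_nnnorm_pterm (ha : Bd d B a) (hd : d < 1) (u v : Fin n → ℂ) :
    Summable fun P => ‖pterm a u v P‖₊ :=
  NNReal.summable_of_le (nnnorm_pterm_le a le_rfl le_rfl) (summable_coef ha hd _ _)

theorem summable_norm_pterm (ha : Bd d B a) (hd : d < 1) (u v : Fin n → ℂ) :
    Summable fun P => ‖pterm a u v P‖ :=
  NNReal.summable_coe.2 (summable_nnnorm_pterm ha hd u v)

theorem hasSum_pser (ha : Bd d B a) (hd : d < 1) (u v : Fin n → ℂ) :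
    HasSum (pterm a u v) (pser a u v) := (summable_norm_pterm ha hd u v).of_norm.hasSum

theorem nnnorm_pser_le (ha : Bd d B a) (hd : d < 1) (u v : Fin n → ℂ) :
    ‖pser a u v‖₊ ≤ B * ∑' P : MultiIndex n × MultiIndex n,
      majorant d ‖u‖₊ P.1 * majorant d ‖v‖₊ P.2 := by
  refine (nnnorm_tsum_le (summable_nnnorm_pterm ha hd u v)).trans ?_
  rw [← NNReal.tsum_mul_left]
  exact (summable_nnnorm_pterm ha hd u v).tsum_le_tsum
    (fun P => (nnnorm_pterm_le a le_rfl le_rfl P).trans (nnnorm_coef_le ha _ _ P))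
    ((summable_majorant_mul hd _ _).mul_left B)

theorem pser_zero (a : MultiIndex n → MultiIndex n → ℂ) : pser a 0 0 = a 0 0 := by
  rw [pser, tsum_eq_single 0]
  · simp [pterm, coef]
  · rintro ⟨R, S⟩ h
    simp only [pterm, mon_apply_zero]
    split_ifs with h1 h2
    · exact absurd (by rw [h1, h2]; rfl) h
    all_goals simp

/-- Monomials are restrictions of multilinear forms of norm at most `1` to the diagonal. -/
theorem exists_multilinear_mon (P : MultiIndex n × MultiIndex n) :
    ∃ M : ContinuousMultilinearMap ℂ
      (fun _ : Fin (deg P.1 + deg P.2) => (Fin n → ℂ) × (Fin n → ℂ)) ℂ,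
      ‖M‖ ≤ 1 ∧ ∀ q : (Fin n → ℂ) × (Fin n → ℂ), M (fun _ => q) = mon P.1 q.1 * mon P.2 q.2 := by
  let E := (Fin n → ℂ) × (Fin n → ℂ)
  -- The forms are built one linear factor of norm at most `1` at a time. `Q k φ` says that `φ`
  -- comes from such a form of degree `k`.
  let Q : ℕ → (E → ℂ) → Prop := fun k φ => ∃ M : ContinuousMultilinearMap ℂ (fun _ : Fin k => E) ℂ,
    ‖M‖ ≤ 1 ∧ ∀ q : E, M (fun _ => q) = φ q
  have hlin : ∀ (l : E →L[ℂ] ℂ), ‖l‖ ≤ 1 → ∀ k φ, Q k φ → Q (k + 1) (fun q => l q * φ q) := by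
    rintro l hl k φ ⟨M, hM, hMφ⟩
    refine ⟨(l.smulRight M).uncurryLeft, ?_, fun q => ?_⟩
    · rw [ContinuousLinearMap.uncurryLeft_norm, ContinuousLinearMap.norm_smulRight_apply]
      exact mul_le_one₀ hl (norm_nonneg _) hM
    · change _ = l q * φ q
      rw [← hMφ]
      simp only [ContinuousLinearMap.uncurryLeft_apply, ContinuousLinearMap.smulRight_apply,
        smul_apply, smul_eq_mul]
      rfl
  have hpow : ∀ (l : E →L[ℂ] ℂ), ‖l‖ ≤ 1 → ∀ r k φ, Q k φ → Q (r + k) (fun q => l q ^ r * φ q) := by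
    intro l hl r k φ h
    induction r with
    | zero => simpa using h
    | succ r ih =>
      have := hlin l hl _ _ ih
      rw [show r + 1 + k = r + k + 1 by ring]
      simpa only [pow_succ', mul_assoc] using this
  have hprod : ∀ (l : Fin n → (E →L[ℂ] ℂ)), (∀ i, ‖l i‖ ≤ 1) → ∀ (R : MultiIndex n) k φ, Q k φ →
      Q (deg R + k) (fun q => (∏ i, l i q ^ R i) * φ q) := by
    intro l hl R k φ h
    have : ∀ s : Finset (Fin n), Q (∑ i ∈ s, R i + k) (fun q => (∏ i ∈ s, l i q ^ R i) * φ q) := by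
      intro s
      induction s using Finset.induction_on with
      | empty => simpa using h
      | insert i s hi ih =>
        have := hpow (l i) (hl i) (R i) _ _ ih
        simpa only [Finset.sum_insert hi, Finset.prod_insert hi, mul_assoc, add_assoc] using this
    exact this Finset.univ
  have hone : Q 0 (fun _ => 1) :=
    ⟨ContinuousMultilinearMap.constOfIsEmpty ℂ _ 1, by simp, fun q => by simp⟩
  have hpr : ∀ i : Fin n, ‖(ContinuousLinearMap.proj i : (Fin n → ℂ) →L[ℂ] ℂ)‖ ≤ 1 := fun i =>
    ContinuousLinearMap.opNorm_le_bound _ zero_le_one fun v => by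
      simpa using norm_le_pi_norm v i
  have h1 := hprod (fun i => (ContinuousLinearMap.proj i).comp (ContinuousLinearMap.fst ℂ _ _))
    (fun i => (ContinuousLinearMap.opNorm_comp_le _ _).trans
      (mul_le_one₀ (hpr i) (norm_nonneg _) (ContinuousLinearMap.norm_fst_le ..))) P.1 _ _
    (hprod (fun i => (ContinuousLinearMap.proj i).comp (ContinuousLinearMap.snd ℂ _ _))
    (fun i => (ContinuousLinearMap.opNorm_comp_le _ _).trans
      (mul_le_one₀ (hpr i) (norm_nonneg _) (ContinuousLinearMap.norm_snd_le ..))) P.2 _ _ hone)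
  rw [add_zero] at h1
  obtain ⟨M, hM, hMq⟩ := h1
  exact ⟨M, hM, fun q => by rw [hMq]; simp only [mul_one]; rfl⟩

/-- Group the monomials by total degree. The coefficients are summable against every `r^degree` and
the monomials come from multilinear forms of norm at most `1`, so the resulting formal series has
infinite radius of convergence. -/
theorem analyticOnNhd_pser (ha : Bd d B a) (hd : d < 1) :
    AnalyticOnNhd ℂ (fun q : (Fin n → ℂ) × (Fin n → ℂ) => pser a q.1 q.2) Set.univ := by
  choose M hM1 hM2 using exists_multilinear_mon (n := n)
  let g : MultiIndex n × MultiIndex n → ℕ := fun P => deg P.1 + deg P.2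
  -- The arity of `M P` is the degree of `P`; on the fibre over `k` it is transported to arity `k`,
  -- so that the forms can be added.
  let M' : ∀ (k : ℕ) (P : g ⁻¹' {k}), ContinuousMultilinearMap ℂ
      (fun _ : Fin k => (Fin n → ℂ) × (Fin n → ℂ)) ℂ := fun k P =>
    (show g P.1 = k from P.2) ▸ M P.1
  have hM'1 : ∀ k P, ‖M' k P‖ ≤ 1 := by
    rintro k ⟨P, hP⟩
    have hP' : g P = k := hP
    subst hP'
    exact hM1 P
  have hM'2 : ∀ k P q, M' k P (fun _ => q) = mon P.1.1 q.1 * mon P.1.2 q.2 := by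
    rintro k ⟨P, hP⟩ q
    have hP' : g P = k := hP
    subst hP'
    exact hM2 P q
  have hs : ∀ r : ℝ≥0, Summable fun P => ‖coef a P‖ * (r : ℝ) ^ g P := fun r => by
    have := NNReal.summable_coe.2 (summable_coef ha hd r r)
    simpa [← pow_add] using this
  have hs1 : Summable fun P => ‖coef a P‖ := by simpa using hs 1
  have hsf : ∀ k, Summable fun P : g ⁻¹' {k} => ‖coef a P.1 • M' k P‖ := fun k =>
    (hs1.subtype (g ⁻¹' {k})).of_nonneg_of_le (fun _ => norm_nonneg _) fun P => by
      rw [norm_smul]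
      exact mul_le_of_le_one_right (norm_nonneg _) (hM'1 k P)
  let p : FormalMultilinearSeries ℂ ((Fin n → ℂ) × (Fin n → ℂ)) ℂ := fun k =>
    ∑' P : g ⁻¹' {k}, coef a P.1 • M' k P
  have hp : ∀ k q, HasSum (fun P : g ⁻¹' {k} => pterm a q.1 q.2 P.1) (p k (fun _ => q)) := by
    intro k q
    have h1 := ((hsf k).of_norm.hasSum).mapL
      (ContinuousMultilinearMap.apply ℂ (fun _ : Fin k => (Fin n → ℂ) × (Fin n → ℂ)) ℂ (fun _ => q))
    have h2 : (fun P : g ⁻¹' {k} => pterm a q.1 q.2 P.1) = fun P : g ⁻¹' {k} =>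
        ContinuousMultilinearMap.apply ℂ (fun _ : Fin k => (Fin n → ℂ) × (Fin n → ℂ)) ℂ
          (fun _ => q) (coef a P.1 • M' k P) := by
      ext P
      rw [map_smul, smul_eq_mul]
      exact congrArg _ (hM'2 k P q).symm
    rw [h2]
    exact h1
  have hrad : p.radius = ⊤ := by
    refine p.radius_eq_top_of_summable_norm fun r => ?_
    have h1 := ((hs r).hasSum.tsum_fiberwise g).summable
    refine h1.of_nonneg_of_le (fun k => by positivity) fun k => ?_
    have h2 : ‖p k‖ ≤ ∑' P : g ⁻¹' {k}, ‖coef a P.1‖ := by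
      refine (norm_tsum_le_tsum_norm (hsf k)).trans ?_
      refine (hsf k).tsum_le_tsum (fun P => ?_) (hs1.subtype _)
      rw [norm_smul]
      exact mul_le_of_le_one_right (norm_nonneg _) (hM'1 k P)
    refine (mul_le_mul_of_nonneg_right h2 (by positivity)).trans (le_of_eq ?_)
    rw [← tsum_mul_right]
    refine tsum_congr fun P => ?_
    have : g P.1 = k := P.2
    rw [this]
  have hball : HasFPowerSeriesOnBall (fun q : (Fin n → ℂ) × (Fin n → ℂ) => pser a q.1 q.2) p 0 ⊤ :=
    { r_le := hrad.ge
      r_pos := ENNReal.zero_lt_top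
      hasSum := fun {q} _ => by
        rw [zero_add]
        have h1 := (hasSum_pser ha hd q.1 q.2).tsum_fiberwise g
        convert h1 using 1
        ext k
        exact (hp k q).tsum_eq.symm }
  simpa using hball.analyticOnNhd

end PowerSeries

/-! ### Derivatives of power series -/

section PowerSeriesDeriv

/-- The array of derivatives of the `(R, S)`-th derivative. -/
def shift (R S : MultiIndex n) (a : MultiIndex n → MultiIndex n → ℂ) :
    MultiIndex n → MultiIndex n → ℂ := fun I J => a (I + R) (J + S)

theorem shift_shift (R S R' S' : MultiIndex n) (a : MultiIndex n → MultiIndex n → ℂ) :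
    shift R S (shift R' S' a) = shift (R + R') (S + S') a := by
  ext I J; simp [shift, add_assoc]

@[simp] theorem shift_zero (a : MultiIndex n → MultiIndex n → ℂ) : shift 0 0 a = a := by
  ext I J; simp [shift]

/-- The constant depends neither on the array nor on `R`, `S`, so the bounds for different shifts
can be summed later. -/
theorem exists_bd_shift {d : ℝ} (hd : 0 ≤ d) : ∃ C : ℝ≥0, ∀ (a : MultiIndex n → MultiIndex n → ℂ)
    (B : ℝ≥0) (R S : MultiIndex n), Bd d B a →
      Bd (2 * d) (C * B * (wt (2 * d) R * wt (2 * d) S)) (shift R S a) := by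
  obtain ⟨C, hC⟩ := exists_wt_add_le (n := n) hd
  refine ⟨C ^ 2, fun a B R S ha I J => (ha _ _).trans ?_⟩
  calc B * (wt d (I + R) * wt d (J + S)) ≤ B * ((C * (wt (2 * d) I * wt (2 * d) R)) *
        (C * (wt (2 * d) J * wt (2 * d) S))) := by gcongr <;> exact hC _ _
    _ = _ := by ring

theorem Tame.shift {a : MultiIndex n → MultiIndex n → ℂ} (ha : Tame a) (R S : MultiIndex n) :
    Tame (shift R S a) := fun d hd => by
  obtain ⟨C, hC⟩ := exists_bd_shift (n := n) (d := d / 2) (by linarith)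
  obtain ⟨B, hB⟩ := ha (d / 2) (by linarith)
  have := hC a B R S hB
  rw [mul_div_cancel₀ d two_ne_zero] at this
  exact ⟨_, this⟩

/-- Any exponent below `1` suffices for convergence of the Taylor series; `1 / 2` is an arbitrary
choice. -/
theorem Tame.exists_bd {a : MultiIndex n → MultiIndex n → ℂ} (ha : Tame a) :
    ∃ B, Bd (1 / 2) B a := ha _ (by norm_num)

theorem Tame.hasSum_pser {a : MultiIndex n → MultiIndex n → ℂ} (ha : Tame a) (u v : Fin n → ℂ) :
    HasSum (pterm a u v) (pser a u v) :=
  let ⟨_, hB⟩ := ha.exists_bd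
  WickStar.hasSum_pser hB (by norm_num) u v

theorem Tame.analyticOnNhd_pser {a : MultiIndex n → MultiIndex n → ℂ} (ha : Tame a) :
    AnalyticOnNhd ℂ (fun q : (Fin n → ℂ) × (Fin n → ℂ) => pser a q.1 q.2) Set.univ :=
  let ⟨_, hB⟩ := ha.exists_bd
  WickStar.analyticOnNhd_pser hB (by norm_num)

/-- The jets of a power series at points of a ball are bounded uniformly in the series. -/
theorem exists_bd_pser_shift {e : ℝ} (he : 0 < e) (u v : Fin n → ℂ) :
    ∃ d : ℝ, 0 < d ∧ ∃ C : ℝ≥0, ∀ (a : MultiIndex n → MultiIndex n → ℂ) (B : ℝ≥0), Bd d B a →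
      Bd e (C * B) (fun R S => pser (shift R S a) u v) := by
  obtain ⟨d, hd, hd1, hd2⟩ : ∃ d : ℝ, 0 < d ∧ 2 * d ≤ e ∧ 2 * d < 1 :=
    ⟨min e 1 / 3, by positivity, by linarith [min_le_left e 1, lt_min he one_pos],
      by linarith [min_le_right e 1]⟩
  obtain ⟨C, hC⟩ := exists_bd_shift (n := n) hd.le
  refine ⟨d, hd, C * ∑' P : MultiIndex n × MultiIndex n,
    majorant (2 * d) ‖u‖₊ P.1 * majorant (2 * d) ‖v‖₊ P.2, fun a B ha => ?_⟩
  refine Bd.mono_exp (fun R S => ?_) hd1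
  refine (nnnorm_pser_le (hC a B R S ha) hd2 u v).trans (le_of_eq ?_)
  ring

theorem Tame.pser_shift {a : MultiIndex n → MultiIndex n → ℂ} (ha : Tame a) (u v : Fin n → ℂ) :
    Tame (fun R S => pser (WickStar.shift R S a) u v) := fun e he => by
  obtain ⟨d, hd, C, hC⟩ := exists_bd_pser_shift he u v
  obtain ⟨B, hB⟩ := ha d hd
  exact ⟨_, hC a B hB⟩

theorem fact_add_unitIdx (R : MultiIndex n) (i : Fin n) :
    fact (R + unitIdx i) = (R i + 1) * fact R := by
  have h : fact (R + unitIdx i) = ∏ j, (if j = i then R i + 1 else 1) * (R j).factorial := by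
    refine Finset.prod_congr rfl fun j _ => ?_
    split_ifs with h
    · subst h; simp [unitIdx, Nat.factorial_succ]
    · simp [unitIdx, Pi.single_eq_of_ne h]
  rw [h, Finset.prod_mul_distrib]
  simp [fact]

/-- If `R i = 0`, the truncated subtraction is harmless because of the factor `R i`. -/
theorem hasDerivAt_mon (R : MultiIndex n) (u : Fin n → ℂ) (i : Fin n) (t : ℂ) :
    HasDerivAt (fun t : ℂ => mon R (u + t • Pi.single i 1))
      (R i * mon (R - unitIdx i) (u + t • Pi.single i 1)) t := by
  have h1 : ∀ (S : MultiIndex n) (t : ℂ), mon S (u + t • Pi.single i 1) =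
      (u i + t) ^ S i * ∏ j ∈ Finset.univ.erase i, u j ^ S j := fun S t => by
    rw [mon, ← Finset.mul_prod_erase _ _ (Finset.mem_univ i)]
    congr 1
    · simp
    · refine Finset.prod_congr rfl fun j hj => ?_
      simp [Pi.single_eq_of_ne (Finset.ne_of_mem_erase hj)]
  have h2 : HasDerivAt (fun t : ℂ => (u i + t) ^ R i) (R i * (u i + t) ^ (R i - 1)) t := by
    have := ((hasDerivAt_id' t).const_add (u i)).fun_pow (R i)
    rwa [mul_one] at this
  simp only [h1]
  refine (h2.mul_const (∏ j ∈ Finset.univ.erase i, u j ^ R j)).congr_deriv ?_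
  rw [mul_assoc]
  congr 2
  · simp [unitIdx]
  · refine Finset.prod_congr rfl fun j hj => ?_
    simp [unitIdx, Pi.single_eq_of_ne (Finset.ne_of_mem_erase hj)]

theorem differentiable_line {G : (Fin n → ℂ) × (Fin n → ℂ) → ℂ} (hG : Differentiable ℂ G)
    (u v x y : Fin n → ℂ) : Differentiable ℂ fun t : ℂ => G (u + t • x, v + t • y) := by
  have h : Differentiable ℂ fun t : ℂ => (u + t • x, v + t • y) :=
    ((differentiable_id.smul_const _).const_add u).prodMk
      ((differentiable_id.smul_const _).const_add v)
  exact hG.comp h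

theorem hasDerivAt_line {G : (Fin n → ℂ) × (Fin n → ℂ) → ℂ} (hG : Differentiable ℂ G)
    (u v x y : Fin n → ℂ) :
    HasDerivAt (fun t : ℂ => G (u + t • x, v + t • y)) (fderiv ℂ G (u, v) (x, y)) 0 := by
  have h : ∀ u x : Fin n → ℂ, HasDerivAt (fun t : ℂ => u + t • x) x 0 := fun u x => by
    have := ((hasDerivAt_id' (0 : ℂ)).smul_const x).const_add u
    rwa [one_smul] at this
  have h1 := (h u x).prodMk (h v y)
  have h2 : HasFDerivAt G (fderiv ℂ G (u, v)) (u + (0 : ℂ) • x, v + (0 : ℂ) • y) := by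
    rw [zero_smul, zero_smul, add_zero, add_zero]
    exact (hG _).hasFDerivAt
  exact h2.comp_hasDerivAt (0 : ℂ) h1

/-- The terms are holomorphic in `t` and dominated by a summable sequence on the unit disc, so the
series may be differentiated term by term. The derivative is then reindexed by `R ↦ R + unitIdx i`.
-/
theorem hasDerivAt_pser_left {a : MultiIndex n → MultiIndex n → ℂ} (ha : Tame a)
    (u v : Fin n → ℂ) (i : Fin n) :
    HasDerivAt (fun t : ℂ => pser a (u + t • Pi.single i 1) v)
      (pser (shift (unitIdx i) 0 a) u v) 0 := by
  have hdiff : Differentiable ℂ (fun q : (Fin n → ℂ) × (Fin n → ℂ) => pser a q.1 q.2) := fun q =>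
    (ha.analyticOnNhd_pser q (Set.mem_univ _)).differentiableAt
  have hline : Differentiable ℂ (fun t : ℂ => pser a (u + t • Pi.single i 1) v) := by
    have h := differentiable_line hdiff u v (Pi.single i 1) 0
    simpa only [smul_zero, add_zero] using h
  obtain ⟨B, hB⟩ := ha.exists_bd
  -- The radius `‖u‖ + 1` accommodates all translates with `|t| ≤ 1`.
  have hs := NNReal.summable_coe.2 (summable_coef hB (by norm_num) (‖u‖₊ + 1) ‖v‖₊)
  have hterm : ∀ P t, HasDerivAt (fun t : ℂ => pterm a (u + t • Pi.single i 1) v P)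
      (coef a P * (P.1 i * mon (P.1 - unitIdx i) (u + t • Pi.single i 1) * mon P.2 v)) t :=
    fun P t => ((hasDerivAt_mon P.1 u i t).mul_const (mon P.2 v)).const_mul (coef a P)
  have h1 := Complex.hasSum_deriv_of_summable_norm (U := Metric.ball (0 : ℂ) 1) hs
    (F := fun P t => pterm a (u + t • Pi.single i 1) v P)
    (fun P t _ => (hterm P t).differentiableAt.differentiableWithinAt) Metric.isOpen_ball
    (fun P t ht => by
      refine NNReal.coe_le_coe.2 (nnnorm_pterm_le a ?_ le_rfl P)
      refine (nnnorm_add_le _ _).trans ?_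
      gcongr
      rw [nnnorm_smul]
      have ht' : ‖t‖₊ ≤ 1 := by
        rw [mem_ball_zero_iff] at ht
        exact_mod_cast ht.le
      have : ‖(Pi.single i 1 : Fin n → ℂ)‖₊ ≤ 1 := by
        rw [Pi.nnnorm_single]; simp
      exact mul_le_one' ht' this) (Metric.mem_ball_self one_pos)
  have h2 : HasSum (pterm (shift (unitIdx i) 0 a) u v)
      (deriv (fun t : ℂ => pser a (u + t • Pi.single i 1) v) 0) := by
    have hinj : Function.Injective fun P : MultiIndex n × MultiIndex n =>
        (P.1 + unitIdx i, P.2) := by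
      rintro ⟨R, S⟩ ⟨R', S'⟩ h
      simpa using h
    have h3 := (hinj.hasSum_iff (fun P hP => ?_)).2 h1
    · refine (congrArg (fun φ => HasSum φ _) (funext ?_)).mp h3
      rintro ⟨R, S⟩
      simp only [Function.comp_apply, (hterm _ _).deriv, zero_smul, add_zero, add_tsub_cancel_right]
      simp only [pterm, coef, shift, fact_add_unitIdx, add_zero]
      have e1 : (fact R : ℂ) ≠ 0 := fact_ne_zero' R
      have e2 : (fact S : ℂ) ≠ 0 := fact_ne_zero' S
      have e3 : ((R i : ℂ) + 1) ≠ 0 := Nat.cast_add_one_ne_zero (R i)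
      have e4 : (R + unitIdx i) i = R i + 1 := by simp [unitIdx]
      rw [e4]
      push_cast
      field_simp
    -- An index outside the range of the shift has `P.1 i = 0`, so its term has derivative zero.
    · rw [(hterm P 0).deriv]
      have : P.1 i = 0 := by
        by_contra h
        refine hP ⟨(P.1 - unitIdx i, P.2), ?_⟩
        refine Prod.ext (funext fun j => ?_) rfl
        by_cases hj : j = i
        · subst hj; simp [unitIdx]; omega
        · simp [unitIdx, Pi.single_eq_of_ne hj]
      simp [this]
  rw [((ha.shift _ _).hasSum_pser u v).unique h2]
  exact (hline 0).hasDerivAt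

/-- The array with the two groups of variables exchanged. -/
def flip (a : MultiIndex n → MultiIndex n → ℂ) : MultiIndex n → MultiIndex n → ℂ := fun R S => a S R

theorem pser_flip (a : MultiIndex n → MultiIndex n → ℂ) (u v : Fin n → ℂ) :
    pser (flip a) v u = pser a u v := by
  unfold pser
  rw [← (Equiv.prodComm _ _).tsum_eq]
  refine tsum_congr fun P => ?_
  simp only [pterm, coef, flip, Equiv.prodComm_apply, Prod.fst_swap, Prod.snd_swap]
  rw [mul_comm (fact P.2 : ℂ), mul_comm (mon P.2 v)]

theorem Bd.flip {a : MultiIndex n → MultiIndex n → ℂ} {d : ℝ} {B : ℝ≥0} (ha : Bd d B a) :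
    Bd d B (flip a) := fun R S => (ha S R).trans_eq (by rw [mul_comm (wt d S)])

theorem Tame.flip {a : MultiIndex n → MultiIndex n → ℂ} (ha : Tame a) : Tame (flip a) :=
  fun d hd => (ha d hd).imp fun _ h => h.flip

theorem hasDerivAt_pser_right {a : MultiIndex n → MultiIndex n → ℂ} (ha : Tame a)
    (u v : Fin n → ℂ) (i : Fin n) :
    HasDerivAt (fun t : ℂ => pser a u (v + t • Pi.single i 1))
      (pser (shift 0 (unitIdx i) a) u v) 0 := by
  have h := hasDerivAt_pser_left ha.flip v u i
  simp only [pser_flip] at h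
  have h2 : pser (shift 0 (unitIdx i) a) u v = pser (shift (unitIdx i) 0 (WickStar.flip a)) v u := by
    rw [← pser_flip]; rfl
  rwa [h2]

/-- The function on `ℂⁿ` whose jet at `p` is `a`. -/
def ofJet (p : Fin n → ℂ) (a : MultiIndex n → MultiIndex n → ℂ) : (Fin n → ℂ) → ℂ :=
  fun z => pser a (z - p) (star (z - p))

/-- The map `z ↦ (z - p, (z - p)̄)` has derivative `v ↦ (v, v̄)`. -/
theorem hasFDerivAt_diag (p z : Fin n → ℂ) :
    HasFDerivAt (fun z : Fin n → ℂ => (z - p, star (z - p)))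
      ((ContinuousLinearMap.id ℝ (Fin n → ℂ)).prod
        ((starL' ℝ : (Fin n → ℂ) ≃L[ℝ] (Fin n → ℂ)) : (Fin n → ℂ) →L[ℝ] (Fin n → ℂ))) z := by
  have h1 : HasFDerivAt (fun z : Fin n → ℂ => z - p) (ContinuousLinearMap.id ℝ (Fin n → ℂ)) z :=
    (hasFDerivAt_id z).sub_const p
  have h2 := ((starL' ℝ : (Fin n → ℂ) ≃L[ℝ] (Fin n → ℂ)) :
    (Fin n → ℂ) →L[ℝ] (Fin n → ℂ)).hasFDerivAt (x := z - p)
  have h3 := HasFDerivAt.comp z h2 h1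
  rw [ContinuousLinearMap.comp_id] at h3
  exact h1.prodMk h3

theorem analyticOnNhd_diag (p : Fin n → ℂ) {G : (Fin n → ℂ) × (Fin n → ℂ) → ℂ}
    (hG : AnalyticOnNhd ℂ G Set.univ) :
    AnalyticOnNhd ℝ (fun z : Fin n → ℂ => G (z - p, star (z - p))) Set.univ := fun z _ => by
  have h1 : AnalyticAt ℝ (fun z : Fin n → ℂ => z - p) z := analyticAt_id.sub analyticAt_const
  have h2 : AnalyticAt ℝ (fun z : Fin n → ℂ => star (z - p)) z :=
    ((starL' ℝ : (Fin n → ℂ) ≃L[ℝ] (Fin n → ℂ)) :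
      (Fin n → ℂ) →L[ℝ] (Fin n → ℂ)).analyticAt _ |>.comp h1
  exact ((hG _ (Set.mem_univ _)).restrictScalars (𝕜 := ℝ)).comp (h1.prod h2)

theorem fderiv_diag (p : Fin n → ℂ) {G : (Fin n → ℂ) × (Fin n → ℂ) → ℂ}
    (hG : Differentiable ℂ G) (z v : Fin n → ℂ) :
    fderiv ℝ (fun z : Fin n → ℂ => G (z - p, star (z - p))) z v =
      fderiv ℂ G (z - p, star (z - p)) (v, star v) := by
  have h := ((hG (z - p, star (z - p))).hasFDerivAt.restrictScalars ℝ).comp z (hasFDerivAt_diag p z)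
  have h' := h.fderiv
  have e : (G ∘ fun z : Fin n → ℂ => (z - p, star (z - p))) =
    fun z : Fin n → ℂ => G (z - p, star (z - p)) := rfl
  rw [e] at h'
  rw [h']
  rfl

/-- Along `v` the real derivative is the complex differential at `(v, v̄)`. In the combinations of
`v = e_i` and `v = √-1 e_i` that define the Wirtinger derivatives, one of the two components
cancels. -/
theorem wirt_diag (p : Fin n → ℂ) {G : (Fin n → ℂ) × (Fin n → ℂ) → ℂ}
    (hG : Differentiable ℂ G) (i : Fin n) (z : Fin n → ℂ) :
    dz i (fun z : Fin n → ℂ => G (z - p, star (z - p))) z =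
        fderiv ℂ G (z - p, star (z - p)) (Pi.single i 1, 0) ∧
      dzbar i (fun z : Fin n → ℂ => G (z - p, star (z - p))) z =
        fderiv ℂ G (z - p, star (z - p)) (0, Pi.single i 1) := by
  set L := fderiv ℂ G (z - p, star (z - p))
  have h1 : L (Pi.single i 1, star (Pi.single i 1)) = L (Pi.single i 1, 0) +
      L (0, Pi.single i 1) := by
    rw [← map_add]
    congr 1
    ext j
    · simp
    · by_cases h : j = i
      · subst h; simp
      · simp [Pi.single_eq_of_ne h]
  have h2 : L (Pi.single i Complex.I, star (Pi.single i Complex.I)) =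
      Complex.I * L (Pi.single i 1, 0) - Complex.I * L (0, Pi.single i 1) := by
    rw [← smul_eq_mul, ← smul_eq_mul, ← map_smul, ← map_smul, ← map_sub]
    congr 1
    ext j
    · by_cases h : j = i
      · subst h; simp
      · simp [Pi.single_eq_of_ne h]
    · by_cases h : j = i
      · subst h; simp
      · simp [Pi.single_eq_of_ne h]
  simp only [dz, dzbar, fderiv_diag p hG]
  rw [h1, h2]
  constructor
  · linear_combination (-(1 / 2) * (L (Pi.single i 1, 0) - L (0, Pi.single i 1))) * Complex.I_sq
  · linear_combination ((1 / 2) * (L (Pi.single i 1, 0) - L (0, Pi.single i 1))) * Complex.I_sq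

variable {a : MultiIndex n → MultiIndex n → ℂ}

theorem Tame.differentiable_pser (ha : Tame a) :
    Differentiable ℂ (fun q : (Fin n → ℂ) × (Fin n → ℂ) => pser a q.1 q.2) := fun q =>
  (ha.analyticOnNhd_pser q (Set.mem_univ _)).differentiableAt

theorem analyticOnNhd_ofJet (ha : Tame a) (p : Fin n → ℂ) :
    AnalyticOnNhd ℝ (ofJet p a) Set.univ := analyticOnNhd_diag p ha.analyticOnNhd_pser

theorem dz_ofJet (ha : Tame a) (p : Fin n → ℂ) (i : Fin n) :
    dz i (ofJet p a) = ofJet p (shift (unitIdx i) 0 a) := by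
  ext z
  refine (wirt_diag p ha.differentiable_pser i z).1.trans ?_
  have h := hasDerivAt_line ha.differentiable_pser (z - p) (star (z - p)) (Pi.single i 1) 0
  simp only [smul_zero, add_zero] at h
  exact h.unique (hasDerivAt_pser_left ha (z - p) (star (z - p)) i)

theorem dzbar_ofJet (ha : Tame a) (p : Fin n → ℂ) (i : Fin n) :
    dzbar i (ofJet p a) = ofJet p (shift 0 (unitIdx i) a) := by
  ext z
  refine (wirt_diag p ha.differentiable_pser i z).2.trans ?_
  have h := hasDerivAt_line ha.differentiable_pser (z - p) (star (z - p)) 0 (Pi.single i 1)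
  simp only [smul_zero, add_zero] at h
  exact h.unique (hasDerivAt_pser_right ha (z - p) (star (z - p)) i)

theorem sum_finRange_single (R : MultiIndex n) :
    ((List.finRange n).map fun i => R i • unitIdx i).sum = R := by
  rw [← Fin.sum_univ_def]
  ext j
  simp [unitIdx, Finset.sum_apply, Pi.single_apply]

theorem dzPow_ofJet (ha : Tame a) (p : Fin n → ℂ) (R : MultiIndex n) :
    dzPow R (ofJet p a) = ofJet p (shift R 0 a) := by
  have iter : ∀ i k (a : MultiIndex n → MultiIndex n → ℂ), Tame a →
      (dz i)^[k] (ofJet p a) = ofJet p (shift (k • unitIdx i) 0 a) := by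
    intro i k
    induction k with
    | zero => intro a _; simp
    | succ k ih =>
      intro a ha
      rw [Function.iterate_succ_apply, dz_ofJet ha, ih _ (ha.shift _ _), shift_shift, succ_nsmul,
        add_zero]
  have key : ∀ L : List (Fin n), L.foldr (fun i g => (dz i)^[R i] g) (ofJet p a) =
      ofJet p (shift (L.map fun i => R i • unitIdx i).sum 0 a) := by
    intro L
    induction L with
    | nil => simp
    | cons i L ih =>
      rw [List.foldr_cons, ih, iter _ _ _ (ha.shift _ _), shift_shift, List.map_cons,
        List.sum_cons, add_zero]
  rw [dzPow, key, sum_finRange_single]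

theorem dzbarPow_ofJet (ha : Tame a) (p : Fin n → ℂ) (S : MultiIndex n) :
    dzbarPow S (ofJet p a) = ofJet p (shift 0 S a) := by
  have iter : ∀ i k (a : MultiIndex n → MultiIndex n → ℂ), Tame a →
      (dzbar i)^[k] (ofJet p a) = ofJet p (shift 0 (k • unitIdx i) a) := by
    intro i k
    induction k with
    | zero => intro a _; simp
    | succ k ih =>
      intro a ha
      rw [Function.iterate_succ_apply, dzbar_ofJet ha, ih _ (ha.shift _ _), shift_shift, succ_nsmul,
        add_zero]
  have key : ∀ L : List (Fin n), L.foldr (fun i g => (dzbar i)^[S i] g) (ofJet p a) =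
      ofJet p (shift 0 (L.map fun i => S i • unitIdx i).sum a) := by
    intro L
    induction L with
    | nil => simp
    | cons i L ih =>
      rw [List.foldr_cons, ih, iter _ _ _ (ha.shift _ _), shift_shift, List.map_cons,
        List.sum_cons, add_zero]
  rw [dzbarPow, key, sum_finRange_single]

theorem dMixed_ofJet (ha : Tame a) (p : Fin n → ℂ) (R S : MultiIndex n) :
    dMixed R S (ofJet p a) = ofJet p (shift R S a) := by
  rw [dMixed, dzbarPow_ofJet ha, dzPow_ofJet (ha.shift _ _), shift_shift, add_zero, zero_add]

theorem jet_ofJet_apply (ha : Tame a) (p z : Fin n → ℂ) (R S : MultiIndex n) :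
    jet (ofJet p a) z R S = pser (shift R S a) (z - p) (star (z - p)) := by
  rw [jet, dMixed_ofJet ha]; rfl

theorem jet_ofJet (ha : Tame a) (p : Fin n → ℂ) : jet (ofJet p a) p = a := by
  ext R S
  rw [jet_ofJet_apply ha, sub_self, star_zero, pser_zero]
  simp [shift]

end PowerSeriesDeriv

/-! ### Products and re-expansions of power series -/

section Cauchy

/-- Summation along the pairs with a given sum. -/
theorem hasSum_fiber {A E : Type*} [Add A] [Sub A] (lo : A → Finset A)
    (h1 : ∀ P Q : A, P ∈ lo (P + Q)) (h2 : ∀ P Q : A, P + Q - P = Q)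
    (h3 : ∀ P T : A, P ∈ lo T → P + (T - P) = T) [NormedAddCommGroup E] {F : A × A → E} {s : E}
    (hF : HasSum F s) : HasSum (fun T => ∑ P ∈ lo T, F (P, T - P)) s := by
  -- Pairs `(P, Q)` correspond to a sum `T = P + Q` with a choice of `P ∈ lo T`; the family is then
  -- summed over the fibres.
  let e : (Σ T : A, lo T) ≃ A × A :=
    { toFun := fun x => (x.2.1, x.1 - x.2.1)
      invFun := fun x => ⟨x.1 + x.2, x.1, h1 _ _⟩
      left_inv := by
        rintro ⟨T, P, hP⟩
        have key : ∀ T', T' = T → ∀ h : P ∈ lo T', (⟨T', P, h⟩ : Σ T : A, lo T) = ⟨T, P, hP⟩ := by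
          rintro _ rfl _; rfl
        exact key _ (h3 P T hP) _
      right_inv := by
        rintro ⟨P, Q⟩
        simp [h2] }
  have h4 := (e.hasSum_iff.2 hF).sigma fun T => hasSum_fintype _
  refine (congrArg (fun φ => HasSum φ s) (funext fun T => ?_)).mp h4
  exact Finset.sum_coe_sort (lo T) fun P => F (P, T - P)

theorem hasSum_Iic {E : Type*} [NormedAddCommGroup E]
    {F : MultiIndex n × MultiIndex n → E} {s : E} (hF : HasSum F s) :
    HasSum (fun T => ∑ P ∈ Finset.Iic T, F (P, T - P)) s :=
  hasSum_fiber _ (fun _ _ => Finset.mem_Iic.2 le_self_add) (fun _ _ => add_tsub_cancel_left _ _)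
    (fun _ _ h => add_tsub_cancel_of_le (Finset.mem_Iic.1 h)) hF

theorem hasSum_Iic_prod {E : Type*} [NormedAddCommGroup E]
    {F : (MultiIndex n × MultiIndex n) × (MultiIndex n × MultiIndex n) → E} {s : E}
    (hF : HasSum F s) :
    HasSum (fun T => ∑ P ∈ Finset.Iic T.1 ×ˢ Finset.Iic T.2, F (P, T - P)) s := by
  refine hasSum_fiber (fun T : MultiIndex n × MultiIndex n => Finset.Iic T.1 ×ˢ Finset.Iic T.2)
    (fun _ _ => ?_) (fun _ _ => ?_) (fun _ _ h => ?_) hF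
  · exact Finset.mem_product.2 ⟨Finset.mem_Iic.2 le_self_add, Finset.mem_Iic.2 le_self_add⟩
  · exact Prod.ext (add_tsub_cancel_left _ _) (add_tsub_cancel_left _ _)
  · have := Finset.mem_product.1 h
    exact Prod.ext (add_tsub_cancel_of_le (Finset.mem_Iic.1 this.1))
      (add_tsub_cancel_of_le (Finset.mem_Iic.1 this.2))

/-- The Leibniz rule for arrays of derivatives. -/
def conv (a b : MultiIndex n → MultiIndex n → ℂ) (R S : MultiIndex n) : ℂ :=
  ∑ I ∈ Finset.Iic R, ∑ J ∈ Finset.Iic S,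
    (binom R I : ℂ) * (binom S J : ℂ) * (a I J * b (R - I) (S - J))

theorem binom_div_fact {R I : MultiIndex n} (h : I ≤ R) :
    (binom R I : ℂ) / fact R = 1 / (fact I * fact (R - I)) := by
  rw [← binom_mul_fact h]
  have h1 : (binom R I : ℂ) ≠ 0 := by
    have := fact_pos R
    rw [← binom_mul_fact h] at this
    exact_mod_cast (Nat.pos_of_mul_pos_right this).ne'
  have h2 : (fact I : ℂ) ≠ 0 := fact_ne_zero' I
  have h3 : (fact (R - I) : ℂ) ≠ 0 := fact_ne_zero' _
  push_cast
  field_simp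

/-- Division by the factorials turns the Leibniz rule into the Cauchy product of Taylor
coefficients. -/
theorem coef_conv (a b : MultiIndex n → MultiIndex n → ℂ) (T : MultiIndex n × MultiIndex n) :
    coef (conv a b) T =
      ∑ P ∈ Finset.Iic T.1 ×ˢ Finset.Iic T.2, coef a P * coef b (T - P) := by
  rw [Finset.sum_product, coef, conv, Finset.sum_div]
  refine Finset.sum_congr rfl fun I hI => ?_
  rw [Finset.sum_div]
  refine Finset.sum_congr rfl fun J hJ => ?_
  rw [mul_div_right_comm, mul_div_mul_comm, binom_div_fact (Finset.mem_Iic.1 hI),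
    binom_div_fact (Finset.mem_Iic.1 hJ)]
  simp only [coef, Prod.fst_sub, Prod.snd_sub]
  ring

/-- The weights satisfy `wt d I * wt d (R - I) ≤ wt d R`, so only the sum of the binomial
coefficients, `2^(|R|+|S|)`, has to be absorbed. This accounts for the second `d`. -/
theorem exists_bd_conv {d : ℝ} (hd : 0 < d) : ∃ C : ℝ≥0,
    ∀ (a b : MultiIndex n → MultiIndex n → ℂ) (B B' : ℝ≥0), Bd d B a → Bd d B' b →
      Bd (2 * d) (C * (B * B')) (conv a b) := by
  obtain ⟨C, hC⟩ := exists_pow_deg_le (n := n) 2 hd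
  refine ⟨C ^ 2, fun a b B B' ha hb R S => ?_⟩
  calc ‖conv a b R S‖₊ ≤ ∑ I ∈ Finset.Iic R, ∑ J ∈ Finset.Iic S, (binom R I : ℝ≥0) *
        (binom S J : ℝ≥0) * (B * B' * (wt d R * wt d S)) := by
        refine (nnnorm_sum_le _ _).trans (Finset.sum_le_sum fun I hI => ?_)
        refine (nnnorm_sum_le _ _).trans (Finset.sum_le_sum fun J hJ => ?_)
        rw [Finset.mem_Iic] at hI hJ
        rw [nnnorm_mul, nnnorm_mul, nnnorm_mul, Complex.nnnorm_natCast, Complex.nnnorm_natCast]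
        refine mul_le_mul_right ?_ _
        calc _ ≤ B * (wt d I * wt d J) * (B' * (wt d (R - I) * wt d (S - J))) :=
              mul_le_mul' (ha I J) (hb _ _)
          _ = B * B' * ((wt d I * wt d (R - I)) * (wt d J * wt d (S - J))) := by ring
          _ ≤ _ := by gcongr <;> exact wt_mul_le hd.le ‹_›
    _ = 2 ^ deg R * 2 ^ deg S * (B * B' * (wt d R * wt d S)) := by
        have h : ∀ R : MultiIndex n, (2 : ℝ≥0) ^ deg R = ∑ I ∈ Finset.Iic R, (binom R I : ℝ≥0) :=
          fun R => by exact_mod_cast (sum_binom R).symm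
        rw [h, h, Finset.sum_mul_sum, Finset.sum_mul]
        exact Finset.sum_congr rfl fun I _ => by rw [Finset.sum_mul]
    _ ≤ C * wt d R * (C * wt d S) * (B * B' * (wt d R * wt d S)) := by gcongr <;> exact hC _
    _ = _ := by rw [two_mul, wt_add_exp, wt_add_exp]; ring

variable {a b : MultiIndex n → MultiIndex n → ℂ}

theorem Tame.conv (ha : Tame a) (hb : Tame b) : Tame (conv a b) := fun d hd => by
  obtain ⟨C, hC⟩ := exists_bd_conv (n := n) (half_pos hd)
  obtain ⟨B, hB⟩ := ha _ (half_pos hd)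
  obtain ⟨B', hB'⟩ := hb _ (half_pos hd)
  have := hC a b B B' hB hB'
  rw [mul_div_cancel₀ d two_ne_zero] at this
  exact ⟨_, this⟩

theorem Tame.summable_norm_pterm (ha : Tame a) (u v : Fin n → ℂ) :
    Summable fun P => ‖pterm a u v P‖ :=
  let ⟨_, hB⟩ := ha.exists_bd
  WickStar.summable_norm_pterm hB (by norm_num) u v

theorem pser_conv (ha : Tame a) (hb : Tame b) (u v : Fin n → ℂ) :
    pser (conv a b) u v = pser a u v * pser b u v := by
  have h1 := summable_mul_of_summable_norm (ha.summable_norm_pterm u v)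
    (hb.summable_norm_pterm u v)
  have h2 := hasSum_Iic_prod ((ha.hasSum_pser u v).mul (hb.hasSum_pser u v) h1)
  refine HasSum.unique ?_ h2
  refine (congrArg (fun φ => HasSum φ _) (funext fun T => ?_)).mp
    ((ha.conv hb).hasSum_pser u v)
  rw [pterm, coef_conv, Finset.sum_mul]
  refine Finset.sum_congr rfl fun P hP => ?_
  rw [Finset.mem_product, Finset.mem_Iic, Finset.mem_Iic] at hP
  have e1 : mon T.1 u = mon P.1 u * mon (T.1 - P.1) u := by
    rw [← mon_add, add_tsub_cancel_of_le hP.1]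
  have e2 : mon T.2 v = mon P.2 v * mon (T.2 - P.2) v := by
    rw [← mon_add, add_tsub_cancel_of_le hP.2]
  rw [e1, e2]
  simp only [pterm, Prod.fst_sub, Prod.snd_sub]
  ring

theorem mon_add_div_fact (R : MultiIndex n) (u v : Fin n → ℂ) :
    mon R (u + v) / fact R =
      ∑ I ∈ Finset.Iic R, mon I u / fact I * (mon (R - I) v / fact (R - I)) := by
  have h : Finset.Iic R = Fintype.piFinset fun i => Finset.Iic (R i) := by
    ext I; simp [Pi.le_def]
  have h1 : ∀ (R : MultiIndex n) (u : Fin n → ℂ),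
      mon R u / fact R = ∏ i, u i ^ R i / (R i).factorial := fun R u => by
    simp [mon, fact, Finset.prod_div_distrib]
  simp only [h1, ← Finset.prod_mul_distrib, Pi.sub_apply]
  rw [h, ← Finset.prod_univ_sum (fun i => Finset.Iic (R i)) (fun i j => u i ^ j / j.factorial *
    (v i ^ (R i - j) / (R i - j).factorial))]
  refine Finset.prod_congr rfl fun i _ => ?_
  have h2 : Finset.Iic (R i) = Finset.range (R i + 1) := by ext j; simp
  rw [Pi.add_apply, add_pow, Finset.sum_div, h2]
  refine Finset.sum_congr rfl fun j hj => ?_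
  have hj' : j ≤ R i := Nat.lt_succ_iff.1 (Finset.mem_range.1 hj)
  rw [← Nat.choose_mul_factorial_mul_factorial hj']
  have e1 : ((R i).choose j : ℂ) ≠ 0 := by exact_mod_cast (Nat.choose_pos hj').ne'
  have e2 : (j.factorial : ℂ) ≠ 0 := by exact_mod_cast Nat.factorial_ne_zero _
  have e3 : ((R i - j).factorial : ℂ) ≠ 0 := by exact_mod_cast Nat.factorial_ne_zero _
  push_cast
  field_simp

/-- The summand of the re-expansion of a power series about a translated point. -/
def tterm (a : MultiIndex n → MultiIndex n → ℂ) (u v x y : Fin n → ℂ)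
    (q : (MultiIndex n × MultiIndex n) × (MultiIndex n × MultiIndex n)) : ℂ :=
  (mon q.1.1 u * mon q.1.2 v) / (fact q.1.1 * fact q.1.2) * pterm (shift q.1.1 q.1.2 a) x y q.2

/-- Shifting by `(I, J)` costs a power of `I! J!` with exponent `1 / 2`, twice the initial `1 / 4`,
against the denominator `I! J!`. The double series is thus dominated by a product of two majorants.
-/
theorem summable_tterm (ha : Tame a) (u v x y : Fin n → ℂ) : Summable (tterm a u v x y) := by
  obtain ⟨C, hC⟩ := exists_bd_shift (n := n) (d := 1 / 4) (by norm_num)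
  obtain ⟨B, hB⟩ := ha (1 / 4) (by norm_num)
  have hm := fun r s => summable_majorant_mul (n := n) (d := 2 * (1 / 4)) (by norm_num) r s
  have h1 := ((NNReal.summable_coe.2 (hm ‖u‖₊ ‖v‖₊)).mul_of_nonneg
    (NNReal.summable_coe.2 (hm ‖x‖₊ ‖y‖₊)) (fun _ => NNReal.coe_nonneg _)
    (fun _ => NNReal.coe_nonneg _)).mul_left ((C * B : ℝ≥0) : ℝ)
  refine Summable.of_norm_bounded h1 fun q => ?_
  rw [← NNReal.coe_mul, ← NNReal.coe_mul, ← coe_nnnorm, NNReal.coe_le_coe]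
  have h2 := (nnnorm_pterm_le (shift q.1.1 q.1.2 a) (le_refl ‖x‖₊) (le_refl ‖y‖₊) q.2).trans
    (nnnorm_coef_le (hC a B q.1.1 q.1.2 hB) _ _ q.2)
  rw [tterm, nnnorm_mul, nnnorm_div, nnnorm_mul, nnnorm_mul, Complex.nnnorm_natCast,
    Complex.nnnorm_natCast]
  calc _ ≤ (‖u‖₊ ^ deg q.1.1 * ‖v‖₊ ^ deg q.1.2) / (fact q.1.1 * fact q.1.2) *
        (C * B * (wt (2 * (1 / 4)) q.1.1 * wt (2 * (1 / 4)) q.1.2) *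
          (majorant (2 * (1 / 4)) ‖x‖₊ q.2.1 * majorant (2 * (1 / 4)) ‖y‖₊ q.2.2)) := by
        gcongr
        · exact nnnorm_mon_le le_rfl
        · exact nnnorm_mon_le le_rfl
    _ = _ := by
        simp only [majorant, div_eq_mul_inv, mul_inv]
        ring

/-- With `P + Q = T` the shifted array gives the same derivative `a T` throughout, and the rest is
the binomial theorem. -/
theorem sum_tterm (a : MultiIndex n → MultiIndex n → ℂ) (u v x y : Fin n → ℂ)
    (T : MultiIndex n × MultiIndex n) :
    ∑ P ∈ Finset.Iic T.1 ×ˢ Finset.Iic T.2, tterm a u v x y (P, T - P) =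
      pterm a (u + x) (v + y) T := by
  obtain ⟨R, S⟩ := T
  have e : pterm a (u + x) (v + y) (R, S) = a R S * ((mon R (u + x) / fact R) *
      (mon S (v + y) / fact S)) := by
    simp only [pterm, coef]; ring
  rw [e, mon_add_div_fact, mon_add_div_fact, Finset.sum_product, Finset.sum_mul_sum,
    Finset.mul_sum]
  refine Finset.sum_congr rfl fun I hI => ?_
  rw [Finset.mul_sum]
  refine Finset.sum_congr rfl fun J hJ => ?_
  rw [Finset.mem_Iic] at hI hJ
  simp only [tterm, pterm, coef, shift, Prod.mk_sub_mk, tsub_add_cancel_of_le hI,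
    tsub_add_cancel_of_le hJ]
  ring

/-- Taylor expansion about a translated point. -/
theorem pser_translate (ha : Tame a) (u v x y : Fin n → ℂ) :
    pser (fun R S => pser (shift R S a) x y) u v = pser a (u + x) (v + y) := by
  have hF := (summable_tterm ha u v x y).hasSum
  -- The double family summed first over the inner expansion; below it is summed along the indices
  -- with a given sum.
  have h1 : HasSum (pterm (fun R S => pser (shift R S a) x y) u v) (∑' q, tterm a u v x y q) := by
    refine hF.prod_fiberwise fun P => ?_
    have h := ((ha.shift P.1 P.2).hasSum_pser x y).mul_left
      ((mon P.1 u * mon P.2 v) / (fact P.1 * fact P.2))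
    have e : pterm (fun R S => pser (shift R S a) x y) u v P =
      (mon P.1 u * mon P.2 v) / (fact P.1 * fact P.2) * pser (shift P.1 P.2 a) x y := by
      rw [pterm, coef]; ring
    rw [e]
    exact h
  have h2 := hasSum_Iic_prod hF
  simp only [sum_tterm] at h2
  exact h1.tsum_eq.trans h2.tsum_eq.symm

end Cauchy

/-! ### Real-analytic functions with slowly growing jets -/

section TameFunctions

/-- The real-analytic functions all of whose jets grow slowly. -/
structure TameFun (f : (Fin n → ℂ) → ℂ) : Prop where
  analytic : AnalyticOnNhd ℝ f Set.univ
  tame : ∀ z, Tame (jet f z)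

theorem jet_sub {f g : (Fin n → ℂ) → ℂ} (hf : ContDiff ℝ ∞ f) (hg : ContDiff ℝ ∞ g)
    (z : Fin n → ℂ) (R S : MultiIndex n) : jet (f - g) z R S = jet f z R S - jet g z R S := by
  have h : f - g = f + (-1 : ℂ) • g := by rw [neg_one_smul, sub_eq_add_neg]
  have hg' : ContDiff ℝ ∞ ((-1 : ℂ) • g) := contDiff_const.smul hg
  rw [h, jet, dMixed_add R S hf hg', dMixed_smul R S _ hg]
  simp [jet, sub_eq_add_neg]

theorem eq_of_jet_eq {f g : (Fin n → ℂ) → ℂ} (hf : AnalyticOnNhd ℝ f Set.univ)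
    (hg : AnalyticOnNhd ℝ g Set.univ) {p : Fin n → ℂ} (h : jet f p = jet g p) : f = g := by
  rw [← sub_eq_zero]
  refine eq_zero_of_jet_eq_zero (hf.sub hg) p fun R S => ?_
  have := jet_sub hf.contDiff hg.contDiff p R S
  rw [h, sub_self] at this
  exact this

theorem eq_ofJet_of_tame {f : (Fin n → ℂ) → ℂ} (hf : AnalyticOnNhd ℝ f Set.univ)
    {p : Fin n → ℂ} (h : Tame (jet f p)) : f = ofJet p (jet f p) :=
  eq_of_jet_eq hf (analyticOnNhd_ofJet h p) (jet_ofJet h p).symm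

theorem jet_ofJet_at {a : MultiIndex n → MultiIndex n → ℂ} (ha : Tame a) (p z : Fin n → ℂ) :
    jet (ofJet p a) z = fun R S => pser (shift R S a) (z - p) (star (z - p)) := by
  ext R S; exact jet_ofJet_apply ha p z R S

theorem tameFun_ofJet {a : MultiIndex n → MultiIndex n → ℂ} (ha : Tame a) (p : Fin n → ℂ) :
    TameFun (ofJet p a) :=
  ⟨analyticOnNhd_ofJet ha p, fun z => by rw [jet_ofJet_at ha]; exact ha.pser_shift _ _⟩

/-- Tameness at one point spreads to all points because the function is then given globally by its
Taylor series. -/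
theorem TameFun.of_tame {f : (Fin n → ℂ) → ℂ} (hf : AnalyticOnNhd ℝ f Set.univ)
    {p : Fin n → ℂ} (h : Tame (jet f p)) : TameFun f := by
  rw [eq_ofJet_of_tame hf h]
  exact tameFun_ofJet h p

theorem TameFun.contDiff {f : (Fin n → ℂ) → ℂ} (hf : TameFun f) : ContDiff ℝ ∞ f :=
  hf.analytic.contDiff

theorem TameFun.eq_ofJet {f : (Fin n → ℂ) → ℂ} (hf : TameFun f) (p : Fin n → ℂ) :
    f = ofJet p (jet f p) := eq_ofJet_of_tame hf.analytic (hf.tame p)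

theorem jet_zero_zero (f : (Fin n → ℂ) → ℂ) (z : Fin n → ℂ) : jet f z 0 0 = f z := by
  simp [jet, dMixed]

/-! #### Finiteness of the seminorms -/

theorem tame_jet_of_mem {p : Fin n → ℂ} {hbar : ℝ} (hpos : 0 < hbar) {f : (Fin n → ℂ) → ℂ}
    (hf : f ∈ preAlgebra n p hbar) : Tame (jet f p) := fun e he => by
  obtain ⟨m, C, h⟩ := exists_bd_jet p hbar hpos he
  have hfin := hf.2 (m + 1) 1 0 0 (Nat.one_lt_two_pow (by omega))
  exact ⟨_, h f _ (ENNReal.coe_toNNReal hfin.ne).symm⟩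

/-- Together with `tame_jet_of_mem`, this replaces finiteness of all seminorms by tameness of the
jet at `p`. -/
theorem mem_preAlgebra {p : Fin n → ℂ} (hbar : ℝ) {f : (Fin n → ℂ) → ℂ} (hf : ContDiff ℝ ∞ f)
    (h : Tame (jet f p)) : f ∈ preAlgebra n p hbar := by
  refine ⟨hf, fun m l R S _ => ?_⟩
  obtain ⟨d, hd, C, hC⟩ := exists_eSeminorm_le p hbar m l R S
  obtain ⟨B, hB⟩ := h d hd
  exact (hC f B hB).trans_lt ENNReal.coe_lt_top

/-! #### Holomorphic extension -/

/-- The difference is holomorphic on `ℂⁿ × ℂⁿ` and vanishes on the totally real diagonal `(z, z̄)`.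
Through `(u, v̄)` passes the complex line `t ↦ (a + t b, ā + t b̄)`, which lies in the diagonal for
real `t` and reaches the given point at `t = √-1`. -/
theorem isHatExtension_unique {f : (Fin n → ℂ) → ℂ} {F G : (Fin n → ℂ) → (Fin n → ℂ) → ℂ}
    (hF : IsHatExtension f F) (hG : IsHatExtension f G) : F = G := by
  let H : (Fin n → ℂ) × (Fin n → ℂ) → ℂ := fun q => F q.1 (star q.2) - G q.1 (star q.2)
  have hH : Differentiable ℂ H := hF.1.sub hG.1
  have h0 : ∀ z, H (z, star z) = 0 := fun z => by
    simp only [H, star_star, hF.2, hG.2, sub_self]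
  ext u v
  let a : Fin n → ℂ := (1 / 2 : ℂ) • (u + v)
  let b : Fin n → ℂ := (1 / (2 * Complex.I)) • (u - v)
  let g : ℂ → ℂ := fun t => H (a + t • b, star a + t • star b)
  have hg : AnalyticOnNhd ℂ g Set.univ := fun t _ =>
    (differentiable_line hH a (star a) b (star b)).analyticAt t
  have hreal : ∀ t : ℝ, g t = 0 := fun t => by
    have : star a + (t : ℂ) • star b = star (a + (t : ℂ) • b) := by
      rw [star_add, star_smul]; simp
    simp only [g, this, h0]
  have hfreq : ∃ᶠ t : ℂ in nhdsWithin 0 {0}ᶜ, g t = (fun _ => 0) t := by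
    have ht : Filter.Tendsto (fun t : ℝ => (t : ℂ)) (nhdsWithin 0 {0}ᶜ) (nhdsWithin 0 {0}ᶜ) := by
      refine tendsto_nhdsWithin_iff.2 ⟨?_, ?_⟩
      · exact (Complex.continuous_ofReal.tendsto' 0 0 (by simp)).mono_left nhdsWithin_le_nhds
      · filter_upwards [self_mem_nhdsWithin] with t ht
        simpa using ht
    exact ht.frequently (Filter.Frequently.of_forall hreal)
  have h1 := congrFun (hg.eq_of_frequently_eq analyticOnNhd_const hfreq) Complex.I
  have e1 : a + Complex.I • b = u := by
    ext i
    simp only [a, b, Pi.add_apply, Pi.smul_apply, smul_eq_mul, Pi.sub_apply]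
    field_simp
    ring
  have e2 : star a + Complex.I • star b = star v := by
    have : a - Complex.I • b = v := by
      ext i
      simp only [a, b, Pi.add_apply, Pi.smul_apply, smul_eq_mul, Pi.sub_apply]
      field_simp
      ring
    have hb : star (Complex.I • b) = -(Complex.I • star b) := by
      rw [star_smul, Complex.star_def, Complex.conj_I, neg_smul]
    calc star a + Complex.I • star b = star (a - Complex.I • b) := by
          rw [star_sub, hb, sub_neg_eq_add]
      _ = star v := by rw [this]
  simp only [g, e1, e2, H, star_star] at h1
  exact sub_eq_zero.1 h1

theorem hat_eq {f : (Fin n → ℂ) → ℂ} {F : (Fin n → ℂ) → (Fin n → ℂ) → ℂ}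
    (hF : IsHatExtension f F) : hat f = F :=
  isHatExtension_unique (Classical.epsilon_spec (p := IsHatExtension f) ⟨F, hF⟩) hF

theorem TameFun.isHatExtension {f : (Fin n → ℂ) → ℂ} (hf : TameFun f) (p : Fin n → ℂ) :
    IsHatExtension f fun u v => pser (jet f p) (u - p) (star (v - p)) := by
  refine ⟨?_, fun z => (congrFun (hf.eq_ofJet p) z).symm⟩
  have h : Differentiable ℂ fun q : (Fin n → ℂ) × (Fin n → ℂ) => (q.1 - p, q.2 - star p) :=
    (differentiable_fst.sub_const p).prodMk (differentiable_snd.sub_const _)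
  have h1 := (hf.tame p).differentiable_pser.comp h
  have e : (fun q : (Fin n → ℂ) × (Fin n → ℂ) => pser (jet f p) (q.1 - p) (star (star q.2 - p))) =
      fun q => pser (jet f p) (q.1 - p) (q.2 - star p) := by
    ext q; rw [star_sub, star_star]
  rw [e]
  exact h1

/-- The base point is free. With `p = u` or `p = v` one argument of the series becomes zero, which
is how products with exponentials are recognized. -/
theorem TameFun.hat_apply {f : (Fin n → ℂ) → ℂ} (hf : TameFun f) (p u v : Fin n → ℂ) :
    hat f u v = pser (jet f p) (u - p) (star (v - p)) := by
  rw [hat_eq (hf.isHatExtension p)]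

theorem TameFun.isHatExtension_hat {f : (Fin n → ℂ) → ℂ} (hf : TameFun f) :
    IsHatExtension f (hat f) := by
  rw [hat_eq (hf.isHatExtension 0)]
  exact hf.isHatExtension 0

/-! #### Operations on tame functions -/

theorem ofJet_conv {a b : MultiIndex n → MultiIndex n → ℂ} (ha : Tame a) (hb : Tame b)
    (p : Fin n → ℂ) : ofJet p (conv a b) = ofJet p a * ofJet p b := by
  ext z; exact pser_conv ha hb _ _

theorem TameFun.mul_eq {f g : (Fin n → ℂ) → ℂ} (hf : TameFun f) (hg : TameFun g)
    (p : Fin n → ℂ) : f * g = ofJet p (conv (jet f p) (jet g p)) := by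
  rw [ofJet_conv (hf.tame p) (hg.tame p), ← hf.eq_ofJet, ← hg.eq_ofJet]

theorem TameFun.mul {f g : (Fin n → ℂ) → ℂ} (hf : TameFun f) (hg : TameFun g) :
    TameFun (f * g) := by
  rw [hf.mul_eq hg 0]
  exact tameFun_ofJet ((hf.tame 0).conv (hg.tame 0)) 0

theorem TameFun.jet_mul {f g : (Fin n → ℂ) → ℂ} (hf : TameFun f) (hg : TameFun g)
    (p : Fin n → ℂ) : jet (f * g) p = conv (jet f p) (jet g p) := by
  rw [hf.mul_eq hg p, jet_ofJet ((hf.tame p).conv (hg.tame p))]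

theorem TameFun.dMixed_eq {f : (Fin n → ℂ) → ℂ} (hf : TameFun f) (R S : MultiIndex n)
    (p : Fin n → ℂ) : dMixed R S f = ofJet p (shift R S (jet f p)) := by
  conv_lhs => rw [hf.eq_ofJet p]
  exact dMixed_ofJet (hf.tame p) p R S

theorem TameFun.dMixed {f : (Fin n → ℂ) → ℂ} (hf : TameFun f) (R S : MultiIndex n) :
    TameFun (dMixed R S f) := by
  rw [hf.dMixed_eq R S 0]
  exact tameFun_ofJet ((hf.tame 0).shift R S) 0

theorem TameFun.jet_dMixed {f : (Fin n → ℂ) → ℂ} (hf : TameFun f) (R S : MultiIndex n)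
    (p : Fin n → ℂ) : jet (WickStar.dMixed R S f) p = shift R S (jet f p) := by
  rw [hf.dMixed_eq R S p, jet_ofJet ((hf.tame p).shift R S)]

/-- The array of derivatives of the complex conjugate. -/
def starArr (a : MultiIndex n → MultiIndex n → ℂ) : MultiIndex n → MultiIndex n → ℂ :=
  fun R S => star (a S R)

theorem Bd.starArr {a : MultiIndex n → MultiIndex n → ℂ} {d : ℝ} {B : ℝ≥0} (ha : Bd d B a) :
    Bd d B (starArr a) := fun R S => by
  rw [WickStar.starArr, nnnorm_star, mul_comm (wt d R)]; exact ha S R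

theorem Tame.starArr {a : MultiIndex n → MultiIndex n → ℂ} (ha : Tame a) : Tame (starArr a) :=
  fun d hd => (ha d hd).imp fun _ h => h.starArr

theorem pser_starArr (a : MultiIndex n → MultiIndex n → ℂ) (u v : Fin n → ℂ) :
    pser (starArr a) u v = star (pser a (star v) (star u)) := by
  have h : starArr a = flip fun R S => star (a R S) := rfl
  rw [h, pser_flip, pser, pser, tsum_star]
  refine tsum_congr fun P => ?_
  simp [pterm, coef, mon]

theorem ofJet_starArr (a : MultiIndex n → MultiIndex n → ℂ) (p : Fin n → ℂ) :
    ofJet p (starArr a) = star (ofJet p a) := by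
  ext z
  rw [ofJet, pser_starArr, star_star]
  rfl

theorem TameFun.star_eq {f : (Fin n → ℂ) → ℂ} (hf : TameFun f) (p : Fin n → ℂ) :
    star f = ofJet p (starArr (jet f p)) := by
  rw [ofJet_starArr, ← hf.eq_ofJet]

theorem TameFun.star {f : (Fin n → ℂ) → ℂ} (hf : TameFun f) : TameFun (star f) := by
  rw [hf.star_eq 0]
  exact tameFun_ofJet (hf.tame 0).starArr 0

theorem TameFun.jet_star {f : (Fin n → ℂ) → ℂ} (hf : TameFun f) (p : Fin n → ℂ) :
    jet (Star.star f) p = starArr (jet f p) := by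
  rw [hf.star_eq p, jet_ofJet (hf.tame p).starArr]

/-- The translation `z ↦ z + α`, `z̄ ↦ z̄ + β̄` in the two variables of the extension. -/
def trans (α β : Fin n → ℂ) (f : (Fin n → ℂ) → ℂ) : (Fin n → ℂ) → ℂ :=
  fun z => hat f (z + α) (z + β)

theorem TameFun.trans_eq {f : (Fin n → ℂ) → ℂ} (hf : TameFun f) (α β p : Fin n → ℂ) :
    trans α β f = ofJet p (fun R S => pser (shift R S (jet f p)) α (Star.star β)) := by
  ext z
  rw [trans, hf.hat_apply p, ofJet, pser_translate (hf.tame p), sub_add_eq_add_sub, ← star_add,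
    sub_add_eq_add_sub]

theorem TameFun.trans {f : (Fin n → ℂ) → ℂ} (hf : TameFun f) (α β : Fin n → ℂ) :
    TameFun (trans α β f) := by
  rw [hf.trans_eq α β 0]
  exact tameFun_ofJet ((hf.tame 0).pser_shift _ _) 0

theorem TameFun.jet_trans {f : (Fin n → ℂ) → ℂ} (hf : TameFun f) (α β p : Fin n → ℂ) :
    jet (WickStar.trans α β f) p = fun R S => pser (shift R S (jet f p)) α (Star.star β) := by
  rw [hf.trans_eq α β p, jet_ofJet ((hf.tame p).pser_shift _ _)]

theorem TameFun.hat_trans {f : (Fin n → ℂ) → ℂ} (hf : TameFun f) (α β u v : Fin n → ℂ) :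
    hat (WickStar.trans α β f) u v = hat f (u + α) (v + β) := by
  have h : IsHatExtension (WickStar.trans α β f) fun u v => hat f (u + α) (v + β) := by
    refine ⟨?_, fun z => rfl⟩
    have h : Differentiable ℂ fun q : (Fin n → ℂ) × (Fin n → ℂ) => (q.1 + α, q.2 + Star.star β) :=
      (differentiable_fst.add_const α).prodMk (differentiable_snd.add_const _)
    have h1 := hf.isHatExtension_hat.1.comp h
    simpa only [Function.comp_def, star_add, star_star] using h1
  rw [hat_eq h]

theorem hat_mul {f g : (Fin n → ℂ) → ℂ} (hf : TameFun f) (hg : TameFun g) (u v : Fin n → ℂ) :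
    hat (f * g) u v = hat f u v * hat g u v := by
  have h : IsHatExtension (f * g) fun u v => hat f u v * hat g u v :=
    ⟨hf.isHatExtension_hat.1.mul hg.isHatExtension_hat.1, fun z => by
      change hat f z z * hat g z z = f z * g z
      rw [hf.isHatExtension_hat.2, hg.isHatExtension_hat.2]⟩
  rw [hat_eq h]

theorem TameFun.hat_self {f : (Fin n → ℂ) → ℂ} (hf : TameFun f) (z : Fin n → ℂ) :
    hat f z z = f z := hf.isHatExtension_hat.2 z

/-! #### Exponentials -/

theorem hasSum_mon (u : Fin n → ℂ) :
    HasSum (fun R : MultiIndex n => mon R u / fact R) (Complex.exp (∑ i, u i)) ∧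
      Summable fun R : MultiIndex n => ‖mon R u / fact R‖ := by
  have h1 : ∀ x : ℂ, HasSum (fun k : ℕ => x ^ k / (k.factorial : ℂ)) (Complex.exp x) := fun x => by
    rw [Complex.exp_eq_exp_ℂ]
    exact NormedSpace.expSeries_div_hasSum_exp x
  have h2 : ∀ x : ℂ, Summable fun k : ℕ => ‖x ^ k / (k.factorial : ℂ)‖ := fun x =>
    NormedSpace.norm_expSeries_div_summable x
  have h := hasSum_prod_univ (g := fun i k => u i ^ k / (k.factorial : ℂ))
    (s := fun i => Complex.exp (u i)) (fun i => h1 (u i)) (fun i => h2 (u i))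
  rw [Complex.exp_sum]
  simpa [mon, fact, Finset.prod_div_distrib] using h

theorem pser_mon (c : ℂ) (x y u v : Fin n → ℂ) :
    pser (fun R S => c * (mon R x * mon S y)) u v =
      c * Complex.exp (∑ i, x i * u i + ∑ i, y i * v i) := by
  have h1 := hasSum_mon fun i => x i * u i
  have h2 := hasSum_mon fun i => y i * v i
  have hs : Summable fun P : MultiIndex n × MultiIndex n =>
      mon P.1 (fun i => x i * u i) / (fact P.1 : ℂ) * (mon P.2 (fun i => y i * v i) / fact P.2) :=
    (h1.2.mul_norm h2.2).of_norm
  have h3 := (h1.1.mul h2.1 hs).mul_left c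
  rw [Complex.exp_add, ← h3.tsum_eq, pser]
  refine tsum_congr fun P => ?_
  simp only [pterm, coef, mon, mul_pow, Finset.prod_mul_distrib]
  ring

theorem tame_mon (c : ℂ) (x y : Fin n → ℂ) :
    Tame fun R S : MultiIndex n => c * (mon R x * mon S y) := fun d hd => by
  obtain ⟨C, hC⟩ := exists_pow_deg_le (n := n) (max ‖x‖₊ ‖y‖₊) hd
  refine ⟨‖c‖₊ * C ^ 2, fun R S => ?_⟩
  rw [nnnorm_mul, nnnorm_mul]
  calc _ ≤ ‖c‖₊ * ((C * wt d R) * (C * wt d S)) := by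
        gcongr
        · exact (nnnorm_mon_le (le_max_left _ _)).trans (hC R)
        · exact (nnnorm_mon_le (le_max_right _ _)).trans (hC S)
    _ = _ := by ring

theorem cdot_add_left (a b c : Fin n → ℂ) : cdot (a + b) c = cdot a c + cdot b c := by
  simp [cdot, add_mul, Finset.sum_add_distrib]

theorem cdot_add_right (a b c : Fin n → ℂ) : cdot a (b + c) = cdot a b + cdot a c := by
  simp [cdot, mul_add, Finset.sum_add_distrib]

theorem cdot_smul_right (c : ℂ) (a b : Fin n → ℂ) : cdot a (c • b) = c * cdot a b := by
  simp [cdot, Finset.mul_sum, mul_left_comm]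

theorem cdot_smul_left (c : ℂ) (a b : Fin n → ℂ) : cdot (c • a) b = star c * cdot a b := by
  simp [cdot, Finset.mul_sum, mul_assoc]

theorem cdot_neg_left (a b : Fin n → ℂ) : cdot (-a) b = -cdot a b := by
  simp [cdot]

theorem cdot_neg_right (a b : Fin n → ℂ) : cdot a (-b) = -cdot a b := by
  simp [cdot]

theorem star_cdot (a b : Fin n → ℂ) : star (cdot a b) = cdot b a := by
  simp [cdot, mul_comm]

theorem expFun_eq_ofJet (hbar : ℝ) (α β p : Fin n → ℂ) :
    expFun hbar α β = ofJet p fun R S => expFun hbar α β p * (mon R (star α) * mon S β) := by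
  ext z
  rw [ofJet, pser_mon, expFun, expFun, ← Complex.exp_add, ← Complex.exp_add, ← Complex.exp_add]
  congr 1
  have h1 : ∑ i, (star α) i * (z - p) i = cdot α (z - p) := rfl
  have h2 : ∑ i, β i * (star (z - p)) i = cdot (z - p) β := by
    simp [cdot, mul_comm]
  rw [h1, h2, sub_eq_add_neg, cdot_add_left, cdot_add_right, cdot_neg_left, cdot_neg_right]
  ring

theorem tameFun_expFun (hbar : ℝ) (α β : Fin n → ℂ) : TameFun (expFun hbar α β) := by
  rw [expFun_eq_ofJet hbar α β 0]
  exact tameFun_ofJet (tame_mon _ _ _) 0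

theorem jet_expFun (hbar : ℝ) (α β p : Fin n → ℂ) : jet (expFun hbar α β) p =
    fun R S => expFun hbar α β p * (mon R (star α) * mon S β) := by
  conv_lhs => rw [expFun_eq_ofJet hbar α β p]
  exact jet_ofJet (tame_mon _ _ _) p

theorem hat_expFun (hbar : ℝ) (α β u v : Fin n → ℂ) : hat (expFun hbar α β) u v =
    Complex.exp ((hbar : ℂ) * cdot α β) * Complex.exp (cdot α u + cdot v β) := by
  rw [(tameFun_expFun hbar α β).hat_apply 0, jet_expFun, pser_mon, sub_zero, sub_zero]
  have h2 : ∑ i, β i * (star v) i = cdot v β := by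
    simp [cdot, mul_comm]
  rw [h2]
  simp [expFun, cdot]

end TameFunctions

/-! ### The topology of `A_{p,ħ}` -/

section Topology

open Filter Topology

variable {p : Fin n → ℂ} {hbar : ℝ}

/-- A tame function as an element of `A_{p,ħ}`. -/
def Alg.ofTame (p : Fin n → ℂ) (hbar : ℝ) {f : (Fin n → ℂ) → ℂ} (hf : TameFun f) :
    Alg n p hbar :=
  ⟨f, mem_preAlgebra hbar hf.contDiff (hf.tame p), hf.analytic⟩

@[simp] theorem Alg.coe_ofTame {f : (Fin n → ℂ) → ℂ} (hf : TameFun f) :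
    ⇑(Alg.ofTame p hbar hf) = f := rfl

theorem Alg.ext_fun {f g : Alg n p hbar} (h : ∀ z, f z = g z) : f = g :=
  DFunLike.ext f g h

theorem Alg.contDiff (f : Alg n p hbar) : ContDiff ℝ ∞ f := f.2.1.1

theorem Alg.analytic (f : Alg n p hbar) : AnalyticOnNhd ℝ f Set.univ := f.2.2

theorem Alg.tame (hpos : 0 < hbar) (f : Alg n p hbar) : TameFun f :=
  TameFun.of_tame f.2.2 (tame_jet_of_mem hpos f.2.1)

@[simp] theorem Alg.coe_add (f g : Alg n p hbar) : ⇑(f + g) = f + g := rfl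

@[simp] theorem Alg.coe_smul (c : ℂ) (f : Alg n p hbar) : ⇑(c • f) = c • ⇑f := rfl

/-- The partial derivatives at a point as linear functionals. -/
def jetLin (p : Fin n → ℂ) (hbar : ℝ) (z : Fin n → ℂ) (R S : MultiIndex n) :
    Alg n p hbar →ₗ[ℂ] ℂ where
  toFun f := jet f z R S
  map_add' f g := by
    rw [Alg.coe_add, jet, dMixed_add R S f.contDiff g.contDiff]; rfl
  map_smul' c f := by
    rw [Alg.coe_smul, jet, dMixed_smul R S c f.contDiff]; rfl

theorem jetLin_apply (z : Fin n → ℂ) (R S : MultiIndex n) (f : Alg n p hbar) :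
    jetLin p hbar z R S f = jet f z R S := rfl

theorem withSeminorms_alg : WithSeminorms (algSeminorm n p hbar) := ⟨rfl⟩

theorem exists_algSeminorm_le (k : SemIndex n) : ∃ d : ℝ, 0 < d ∧ ∃ C : ℝ≥0,
    ∀ (f : Alg n p hbar) (B : ℝ≥0), Bd d B (jet f p) → algSeminorm n p hbar k f ≤ C * B := by
  obtain ⟨d, hd, C, hC⟩ := exists_eSeminorm_le p hbar k.1 k.2.1 k.2.2.1 k.2.2.2
  refine ⟨d, hd, C, fun f B hf => ?_⟩
  have h := ENNReal.toReal_mono ENNReal.coe_ne_top (hC f B hf)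
  exact h

/-- With `exists_algSeminorm_le`, this shows that the topology is that of the best constants in `Bd
d`; from here on only these constants are estimated. -/
theorem exists_bd_algSeminorm (hpos : 0 < hbar) {e : ℝ} (he : 0 < e) :
    ∃ (k : SemIndex n) (C : ℝ≥0), ∀ f : Alg n p hbar,
      Bd e (C * (algSeminorm n p hbar k f).toNNReal) (jet f p) := by
  obtain ⟨m, C, h⟩ := exists_bd_jet p hbar hpos he
  have h1 : 1 < 2 ^ (m + 1) := Nat.one_lt_two_pow (by omega)
  refine ⟨⟨m + 1, ⟨1, h1⟩, 0, 0⟩, C, fun f => h f _ ?_⟩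
  have hfin := (f.2.1.2 (m + 1) 1 0 0 h1).ne
  have h2 : (algSeminorm n p hbar ⟨m + 1, ⟨1, h1⟩, 0, 0⟩ f).toNNReal =
      (eSeminorm p hbar (m + 1) 1 0 0 f).toNNReal := Real.toNNReal_coe
  rw [h2]
  exact (ENNReal.coe_toNNReal hfin).symm

theorem exists_seminorm_map_le (hpos : 0 < hbar) {T : Alg n p hbar → Alg n p hbar}
    (hT : ∀ e : ℝ, 0 < e → ∃ d : ℝ, 0 < d ∧ ∃ C : ℝ≥0, ∀ (f : Alg n p hbar) (B : ℝ≥0),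
      Bd d B (jet f p) → Bd e (C * B) (jet (T f) p)) (k : SemIndex n) :
    ∃ (k' : SemIndex n) (C : ℝ≥0), ∀ f,
      algSeminorm n p hbar k (T f) ≤ C * algSeminorm n p hbar k' f := by
  obtain ⟨e, he, C1, h1⟩ := exists_algSeminorm_le (p := p) (hbar := hbar) k
  obtain ⟨d, hd, C2, h2⟩ := hT e he
  obtain ⟨k', C3, h3⟩ := exists_bd_algSeminorm (n := n) (p := p) hpos hd
  refine ⟨k', C1 * (C2 * C3), fun f => (h1 _ _ (h2 f _ (h3 f))).trans (le_of_eq ?_)⟩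
  push_cast
  rw [Real.coe_toNNReal _ (apply_nonneg _ _)]
  ring

/-- Only compatibility with differences is required, so that it applies to linear maps and to the
conjugate-linear involution alike. -/
theorem continuous_of_bd (hpos : 0 < hbar) {T : Alg n p hbar → Alg n p hbar}
    (hsub : ∀ f g, T (f - g) = T f - T g)
    (hT : ∀ e : ℝ, 0 < e → ∃ d : ℝ, 0 < d ∧ ∃ C : ℝ≥0, ∀ (f : Alg n p hbar) (B : ℝ≥0),
      Bd d B (jet f p) → Bd e (C * B) (jet (T f) p)) : Continuous T := by
  rw [continuous_iff_continuousAt]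
  intro f
  refine (withSeminorms_alg.tendsto_nhds _ _).2 fun k ε hε => ?_
  obtain ⟨k', C, hC⟩ := exists_seminorm_map_le hpos hT k
  have h1 := (withSeminorms_alg.tendsto_nhds (fun g : Alg n p hbar => g) f).1 tendsto_id k'
    -- The summand `1` guards against `C = 0`.
    (ε / (C + 1)) (by positivity)
  filter_upwards [h1] with g hg
  rw [← hsub]
  rw [lt_div_iff₀ (by positivity)] at hg
  have h2 : (0 : ℝ) ≤ algSeminorm n p hbar k' (g - f) := apply_nonneg _ _
  calc _ ≤ _ := hC (g - f)
    _ ≤ algSeminorm n p hbar k' (g - f) * (C + 1) := by nlinarith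
    _ < ε := hg

theorem continuous_bilin_of_bd (hpos : 0 < hbar)
    {M : Alg n p hbar →ₗ[ℂ] Alg n p hbar →ₗ[ℂ] Alg n p hbar}
    (hM : ∀ e : ℝ, 0 < e → ∃ d : ℝ, 0 < d ∧ ∃ C : ℝ≥0, ∀ (f g : Alg n p hbar) (B B' : ℝ≥0),
      Bd d B (jet f p) → Bd d B' (jet g p) → Bd e (C * (B * B')) (jet (M f g) p)) :
    Continuous fun q : Alg n p hbar × Alg n p hbar => M q.1 q.2 := by
  rw [continuous_iff_continuousAt]
  rintro ⟨f, g⟩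
  refine (withSeminorms_alg.tendsto_nhds _ _).2 fun k ε hε => ?_
  obtain ⟨e, he, C1, h1⟩ := exists_algSeminorm_le (p := p) (hbar := hbar) k
  obtain ⟨d, hd, C2, h2⟩ := hM e he
  obtain ⟨k', C3, h3⟩ := exists_bd_algSeminorm (n := n) (p := p) hpos hd
  set q := algSeminorm n p hbar k' with hq
  have hb : ∀ f g, algSeminorm n p hbar k (M f g) ≤ C1 * C2 * C3 ^ 2 * (q f * q g) := fun f g => by
    refine (h1 _ _ (h2 f g _ _ (h3 f) (h3 g))).trans (le_of_eq ?_)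
    push_cast
    rw [Real.coe_toNNReal _ (apply_nonneg _ _), Real.coe_toNNReal _ (apply_nonneg _ _)]
    ring
  set C : ℝ := C1 * C2 * C3 ^ 2 with hC
  have hqf : ∀ f : Alg n p hbar, Tendsto (fun g => q (g - f)) (𝓝 f) (𝓝 0) := fun f => by
    refine Metric.tendsto_nhds.2 fun ε hε => ?_
    have := (withSeminorms_alg.tendsto_nhds (fun g : Alg n p hbar => g) f).1 tendsto_id k' ε hε
    filter_upwards [this] with g hg
    rw [Real.dist_eq, sub_zero, abs_of_nonneg (apply_nonneg _ _)]
    exact hg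
  have ht : Tendsto (fun x : Alg n p hbar × Alg n p hbar => C * (q (x.1 - f) * q (x.2 - g)) +
      (C * (q f * q (x.2 - g)) + C * (q (x.1 - f) * q g))) (𝓝 (f, g)) (𝓝 0) := by
    have e1 := (hqf f).comp (continuous_fst.tendsto (f, g))
    have e2 := (hqf g).comp (continuous_snd.tendsto (f, g))
    have e3 := ((e1.mul e2).const_mul C).add (((e2.const_mul (q f)).const_mul C).add
      ((e1.mul_const (q g)).const_mul C))
    simpa using e3
  filter_upwards [ht.eventually_lt_const hε] with x hx
  refine lt_of_le_of_lt ?_ hx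
  -- Each of the three terms contains a difference that tends to zero and is controlled by the
  -- bilinear bound `hb`.
  have key : M x.1 x.2 - M f g = M (x.1 - f) (x.2 - g) + (M f (x.2 - g) + M (x.1 - f) g) := by
    simp only [map_sub, LinearMap.sub_apply]; abel
  rw [key]
  refine (map_add_le_add _ _ _).trans (add_le_add (hb _ _) ?_)
  exact (map_add_le_add _ _ _).trans (add_le_add (hb _ _) (hb _ _))

/-- Uniform bounds on jets imply convergence in the topology of `A_{p,ħ}` and of all jets. -/
theorem hasSum_of_bd (hpos : 0 < hbar) {ι : Type*} {t : ι → Alg n p hbar} {s : Alg n p hbar}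
    (hK : ∀ d : ℝ, 0 < d → ∃ K : ι → ℝ≥0, Summable K ∧ ∀ N, Bd d (K N) (jet (t N) p))
    (hs : ∀ R S, HasSum (fun N => jet (t N) p R S) (jet s p R S)) :
    HasSum t s ∧ (∀ k, Summable fun N => algSeminorm n p hbar k (t N)) ∧
      ∀ z R S, HasSum (fun N => jet (t N) z R S) (jet s z R S) := by
  -- The remainder after a finite set `F` has the tail of `K` as its bound. Both the convergence in
  -- the seminorms and that of the jets elsewhere follow from it.
  have tail : ∀ d : ℝ, 0 < d → ∃ K : Finset ι → ℝ≥0, Tendsto K atTop (𝓝 0) ∧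
      ∀ F, Bd d (K F) (jet (s - ∑ N ∈ F, t N : Alg n p hbar) p) := by
    intro d hd
    obtain ⟨K, hKs, hKb⟩ := hK d hd
    refine ⟨_, NNReal.tendsto_tsum_compl_atTop_zero K, fun F R S => ?_⟩
    have h1 : jet (s - ∑ N ∈ F, t N : Alg n p hbar) p R S =
        jet s p R S - ∑ N ∈ F, jet (t N) p R S := by
      rw [← jetLin_apply, map_sub, map_sum]; rfl
    have h2 : HasSum (fun N : {N // N ∉ F} => jet (t N) p R S)
        (jet s p R S - ∑ N ∈ F, jet (t N) p R S) := by
      refine (F.hasSum_compl_iff (f := fun N => jet (t N) p R S)).2 ?_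
      rw [sub_add_cancel]
      exact hs R S
    have hKF : Summable fun N : {N // N ∉ F} => K N := NNReal.summable_comp_injective hKs
      Subtype.val_injective
    rw [h1, ← h2.tsum_eq]
    have hle : ∀ N : {N // N ∉ F}, ‖jet (t N) p R S‖₊ ≤ K N * (wt d R * wt d S) := fun N =>
      hKb N R S
    have hsum := NNReal.summable_of_le hle (hKF.mul_right _)
    refine (nnnorm_tsum_le hsum).trans ?_
    rw [← NNReal.tsum_mul_right]
    exact hsum.tsum_le_tsum hle (hKF.mul_right _)
  refine ⟨?_, fun k => ?_, fun z R S => ?_⟩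
  · refine (withSeminorms_alg.tendsto_nhds _ _).2 fun k ε hε => ?_
    obtain ⟨d, hd, C, hC⟩ := exists_algSeminorm_le (p := p) (hbar := hbar) k
    obtain ⟨K, hK0, hKb⟩ := tail d hd
    have h0 : Tendsto (fun F => ((C * K F : ℝ≥0) : ℝ)) atTop (𝓝 0) := by
      have := (hK0.const_mul C)
      rw [mul_zero] at this
      exact NNReal.tendsto_coe.2 this
    filter_upwards [h0.eventually_lt_const hε] with F hF
    rw [map_sub_rev]
    refine lt_of_le_of_lt (hC _ _ (hKb F)) ?_
    exact_mod_cast hF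
  · obtain ⟨d, hd, C, hC⟩ := exists_algSeminorm_le (p := p) (hbar := hbar) k
    obtain ⟨K, hKs, hKb⟩ := hK d hd
    exact ((NNReal.summable_coe.2 hKs).mul_left (C : ℝ)).of_nonneg_of_le
      (fun N => apply_nonneg _ _) fun N => hC _ _ (hKb N)
  -- The jet at `z` is the re-expanded jet at `p`, and re-expansion is bounded; the exponent `1` is
  -- arbitrary, since `R` and `S` are fixed.
  · obtain ⟨d, hd, C, hC⟩ := exists_bd_pser_shift one_pos (z - p) (star (z - p))
    obtain ⟨K, hK0, hKb⟩ := tail d hd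
    have h0 : Tendsto (fun F => ((C * K F * (wt 1 R * wt 1 S) : ℝ≥0) : ℝ)) atTop (𝓝 0) := by
      have := (hK0.const_mul C).mul_const (wt 1 R * wt 1 S)
      rw [mul_zero, zero_mul] at this
      exact NNReal.tendsto_coe.2 this
    have h1 : Tendsto (fun F => jet (s - ∑ N ∈ F, t N : Alg n p hbar) z R S) atTop (𝓝 0) := by
      refine squeeze_zero_norm (fun F => ?_) h0
      have h2 := Alg.tame hpos (s - ∑ N ∈ F, t N)
      rw [h2.eq_ofJet p, jet_ofJet_at (h2.tame p)]
      exact NNReal.coe_le_coe.2 (hC _ _ (hKb F) R S)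
    have h2 := h1.const_sub (jet s z R S)
    rw [sub_zero] at h2
    refine h2.congr fun F => ?_
    simp only [← jetLin_apply, map_sub, map_sum]
    abel

end Topology

/-! ### The star product -/

section StarProduct

/-- The coefficient `(2ħ)^|N| / N!`. -/
def starCoef (hbar : ℝ) (N : MultiIndex n) : ℂ := (2 * (hbar : ℂ)) ^ deg N / (fact N : ℂ)

theorem exists_starCoef_le (hbar : ℝ) {d : ℝ} (hd : 0 < d) : ∃ C : ℝ≥0, ∀ N : MultiIndex n,
    ‖starCoef hbar N‖₊ ≤ C * ((fact N : ℝ≥0)⁻¹ * wt d N) := by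
  obtain ⟨C, hC⟩ := exists_pow_deg_le (n := n) ‖2 * (hbar : ℂ)‖₊ hd
  refine ⟨C, fun N => ?_⟩
  rw [starCoef, nnnorm_div, nnnorm_pow, Complex.nnnorm_natCast, div_eq_inv_mul, mul_left_comm]
  gcongr
  exact hC N

theorem star_starCoef (hbar : ℝ) (N : MultiIndex n) :
    star (starCoef hbar N) = starCoef hbar N := by
  simp [starCoef]

theorem starCoef_mul (hbar : ℝ) {R I : MultiIndex n} (h : I ≤ R) :
    starCoef hbar I * starCoef hbar (R - I) = starCoef hbar R * binom R I := by
  have h1 : deg R = deg I + deg (R - I) := by rw [← deg_add, add_tsub_cancel_of_le h]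
  have h2 := binom_div_fact h
  simp only [starCoef]
  rw [h1, pow_add]
  linear_combination (-((2 * (hbar : ℂ)) ^ deg I * (2 * (hbar : ℂ)) ^ deg (R - I))) * h2

/-- The jet of a summand of the star product. -/
def termArr (hbar : ℝ) (a b : MultiIndex n → MultiIndex n → ℂ) (N : MultiIndex n) :
    MultiIndex n → MultiIndex n → ℂ :=
  fun R S => starCoef hbar N * conv (shift N 0 a) (shift 0 N b) R S

theorem exists_bd_termArr (hbar : ℝ) {e : ℝ} (he : 0 < e) : ∃ d : ℝ, 0 < d ∧
    ∃ K : MultiIndex n → ℝ≥0, Summable K ∧ ∀ (a b : MultiIndex n → MultiIndex n → ℂ)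
      (B B' : ℝ≥0), Bd d B a → Bd d B' b → ∀ N, Bd e (K N * (B * B')) (termArr hbar a b N) := by
  -- In `N`, the coefficient costs `d` and each of the two shifts `2 * d`, in total `5 * d`. In `R`
  -- and `S`, shift and convolution lead to `4 * d`.
  obtain ⟨d, hd, hd1, hd2⟩ : ∃ d : ℝ, 0 < d ∧ 5 * d ≤ e ∧ 5 * d < 1 :=
    ⟨min e 1 / 6, by positivity, by linarith [min_le_left e 1, lt_min he one_pos],
      by linarith [min_le_right e 1]⟩
  obtain ⟨C1, h1⟩ := exists_starCoef_le (n := n) hbar hd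
  obtain ⟨C2, h2⟩ := exists_bd_shift (n := n) hd.le
  obtain ⟨C3, h3⟩ := exists_bd_conv (n := n) (d := 2 * d) (by linarith)
  refine ⟨d, hd, fun N => C1 * C2 ^ 2 * C3 * ((fact N : ℝ≥0)⁻¹ * wt (5 * d) N),
    (summable_fact_wt hd2).mul_left _, fun a b B B' ha hb N => ?_⟩
  refine Bd.mono_exp (fun R S => ?_) (show 2 * (2 * d) ≤ e by linarith)
  rw [termArr, nnnorm_mul]
  refine (mul_le_mul' (h1 N) (h3 _ _ _ _ (h2 a B N 0 ha) (h2 b B' 0 N hb) R S)).trans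
    (le_of_eq ?_)
  have h5 : wt (5 * d) N = wt d N * wt (2 * d) N * wt (2 * d) N := by
    rw [← wt_add_exp, ← wt_add_exp, show d + 2 * d + 2 * d = 5 * d by ring]
  simp only [h5, wt_zero]
  ring

/-- The jet of the star product. -/
def starArr₂ (hbar : ℝ) (a b : MultiIndex n → MultiIndex n → ℂ) :
    MultiIndex n → MultiIndex n → ℂ := fun R S => ∑' N, termArr hbar a b N R S

theorem hasSum_starArr₂ (hbar : ℝ) {a b : MultiIndex n → MultiIndex n → ℂ} (ha : Tame a)
    (hb : Tame b) (R S : MultiIndex n) :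
    HasSum (fun N => termArr hbar a b N R S) (starArr₂ hbar a b R S) := by
  obtain ⟨d, hd, K, hK, h⟩ := exists_bd_termArr (n := n) hbar one_pos
  obtain ⟨B, hB⟩ := ha d hd
  obtain ⟨B', hB'⟩ := hb d hd
  have hs : Summable fun N => K N * (B * B') * (wt 1 R * wt 1 S) := (hK.mul_right _).mul_right _
  exact (Summable.of_norm_bounded (NNReal.summable_coe.2 hs) fun N =>
    NNReal.coe_le_coe.2 (h a b B B' hB hB' N R S)).hasSum

theorem exists_bd_starArr₂ (hbar : ℝ) {e : ℝ} (he : 0 < e) : ∃ d : ℝ, 0 < d ∧ ∃ C : ℝ≥0,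
    ∀ (a b : MultiIndex n → MultiIndex n → ℂ) (B B' : ℝ≥0), Bd d B a → Bd d B' b →
      Bd e (C * (B * B')) (starArr₂ hbar a b) := by
  obtain ⟨d, hd, K, hK, h⟩ := exists_bd_termArr (n := n) hbar he
  refine ⟨d, hd, ∑' N, K N, fun a b B B' ha hb R S => ?_⟩
  have hle := fun N => h a b B B' ha hb N R S
  have hs : Summable fun N => K N * (B * B') * (wt e R * wt e S) := (hK.mul_right _).mul_right _
  have hsum := NNReal.summable_of_le hle hs
  refine (nnnorm_tsum_le hsum).trans ?_
  rw [← NNReal.tsum_mul_right, ← NNReal.tsum_mul_right]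
  exact hsum.tsum_le_tsum hle hs

theorem Tame.starArr₂ (hbar : ℝ) {a b : MultiIndex n → MultiIndex n → ℂ} (ha : Tame a)
    (hb : Tame b) : Tame (starArr₂ hbar a b) := fun e he => by
  obtain ⟨d, hd, C, h⟩ := exists_bd_starArr₂ (n := n) hbar he
  obtain ⟨B, hB⟩ := ha d hd
  obtain ⟨B', hB'⟩ := hb d hd
  exact ⟨_, h a b B B' hB hB'⟩

variable {p : Fin n → ℂ} {hbar : ℝ}

theorem wickTerm_eq (f g : (Fin n → ℂ) → ℂ) (N : MultiIndex n) (z : Fin n → ℂ) :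
    wickTerm hbar f g N z = starCoef hbar N * jet f z N 0 * jet g z 0 N := by
  simp [wickTerm, starCoef, jet, dMixed]

/-- The summand of the star product as an element of `A_{p,ħ}`. -/
def starTerm (hpos : 0 < hbar) (f g : Alg n p hbar) (N : MultiIndex n) : Alg n p hbar :=
  starCoef hbar N • Alg.ofTame p hbar
    (((f.tame hpos).dMixed N 0).mul ((g.tame hpos).dMixed 0 N))

theorem starTerm_apply (hpos : 0 < hbar) (f g : Alg n p hbar) (N : MultiIndex n)
    (z : Fin n → ℂ) : starTerm hpos f g N z = wickTerm hbar f g N z := by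
  rw [wickTerm_eq, mul_assoc]; rfl

theorem jet_starTerm (hpos : 0 < hbar) (f g : Alg n p hbar) (N : MultiIndex n)
    (z : Fin n → ℂ) : jet (starTerm hpos f g N) z = termArr hbar (jet f z) (jet g z) N := by
  ext R S
  have hf := f.tame hpos
  have hg := g.tame hpos
  rw [← jetLin_apply, starTerm, map_smul, jetLin_apply, Alg.coe_ofTame,
    (hf.dMixed N 0).jet_mul (hg.dMixed 0 N), hf.jet_dMixed, hg.jet_dMixed]
  rfl

/-- The star product of two elements of `A_{p,ħ}`. -/
def starMul (hpos : 0 < hbar) (f g : Alg n p hbar) : Alg n p hbar :=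
  Alg.ofTame p hbar
    (tameFun_ofJet (((f.tame hpos).tame p).starArr₂ hbar ((g.tame hpos).tame p)) p)

theorem jet_starMul_self (hpos : 0 < hbar) (f g : Alg n p hbar) :
    jet (starMul hpos f g) p = starArr₂ hbar (jet f p) (jet g p) :=
  jet_ofJet (((f.tame hpos).tame p).starArr₂ hbar ((g.tame hpos).tame p)) p

theorem starMul_hasSum (hpos : 0 < hbar) (f g : Alg n p hbar) :
    HasSum (starTerm hpos f g) (starMul hpos f g) ∧
      (∀ k, Summable fun N => algSeminorm n p hbar k (starTerm hpos f g N)) ∧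
      ∀ z R S, HasSum (fun N => jet (starTerm hpos f g N) z R S)
        (jet (starMul hpos f g) z R S) := by
  have ha := (f.tame hpos).tame p
  have hb := (g.tame hpos).tame p
  refine hasSum_of_bd hpos (fun e he => ?_) fun R S => ?_
  · obtain ⟨d, hd, K, hK, h⟩ := exists_bd_termArr (n := n) hbar he
    obtain ⟨B, hB⟩ := ha d hd
    obtain ⟨B', hB'⟩ := hb d hd
    exact ⟨_, hK.mul_right (B * B'), fun N => by
      rw [jet_starTerm]; exact h _ _ B B' hB hB' N⟩
  · simp only [jet_starTerm, jet_starMul_self]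
    exact hasSum_starArr₂ hbar ha hb R S

/-- Although the product is constructed from jets at `p`, its jet obeys the same formula at every
`z`. Identities can therefore be verified pointwise from jets at the same point. -/
theorem jet_starMul_hasSum (hpos : 0 < hbar) (f g : Alg n p hbar) (z : Fin n → ℂ)
    (R S : MultiIndex n) : HasSum (fun N => termArr hbar (jet f z) (jet g z) N R S)
      (jet (starMul hpos f g) z R S) := by
  simpa only [jet_starTerm] using (starMul_hasSum hpos f g).2.2 z R S

theorem starMul_apply_hasSum (hpos : 0 < hbar) (f g : Alg n p hbar) (z : Fin n → ℂ) :
    HasSum (fun N => wickTerm hbar f g N z) (starMul hpos f g z) := by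
  simpa only [jet_zero_zero, starTerm_apply] using (starMul_hasSum hpos f g).2.2 z 0 0

theorem starMul_eq_of_hasSum (hpos : 0 < hbar) {f g k : Alg n p hbar}
    (h : ∀ z, HasSum (fun N => starCoef hbar N * jet f z N 0 * jet g z 0 N) (k z)) :
    starMul hpos f g = k := Alg.ext_fun fun z => by
  refine (starMul_apply_hasSum hpos f g z).unique ?_
  simpa only [wickTerm_eq] using h z

theorem starMul_apply_hasSum' (hpos : 0 < hbar) (f g : Alg n p hbar) (z : Fin n → ℂ) :
    HasSum (fun N => starCoef hbar N * jet f z N 0 * jet g z 0 N) (starMul hpos f g z) := by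
  simpa only [wickTerm_eq] using starMul_apply_hasSum hpos f g z

theorem jet_add (f g : Alg n p hbar) (z : Fin n → ℂ) (R S : MultiIndex n) :
    jet (f + g : Alg n p hbar) z R S = jet f z R S + jet g z R S :=
  map_add (jetLin p hbar z R S) f g

theorem jet_smul (c : ℂ) (f : Alg n p hbar) (z : Fin n → ℂ) (R S : MultiIndex n) :
    jet (c • f : Alg n p hbar) z R S = c * jet f z R S :=
  map_smul (jetLin p hbar z R S) c f

/-- The star product as a bilinear map. -/
def starLin (p : Fin n → ℂ) (hpos : 0 < hbar) :
    Alg n p hbar →ₗ[ℂ] Alg n p hbar →ₗ[ℂ] Alg n p hbar :=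
  LinearMap.mk₂ ℂ (starMul hpos)
    (fun f f' g => starMul_eq_of_hasSum hpos fun z =>
      (congrArg (fun φ => HasSum φ _) (funext fun N => by rw [jet_add]; ring)).mp
        ((starMul_apply_hasSum' hpos f g z).add (starMul_apply_hasSum' hpos f' g z)))
    (fun c f g => starMul_eq_of_hasSum hpos fun z =>
      (congrArg (fun φ => HasSum φ _) (funext fun N => by rw [jet_smul]; ring)).mp
        ((starMul_apply_hasSum' hpos f g z).mul_left c))
    (fun f g g' => starMul_eq_of_hasSum hpos fun z =>
      (congrArg (fun φ => HasSum φ _) (funext fun N => by rw [jet_add]; ring)).mp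
        ((starMul_apply_hasSum' hpos f g z).add (starMul_apply_hasSum' hpos f g' z)))
    (fun c f g => starMul_eq_of_hasSum hpos fun z =>
      (congrArg (fun φ => HasSum φ _) (funext fun N => by rw [jet_smul]; ring)).mp
        ((starMul_apply_hasSum' hpos f g z).mul_left c))

theorem starLin_apply (hpos : 0 < hbar) (f g : Alg n p hbar) :
    starLin p hpos f g = starMul hpos f g := rfl

theorem continuous_starLin (hpos : 0 < hbar) :
    Continuous fun q : Alg n p hbar × Alg n p hbar => starLin p hpos q.1 q.2 := by
  refine continuous_bilin_of_bd hpos fun e he => ?_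
  obtain ⟨d, hd, C, h⟩ := exists_bd_starArr₂ (n := n) hbar he
  refine ⟨d, hd, C, fun f g B B' hf hg => ?_⟩
  rw [starLin_apply, jet_starMul_self]
  exact h _ _ B B' hf hg

/-- Complex conjugation on `A_{p,ħ}`. -/
def conjLin (p : Fin n → ℂ) (hpos : 0 < hbar) : Alg n p hbar →ₗ⋆[ℂ] Alg n p hbar where
  toFun f := Alg.ofTame p hbar (f.tame hpos).star
  map_add' f g := Alg.ext_fun fun z => star_add (f z) (g z)
  map_smul' c f := Alg.ext_fun fun z => star_mul' c (f z)

theorem conjLin_apply (hpos : 0 < hbar) (f : Alg n p hbar) (z : Fin n → ℂ) :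
    conjLin p hpos f z = star (f z) := rfl

theorem jet_conjLin (hpos : 0 < hbar) (f : Alg n p hbar) (z : Fin n → ℂ) :
    jet (conjLin p hpos f) z = starArr (jet f z) := (f.tame hpos).jet_star z

theorem continuous_conjLin (hpos : 0 < hbar) : Continuous (conjLin p hpos) := by
  refine continuous_of_bd hpos (fun f g => map_sub _ f g) fun e he => ?_
  refine ⟨e, he, 1, fun f B hf => ?_⟩
  rw [jet_conjLin, one_mul]
  exact hf.starArr

theorem conj_starMul (hpos : 0 < hbar) (f g : Alg n p hbar) :
    conjLin p hpos (starMul hpos f g) =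
      starMul hpos (conjLin p hpos g) (conjLin p hpos f) := by
  symm
  refine starMul_eq_of_hasSum hpos fun z => ?_
  rw [conjLin_apply]
  have h := (starMul_apply_hasSum' hpos f g z).star
  refine (congrArg (fun φ => HasSum φ _) (funext fun N => ?_)).mp h
  rw [jet_conjLin, jet_conjLin, starArr, starArr, star_mul', star_mul', star_starCoef]
  ring

theorem conj_conj (hpos : 0 < hbar) (f : Alg n p hbar) :
    conjLin p hpos (conjLin p hpos f) = f := Alg.ext_fun fun z => star_star (f z)

/-! #### Associativity -/

/-- The summand of a triple star product. -/
def tripleTerm (hbar : ℝ) (a b c : MultiIndex n → MultiIndex n → ℂ)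
    (q : (MultiIndex n × MultiIndex n) × MultiIndex n) : ℂ :=
  starCoef hbar q.1.1 * starCoef hbar q.1.2 * starCoef hbar q.2 *
    (a (q.1.1 + q.2) 0 * b q.1.2 q.2 * c 0 (q.1.1 + q.1.2))

theorem summable_tripleTerm (hbar : ℝ) {a b c : MultiIndex n → MultiIndex n → ℂ} (ha : Tame a)
    (hb : Tame b) (hc : Tame c) : Summable (tripleTerm hbar a b c) := by
  -- The coefficients and the separation of the sums `I + N` and `I + K` give exponents `5 * d`, `4
  -- * d`, `4 * d` in `I`, `K`, `N`; here `5 * d = 1 / 2 < 1`.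
  set d : ℝ := 1 / 10 with hd
  have hd0 : 0 < d := by norm_num [hd]
  obtain ⟨C1, h1⟩ := exists_starCoef_le (n := n) hbar hd0
  obtain ⟨C2, h2⟩ := exists_wt_add_le (n := n) hd0.le
  obtain ⟨A, hA⟩ := ha d hd0
  obtain ⟨B, hB⟩ := hb d hd0
  obtain ⟨C, hC⟩ := hc d hd0
  have hs := NNReal.summable_coe.2 (summable_fact_wt (n := n) (d := 5 * d) (by norm_num [hd]))
  have h3 := ((hs.mul_of_nonneg hs (fun _ => NNReal.coe_nonneg _)
    (fun _ => NNReal.coe_nonneg _)).mul_of_nonneg hs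
      (fun _ => mul_nonneg (NNReal.coe_nonneg _) (NNReal.coe_nonneg _))
      (fun _ => NNReal.coe_nonneg _)).mul_left ((C1 ^ 3 * C2 ^ 2 * A * B * C : ℝ≥0) : ℝ)
  refine Summable.of_norm_bounded h3 fun ⟨⟨I, K⟩, N⟩ => ?_
  rw [← NNReal.coe_mul, ← NNReal.coe_mul, ← NNReal.coe_mul, ← coe_nnnorm, NNReal.coe_le_coe]
  simp only [tripleTerm, nnnorm_mul]
  have hwt : ∀ N : MultiIndex n, wt (4 * d) N ≤ wt (5 * d) N := fun N =>
    wt_mono_exp (by linarith) N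
  have h2d : ∀ N : MultiIndex n, wt (2 * d) N = wt d N ^ 2 := fun N => by
    rw [two_mul, wt_add_exp, sq]
  have h4d : ∀ N : MultiIndex n, wt (4 * d) N = wt d N ^ 4 := fun N => by
    rw [wt_pow]; congr 1; push_cast; ring
  have h5d : ∀ N : MultiIndex n, wt (5 * d) N = wt d N ^ 5 := fun N => by
    rw [wt_pow]; congr 1; push_cast; ring
  calc _ ≤ (C1 * ((fact I : ℝ≥0)⁻¹ * wt d I)) * (C1 * ((fact K : ℝ≥0)⁻¹ * wt d K)) *
        (C1 * ((fact N : ℝ≥0)⁻¹ * wt d N)) *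
        ((A * ((C2 * (wt (2 * d) I * wt (2 * d) N)) * wt d 0)) * (B * (wt d K * wt d N)) *
          (C * (wt d 0 * (C2 * (wt (2 * d) I * wt (2 * d) K))))) := by
        refine mul_le_mul' (mul_le_mul' (mul_le_mul' (h1 _) (h1 _)) (h1 _))
          (mul_le_mul' (mul_le_mul' ((hA _ _).trans ?_) (hB _ _)) ((hC _ _).trans ?_))
        · gcongr; exact h2 _ _
        · gcongr; exact h2 _ _
    _ = C1 ^ 3 * C2 ^ 2 * A * B * C * ((fact I : ℝ≥0)⁻¹ * wt (5 * d) I *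
          ((fact K : ℝ≥0)⁻¹ * wt (4 * d) K) * ((fact N : ℝ≥0)⁻¹ * wt (4 * d) N)) := by
        rw [h2d, h2d, h2d, h4d, h4d, h5d, wt_zero]; ring
    _ ≤ _ := by gcongr <;> exact hwt _

theorem conv_zero_right (a b : MultiIndex n → MultiIndex n → ℂ) (R : MultiIndex n) :
    conv a b R 0 = ∑ I ∈ Finset.Iic R, (binom R I : ℂ) * (a I 0 * b (R - I) 0) := by
  have h : Finset.Iic (0 : MultiIndex n) = {0} := by ext I; simp [funext_iff]
  refine Finset.sum_congr rfl fun I _ => ?_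
  rw [h, Finset.sum_singleton]
  simp [binom]

/-- By the Leibniz rule, `∂^M` of the inner product lets `I` derivatives fall on `f` and `K = M - I`
on `g`, and `starCoef_mul` splits the coefficient accordingly. Absolute convergence permits
regrouping by `M = I + K`. -/
theorem starMul_starMul_apply (hpos : 0 < hbar) (f g k : Alg n p hbar) (z : Fin n → ℂ) :
    starMul hpos (starMul hpos f g) k z =
      ∑' q, tripleTerm hbar (jet f z) (jet g z) (jet k z) q := by
  have hF := summable_tripleTerm hbar ((f.tame hpos).tame z) ((g.tame hpos).tame z)
    ((k.tame hpos).tame z)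
  have h1 := hF.hasSum.prod_fiberwise fun P => (hF.prod_factor P).hasSum
  have h2 := hasSum_Iic h1
  refine HasSum.unique ?_ h2
  refine (congrArg (fun φ => HasSum φ _) (funext fun M => ?_)).mp
    (starMul_apply_hasSum' hpos (starMul hpos f g) k z)
  have h3 := (((jet_starMul_hasSum hpos f g z M 0).mul_left (starCoef hbar M)).mul_right
    (jet k z 0 M))
  refine h3.unique ?_
  have h4 := hasSum_sum (s := Finset.Iic M) fun I _ => (hF.prod_factor (I, M - I)).hasSum
  refine (congrArg (fun φ => HasSum φ _) (funext fun N => ?_)).mp h4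
  simp only [termArr, conv_zero_right, Finset.mul_sum, Finset.sum_mul]
  refine Finset.sum_congr rfl fun I hI => ?_
  rw [Finset.mem_Iic] at hI
  simp only [tripleTerm, shift, starCoef_mul hbar hI, add_tsub_cancel_of_le hI, add_zero, zero_add]
  ring

/-- Reversing and conjugating the three factors exchanges the summation indices `K` and `N`. -/
theorem tripleTerm_star (a b c : MultiIndex n → MultiIndex n → ℂ) :
    star (∑' q, tripleTerm hbar (starArr c) (starArr b) (starArr a) q) =
      ∑' q, tripleTerm hbar a b c q := by
  let e : (MultiIndex n × MultiIndex n) × MultiIndex n ≃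
      (MultiIndex n × MultiIndex n) × MultiIndex n :=
    { toFun := fun q => ((q.1.1, q.2), q.1.2)
      invFun := fun q => ((q.1.1, q.2), q.1.2)
      left_inv := fun _ => rfl
      right_inv := fun _ => rfl }
  rw [tsum_star, ← e.tsum_eq]
  refine tsum_congr fun q => ?_
  simp only [e, Equiv.coe_fn_mk, tripleTerm, starArr, star_mul', star_starCoef, star_star]
  ring

/-- As conjugation reverses products, the right-bracketed product is the conjugate of a
left-bracketed one, so the triple series for left bracketing suffices. -/
theorem starMul_assoc (hpos : 0 < hbar) (f g k : Alg n p hbar) :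
    starMul hpos (starMul hpos f g) k = starMul hpos f (starMul hpos g k) := by
  refine Alg.ext_fun fun z => ?_
  have h : starMul hpos f (starMul hpos g k) = conjLin p hpos (starMul hpos
      (starMul hpos (conjLin p hpos k) (conjLin p hpos g)) (conjLin p hpos f)) := by
    rw [conj_starMul, conj_starMul, conj_conj, conj_conj, conj_conj]
  rw [h, conjLin_apply, starMul_starMul_apply, starMul_starMul_apply]
  simp only [jet_conjLin]
  exact (tripleTerm_star _ _ _).symm

/-! #### Products with exponentials -/

theorem hasSum_pser_left {a : MultiIndex n → MultiIndex n → ℂ} (ha : Tame a) (u : Fin n → ℂ) :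
    HasSum (fun N => a N 0 / fact N * mon N u) (pser a u 0) := by
  have hinj : Function.Injective fun N : MultiIndex n => (N, (0 : MultiIndex n)) :=
    fun _ _ h => (Prod.ext_iff.1 h).1
  have h := (hinj.hasSum_iff (f := pterm a u 0) fun P hP => ?_).2 (ha.hasSum_pser u 0)
  · refine (congrArg (fun φ => HasSum φ _) (funext fun N => ?_)).mp h
    simp [pterm, coef]
  · have : P.2 ≠ 0 := fun h => hP ⟨P.1, Prod.ext rfl h.symm⟩
    simp [pterm, mon_apply_zero, this]

theorem hasSum_pser_right {a : MultiIndex n → MultiIndex n → ℂ} (ha : Tame a) (v : Fin n → ℂ) :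
    HasSum (fun N => a 0 N / fact N * mon N v) (pser a 0 v) := by
  have h := hasSum_pser_left ha.flip v
  rwa [pser_flip] at h

theorem mon_smul (N : MultiIndex n) (c : ℂ) (u : Fin n → ℂ) :
    mon N (c • u) = c ^ deg N * mon N u := by
  simp [mon, deg, mul_pow, Finset.prod_mul_distrib, Finset.prod_pow_eq_pow_sum]

/-- The exponential functions as elements of `A_{p,ħ}`. -/
def expAlg (p : Fin n → ℂ) (hbar : ℝ) (α β : Fin n → ℂ) : Alg n p hbar :=
  Alg.ofTame p hbar (tameFun_expFun hbar α β)

theorem expAlg_apply (α β z : Fin n → ℂ) : expAlg p hbar α β z = expFun hbar α β z := rfl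

/-- Each `∂/∂z^i` multiplies the exponential by `ᾱ_i`, so the series is, up to that factor, the
Taylor series of `f̂(z, ·)` at `z̄` with increment `2ħᾱ`. -/
theorem starMul_exp_left (hpos : 0 < hbar) (α β : Fin n → ℂ) (f : Alg n p hbar)
    (z : Fin n → ℂ) : starMul hpos (expAlg p hbar α β) f z =
      expFun hbar α β z * tauBar ((2 * (hbar : ℂ)) • α) f z := by
  have hf := f.tame hpos
  have e1 : tauBar ((2 * (hbar : ℂ)) • α) f z =
      pser (jet f z) 0 ((2 * (hbar : ℂ)) • star α) := by
    rw [tauBar, hf.hat_apply z, sub_self, add_sub_cancel_left, star_smul]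
    simp
  rw [e1]
  refine (starMul_apply_hasSum' hpos (expAlg p hbar α β) f z).unique ?_
  refine (congrArg (fun φ => HasSum φ _) (funext fun N => ?_)).mp
    ((hasSum_pser_right (hf.tame z) ((2 * (hbar : ℂ)) • star α)).mul_left (expFun hbar α β z))
  rw [expAlg, Alg.coe_ofTame, jet_expFun, mon_smul]
  simp only [mon_zero, starCoef]
  ring

theorem starMul_exp_right (hpos : 0 < hbar) (α β : Fin n → ℂ) (f : Alg n p hbar)
    (z : Fin n → ℂ) : starMul hpos f (expAlg p hbar α β) z =
      expFun hbar α β z * tau ((2 * (hbar : ℂ)) • β) f z := by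
  have hf := f.tame hpos
  have e1 : tau ((2 * (hbar : ℂ)) • β) f z = pser (jet f z) ((2 * (hbar : ℂ)) • β) 0 := by
    rw [tau, hf.hat_apply z, sub_self, add_sub_cancel_left, star_zero]
  rw [e1]
  refine (starMul_apply_hasSum' hpos f (expAlg p hbar α β) z).unique ?_
  refine (congrArg (fun φ => HasSum φ _) (funext fun N => ?_)).mp
    ((hasSum_pser_left (hf.tame z) ((2 * (hbar : ℂ)) • β)).mul_left (expFun hbar α β z))
  rw [expAlg, Alg.coe_ofTame, jet_expFun, mon_smul]
  simp only [mon_zero, starCoef]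
  ring

theorem starMul_exp_exp (hpos : 0 < hbar) (α β γ δ : Fin n → ℂ) :
    starMul hpos (expAlg p hbar α β) (expAlg p hbar γ δ) =
      Complex.exp ((hbar : ℂ) * (cdot α δ - cdot γ β)) • expAlg p hbar (α + γ) (β + δ) := by
  refine Alg.ext_fun fun z => ?_
  rw [starMul_exp_left, tauBar, expAlg, Alg.coe_ofTame, hat_expFun]
  change _ = _ * expFun hbar (α + γ) (β + δ) z
  simp only [expFun, ← Complex.exp_add]
  congr 1
  simp only [cdot_add_left, cdot_add_right, cdot_smul_left]
  have : star (2 * (hbar : ℂ)) = 2 * hbar := by simp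
  rw [this]
  ring

theorem conj_exp (hpos : 0 < hbar) (α β : Fin n → ℂ) :
    conjLin p hpos (expAlg p hbar α β) = expAlg p hbar β α := by
  refine Alg.ext_fun fun z => ?_
  rw [conjLin_apply, expAlg_apply, expAlg_apply]
  simp only [expFun, ← Complex.exp_add, Complex.star_def, ← Complex.exp_conj, map_add, map_mul,
    Complex.conj_ofReal]
  simp only [← Complex.star_def, star_cdot]
  rw [add_comm (cdot z α)]

theorem expFun_zero (z : Fin n → ℂ) : expFun hbar 0 0 z = 1 := by
  simp [expFun, cdot]

/-! #### Translations -/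

theorem hat_add {f g : (Fin n → ℂ) → ℂ} (hf : TameFun f) (hg : TameFun g) :
    hat (f + g) = fun u v => hat f u v + hat g u v :=
  hat_eq ⟨hf.isHatExtension_hat.1.add hg.isHatExtension_hat.1, fun z => by
    rw [Pi.add_apply, ← hf.hat_self z, ← hg.hat_self z]⟩

theorem hat_smul (c : ℂ) {f : (Fin n → ℂ) → ℂ} (hf : TameFun f) :
    hat (c • f) = fun u v => c * hat f u v :=
  hat_eq ⟨hf.isHatExtension_hat.1.const_mul c, fun z => by
    rw [Pi.smul_apply, ← hf.hat_self z, smul_eq_mul]⟩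

/-- The translations in the two variables of the extension as linear maps. -/
def transLin (p : Fin n → ℂ) (hpos : 0 < hbar) (α β : Fin n → ℂ) :
    Alg n p hbar →ₗ[ℂ] Alg n p hbar where
  toFun f := Alg.ofTame p hbar ((f.tame hpos).trans α β)
  map_add' f g := Alg.ext_fun fun z =>
    congrFun (congrFun (hat_add (f.tame hpos) (g.tame hpos)) (z + α)) (z + β)
  map_smul' c f := Alg.ext_fun fun z =>
    congrFun (congrFun (hat_smul c (f.tame hpos)) (z + α)) (z + β)

theorem transLin_apply (hpos : 0 < hbar) (α β : Fin n → ℂ) (f : Alg n p hbar)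
    (z : Fin n → ℂ) : transLin p hpos α β f z = hat f (z + α) (z + β) := rfl

theorem continuous_transLin (hpos : 0 < hbar) (α β : Fin n → ℂ) :
    Continuous (transLin p hpos α β) := by
  refine continuous_of_bd hpos (fun f g => map_sub _ f g) fun e he => ?_
  obtain ⟨d, hd, C, h⟩ := exists_bd_pser_shift he α (star β)
  refine ⟨d, hd, C, fun f B hf => ?_⟩
  have : jet (transLin p hpos α β f) p = _ := (f.tame hpos).jet_trans α β p
  rw [this]
  exact h _ _ hf

theorem transLin_transLin (hpos : 0 < hbar) (α β γ δ : Fin n → ℂ) (f : Alg n p hbar) :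
    transLin p hpos α β (transLin p hpos γ δ f) = transLin p hpos (α + γ) (β + δ) f := by
  refine Alg.ext_fun fun z => ?_
  rw [transLin_apply]
  have : hat (transLin p hpos γ δ f) = hat (trans γ δ f) := rfl
  rw [this, (f.tame hpos).hat_trans, transLin_apply, add_assoc, add_assoc]

theorem transLin_zero (hpos : 0 < hbar) (f : Alg n p hbar) : transLin p hpos 0 0 f = f := by
  refine Alg.ext_fun fun z => ?_
  rw [transLin_apply, add_zero, (f.tame hpos).hat_self]

/-- The translations in the two variables of the extension as topological isomorphisms. -/
def transEquiv (p : Fin n → ℂ) (hpos : 0 < hbar) (α β : Fin n → ℂ) :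
    Alg n p hbar ≃L[ℂ] Alg n p hbar where
  toLinearMap := transLin p hpos α β
  invFun := transLin p hpos (-α) (-β)
  left_inv f := by
    change transLin p hpos (-α) (-β) (transLin p hpos α β f) = f
    rw [transLin_transLin, neg_add_cancel, neg_add_cancel, transLin_zero]
  right_inv f := by
    change transLin p hpos α β (transLin p hpos (-α) (-β) f) = f
    rw [transLin_transLin, add_neg_cancel, add_neg_cancel, transLin_zero]
  continuous_toFun := continuous_transLin hpos α β
  continuous_invFun := continuous_transLin hpos (-α) (-β)

theorem transEquiv_apply (hpos : 0 < hbar) (α β : Fin n → ℂ) (f : Alg n p hbar) :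
    transEquiv p hpos α β f = transLin p hpos α β f := rfl

theorem transLin_diag_apply (hpos : 0 < hbar) (w : Fin n → ℂ) (f : Alg n p hbar)
    (z : Fin n → ℂ) : transLin p hpos w w f z = f (z + w) := by
  rw [transLin_apply, (f.tame hpos).hat_self]

theorem jet_transLin_diag (hpos : 0 < hbar) (w : Fin n → ℂ) (f : Alg n p hbar)
    (z : Fin n → ℂ) : jet (transLin p hpos w w f) z = jet f (z + w) := by
  have hf := f.tame hpos
  have h1 : jet (transLin p hpos w w f) z = _ := hf.jet_trans w w z
  rw [h1]
  conv_rhs => rw [hf.eq_ofJet z, jet_ofJet_at (hf.tame z), add_sub_cancel_left]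

/-- The star product at a point depends only on the jets there, with coefficients independent of the
point, and translation merely moves jets. -/
theorem transLin_starMul (hpos : 0 < hbar) (w : Fin n → ℂ) (f g : Alg n p hbar) :
    transLin p hpos w w (starMul hpos f g) =
      starMul hpos (transLin p hpos w w f) (transLin p hpos w w g) := by
  symm
  refine starMul_eq_of_hasSum hpos fun z => ?_
  rw [transLin_diag_apply]
  simp only [jet_transLin_diag]
  exact starMul_apply_hasSum' hpos f g (z + w)

/-- Translations are inner. -/
theorem transLin_eq_inner (hpos : 0 < hbar) (w : Fin n → ℂ) (f : Alg n p hbar) :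
    transLin p hpos w w f =
      starMul hpos (starMul hpos (expAlg p hbar ((1 / (2 * (hbar : ℂ))) • w)
        (-((1 / (2 * (hbar : ℂ))) • w))) f)
        (expAlg p hbar (-((1 / (2 * (hbar : ℂ))) • w)) ((1 / (2 * (hbar : ℂ))) • w)) := by
  have hf := f.tame hpos
  have h0 : (2 * (hbar : ℂ)) ≠ 0 := by
    simpa using hpos.ne'
  set x : Fin n → ℂ := (1 / (2 * (hbar : ℂ))) • w with hx
  have hxw : (2 * (hbar : ℂ)) • x = w := by
    rw [hx, smul_smul, mul_one_div_cancel h0, one_smul]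
  have hE := tameFun_expFun (n := n) hbar x (-x)
  refine Alg.ext_fun fun z => ?_
  -- Left multiplication shifts only the antiholomorphic variable; the right factor then shifts the
  -- holomorphic one, and the two shifts together give the diagonal translation.
  have e1 : (starMul hpos (expAlg p hbar x (-x)) f : (Fin n → ℂ) → ℂ) =
      expFun hbar x (-x) * trans 0 w f := by
    ext z
    rw [starMul_exp_left, hxw, Pi.mul_apply, trans, add_zero]
    rfl
  rw [starMul_exp_right, tau, e1, hat_mul hE (hf.trans 0 w), hf.hat_trans, hxw, hat_expFun,
    add_zero, hf.hat_self, transLin_diag_apply]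
  -- The exponential factors cancel: the shift contributes `x̄ w = 2ħ x̄ x`, which offsets the two
  -- prefactors `exp (-ħ x̄ x)`.
  have e2 : expFun hbar (-x) x z * (Complex.exp ((hbar : ℂ) * cdot x (-x)) *
      Complex.exp (cdot x (z + w) + cdot z (-x))) = 1 := by
    simp only [expFun, ← Complex.exp_add]
    rw [← Complex.exp_zero]
    congr 1
    have : cdot x w = 2 * hbar * cdot x x := by
      conv_lhs => rw [← hxw, cdot_smul_right]
    simp only [cdot_add_right, cdot_neg_left, cdot_neg_right, this]
    ring
  rw [← mul_assoc, e2, one_mul]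

end StarProduct

end WickStar

end

/-! ### Assembly of the theorem -/

open WickStar in
theorem mainTheorem7 (n : ℕ) (p : Fin n → ℂ) (hbar : ℝ) (hpos : 0 < hbar) :
    -- every class modulo the functions with vanishing infinite jet at `p` has exactly one
    -- real-analytic representative
    (∀ f ∈ preAlgebra n p hbar, ∃! g : Alg n p hbar, ∀ R S, dMixed R S g p = dMixed R S f p) ∧
    -- the extension entering the definition of the translations of a single variable
    (∀ f : Alg n p hbar, ∃! F, IsHatExtension f F) ∧
    ∃ (mul : Alg n p hbar →ₗ[ℂ] Alg n p hbar →ₗ[ℂ] Alg n p hbar)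
      (conj : Alg n p hbar →ₗ⋆[ℂ] Alg n p hbar) (one : Alg n p hbar)
      (e : (Fin n → ℂ) → (Fin n → ℂ) → Alg n p hbar) (u : (Fin n → ℂ) → Alg n p hbar)
      (τ τbar T : (Fin n → ℂ) → (Alg n p hbar ≃L[ℂ] Alg n p hbar)),
      -- `mul` is the Wick star product: its series converges absolutely in the topology of
      -- `A_{p,ħ}`, and pointwise
      (∀ f g : Alg n p hbar,
        (∃ t : MultiIndex n → Alg n p hbar,
          (∀ N z, t N z = wickTerm hbar f g N z) ∧
          (∀ k, Summable fun N => algSeminorm n p hbar k (t N)) ∧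
          HasSum t (mul f g)) ∧
        ∀ z, HasSum (fun N => wickTerm hbar f g N z) (mul f g z)) ∧
      -- `A_{p,ħ}` is a unital topological *-algebra
      (∀ f g k, mul (mul f g) k = mul f (mul g k)) ∧
      (∀ z, one z = 1) ∧ (∀ f, mul one f = f ∧ mul f one = f) ∧
      (∀ f z, conj f z = star (f z)) ∧ (∀ f g, conj (mul f g) = mul (conj g) (conj f)) ∧
      Continuous (fun q : Alg n p hbar × Alg n p hbar => mul q.1 q.2) ∧ Continuous conj ∧
      -- Wick products with exponentials
      (∀ α β z, e α β z = expFun hbar α β z) ∧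
      (∀ α β γ δ, mul (e α β) (e γ δ) =
        Complex.exp ((hbar : ℂ) * (cdot α δ - cdot γ β)) • e (α + γ) (β + δ)) ∧
      (∀ α β (f : Alg n p hbar) z, mul (e α β) f z =
        expFun hbar α β z * tauBar ((2 * (hbar : ℂ)) • α) f z) ∧
      (∀ α β (f : Alg n p hbar) z, mul f (e α β) z =
        expFun hbar α β z * tau ((2 * (hbar : ℂ)) • β) f z) ∧
      (∀ α (f : Alg n p hbar) z, τ α f z = tau α f z ∧ τbar α f z = tauBar α f z) ∧
      -- the elements `u_w` are unitary
      (∀ w z, u w z = uFun hbar w z) ∧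
      (∀ w, mul (u w) (conj (u w)) = one ∧ mul (conj (u w)) (u w) = one) ∧
      -- the translation group acts by continuous *-automorphisms, which are inner
      (∀ w (f : Alg n p hbar) z, T w f z = f (z + w)) ∧
      (∀ f, T 0 f = f) ∧ (∀ v w f, T (v + w) f = T v (T w f)) ∧
      (∀ w f g, T w (mul f g) = mul (T w f) (T w g)) ∧ (∀ w, T w one = one) ∧
      (∀ w f, T w (conj f) = conj (T w f)) ∧
      (∀ w f, T w f = mul (mul (u w) f) (conj (u w))) := by
  let x : (Fin n → ℂ) → Fin n → ℂ := fun w => (1 / (2 * (hbar : ℂ))) • w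
  have hone : ∀ z, expAlg p hbar 0 0 z = 1 := expFun_zero
  -- For opposite parameters of the form `(y, -y)` the phase is trivial. Applied to `y` and to `-y`,
  -- this gives both unitarity relations.
  have hexp : ∀ y : Fin n → ℂ, starMul hpos (expAlg p hbar y (-y)) (expAlg p hbar (-y) y) =
      expAlg p hbar 0 0 := fun y => by
    rw [starMul_exp_exp, cdot_neg_left, cdot_neg_right, neg_neg, sub_self, mul_zero,
      Complex.exp_zero, one_smul, add_neg_cancel, neg_add_cancel]
  refine ⟨fun f hf => ?_, fun f => ⟨hat f, (f.tame hpos).isHatExtension_hat,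
      fun F hF => (hat_eq hF).symm⟩,
    starLin p hpos, conjLin p hpos, expAlg p hbar 0 0, expAlg p hbar,
    fun w => expAlg p hbar (x w) (-x w), fun α => transEquiv p hpos α 0,
    fun α => transEquiv p hpos 0 α, fun w => transEquiv p hpos w w,
    fun f g => ⟨⟨starTerm hpos f g, starTerm_apply hpos f g, (starMul_hasSum hpos f g).2.1,
      (starMul_hasSum hpos f g).1⟩, starMul_apply_hasSum hpos f g⟩,
    starMul_assoc hpos, hone, fun f => ⟨Alg.ext_fun fun z => ?_, Alg.ext_fun fun z => ?_⟩,
    conjLin_apply hpos, conj_starMul hpos, continuous_starLin hpos, continuous_conjLin hpos,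
    expAlg_apply, starMul_exp_exp hpos, starMul_exp_left hpos, starMul_exp_right hpos,
    fun α f z => ⟨?_, ?_⟩, fun w z => rfl, fun w => ?_, transLin_diag_apply hpos,
    transLin_zero hpos, fun v w f => (transLin_transLin hpos v v w w f).symm,
    transLin_starMul hpos, fun w => Alg.ext_fun fun z => ?_, fun w f => Alg.ext_fun fun z => ?_,
    fun w f => ?_⟩
  · have ha := tame_jet_of_mem hpos hf
    -- The representative is the sum of the Taylor series of `f` at `p`, which need not equal `f`
    -- when `f` is merely smooth.
    refine ⟨Alg.ofTame p hbar (tameFun_ofJet ha p), fun R S =>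
      congrFun (congrFun (jet_ofJet ha p) R) S, fun g hg => Alg.ext_fun fun z => ?_⟩
    refine congrFun (eq_of_jet_eq g.analytic (analyticOnNhd_ofJet ha p) (p := p) ?_) z
    rw [jet_ofJet ha p]
    ext R S
    exact hg R S
  · rw [starLin_apply, starMul_exp_left, expFun_zero, tauBar, smul_zero, add_zero,
      (f.tame hpos).hat_self, one_mul]
  · rw [starLin_apply, starMul_exp_right, expFun_zero, tau, smul_zero, add_zero,
      (f.tame hpos).hat_self, one_mul]
  · rw [transEquiv_apply, transLin_apply, add_zero, tau]
  · rw [transEquiv_apply, transLin_apply, add_zero, tauBar]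
  · rw [conj_exp, starLin_apply, starLin_apply]
    refine ⟨hexp (x w), ?_⟩
    have h := hexp (-x w)
    rwa [neg_neg] at h
  · rw [transEquiv_apply, transLin_diag_apply, hone, hone]
  · rw [transEquiv_apply, transEquiv_apply, transLin_diag_apply, conjLin_apply, conjLin_apply,
      transLin_diag_apply]
  · rw [conj_exp]
    exact transLin_eq_inner hpos w f
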